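/- **Parallel Trimming.** For a simple undirected graph $G=(V,E)$ with $n$ vertices and $m$ edges and for $S\subseteq V$, let $\deg_G(S)=\sum_{v\in S}\deg_G(v)$, and for disjoint $S,T\subseteq V$ let $E(S,T)$ be the set of edges with one endpoint in $S$ and the other in $T$. For $A\subseteq V$ and $\psi\ge 0$, say that - $G[A]$ is a *$\psi$-nearly expander in $G$* if $|E(S,V\setminus S)|\ge\psi\deg_G(S)$ for all $S\subseteq A$ with $\deg_G(S)\le\deg_G(A\setminus S)$; - $G[A]$ is a *$\psi$-expander* if $|E(S,A\setminus S)|\ge\psi\deg_G(S)$ for all $S\subseteq A$ with $\deg_G(S)\le\deg_G(A\setminus S)$. The model of computation is a CREW PRAM: synchronous parallel steps, conditionals and loops over a shared memory of natural numbers, where memory access, addition, truncated subtraction, halving, comparison, and the test $p\le q\varphi$ for numbers $p,q$ and the real parameter $\varphi$ have unit cost. The *work* is the total number of operations; the *span* is the time with unboundedly many processors. There are a deterministic parallel algorithm $\textsc{Trimming}$ and constants $C,k$ such that the following holds for all $G$ (with $V=\{0,\dots,n-1\}$, given as a list of its edges in any order), all real $\varphi\ge 0$ and all $A\subseteq V$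 (given by its indicator array): if $G[A]$ is a $\varphi$-nearly expander in $G$ and $|E(A,V\setminus A)|\le\varphi m$, then $\textsc{Trimming}(G,A,\varphi)$ halts and outputs a set $A'\subseteq A$ such that 1. $G[A']$ is a $\varphi/6$-expander; 2. $\deg_G(A')\ge\deg_G(A)-\frac{4\log^2 n}{\varphi}\,|E(A,V\setminus A)|$, where $\log$ is the natural logarithm, and where for $\varphi=0$ (in which case $|E(A,V\setminus A)|=0$) the subtracted term is read as $0$; 3. $|E(A',V\setminus A')|\le 2\,|E(A,V\setminus A)|$. If moreover $0<\varphi\le1$ and $m\ge1$, then its work is $\tilde O(m/\varphi^2)$ and its span is $\tilde O(1/\varphi^3)$, namely at most $C(\log n)^k\, m/\varphi^2$ and $C(\log n)^k/\varphi^3$ respectively. -/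

import Mathlib

/-! ### Cuts and expanders -/

section Expanders

variable {V : Type*} [Fintype V] [DecidableEq V]

/-- The volume `deg_G(S)`: the sum over `v ∈ S` of the degree of `v` in the whole graph `G`. -/
def vol (G : SimpleGraph V) [DecidableRel G.Adj] (S : Finset V) : ℕ :=
  ∑ v ∈ S, G.degree v

/-- `|E(S, T)|` for disjoint `S` and `T`: the number of edges with one endpoint in `S` and the
other in `T` (each such edge is counted once, as the pair of its endpoint in `S` and its endpoint
in `T`). -/
def cutSize (G : SimpleGraph V) [DecidableRel G.Adj] (S T : Finset V) : ℕ :=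
  (G.interedges S T).card

/-- `G[A]` is a `φ`-nearly expander in `G`. -/
def IsNearlyExpander (G : SimpleGraph V) [DecidableRel G.Adj] (φ : ℝ) (A : Finset V) : Prop :=
  ∀ S ⊆ A, vol G S ≤ vol G (A \ S) → φ * (vol G S : ℝ) ≤ (cutSize G S Sᶜ : ℝ)

/-- `G[A]` is a `φ`-expander: as above, but only edges inside `G[A]` count. Volumes are those of
`G`, so this implies the same inequality with the smaller degrees of `G[A]`. -/
def IsInducedExpander (G : SimpleGraph V) [DecidableRel G.Adj] (φ : ℝ) (A : Finset V) : Prop :=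
  ∀ S ⊆ A, vol G S ≤ vol G (A \ S) → φ * (vol G S : ℝ) ≤ (cutSize G S (A \ S) : ℝ)

end Expanders

/-! ### A parallel machine with work and span

A CREW PRAM in the work-time presentation: a program is a sequential composition of synchronous
parallel steps, with conditionals and loops. Memory cells hold natural numbers, and the only unit
cost operations are addition, truncated subtraction, halving, comparison, access to the shared
memory, and comparison of `p` with `q φ` for numbers `p`, `q` and the real parameter `φ` of the
instance. In particular there is no unit cost multiplication. -/

namespace Pram

/-- The shared memory: cell number `i` of array number `a` holds `M a i`. -/
abbrev Mem := ℕ → ℕ → ℕ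

/-- Expressions that a single processor evaluates. -/
inductive Expr : Type
  /-- a constant of the program -/
  | lit (c : ℕ)
  /-- the number of the processor that evaluates the expression -/
  | tid
  /-- the content of cell `i` of array `a` -/
  | get (a i : Expr)
  | add (x y : Expr)
  | sub (x y : Expr)
  | half (x : Expr)
  /-- `1` if `x ≤ y`, and `0` otherwise -/
  | le (x y : Expr)
  /-- `1` if `x ≤ y φ`, and `0` otherwise -/
  | leParam (x y : Expr)

/-- The value of an expression on processor `t`, with real parameter `φ` and memory `M`. -/
noncomputable def Expr.eval (φ : ℝ) (M : Mem) (t : ℕ) : Expr → ℕ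
  | .lit c => c
  | .tid => t
  | .get a i => M (a.eval φ M t) (i.eval φ M t)
  | .add x y => x.eval φ M t + y.eval φ M t
  | .sub x y => x.eval φ M t - y.eval φ M t
  | .half x => x.eval φ M t / 2
  | .le x y => if x.eval φ M t ≤ y.eval φ M t then 1 else 0
  | .leParam x y =>
      open Classical in if (x.eval φ M t : ℝ) ≤ (y.eval φ M t : ℝ) * φ then 1 else 0

/-- The number of operations in an expression, which is the cost of its evaluation. -/
def Expr.size : Expr → ℕ
  | .lit _ => 1
  | .tid => 1
  | .get a i => a.size + i.size + 1
  | .add x y => x.size + y.size + 1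
  | .sub x y => x.size + y.size + 1
  | .half x => x.size + 1
  | .le x y => x.size + y.size + 1
  | .leParam x y => x.size + y.size + 1

/-- Programs. In the parallel step `pardo k g a i v`, every processor `t < k` evaluates its guard
`g`, and if that is nonzero it writes the value of `v` to cell `i` of array `a`. -/
inductive Prog : Type
  | skip
  | pardo (k g a i v : Expr)
  | seq (P Q : Prog)
  | ite (c : Expr) (P Q : Prog)
  | loop (c : Expr) (P : Prog)

/-- Processor `t < K` takes part in the parallel step and writes to cell `j` of array `b`. -/
def Writes (φ : ℝ) (M : Mem) (K : ℕ) (g a i : Expr) (b j t : ℕ) : Prop :=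
  t < K ∧ g.eval φ M t ≠ 0 ∧ a.eval φ M t = b ∧ i.eval φ M t = j

/-- No two processors write to the same cell. -/
def ExclusiveWrite (φ : ℝ) (M : Mem) (K : ℕ) (g a i : Expr) : Prop :=
  ∀ b j t t', Writes φ M K g a i b j t → Writes φ M K g a i b j t' → t = t'

open Classical in
/-- The memory after a parallel step: all expressions are evaluated in the old memory `M`, and
then all writes take place. -/
noncomputable def parWrite (φ : ℝ) (M : Mem) (K : ℕ) (g a i v : Expr) : Mem := fun b j =>
  if h : ∃ t, Writes φ M K g a i b j t then v.eval φ M (Nat.find h) else M b j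

/-- `Exec φ P M M' w s`: started on memory `M`, with real parameter `φ`, the program `P` halts
with memory `M'`, having performed `w` operations in total (the work), the longest chain of which
that have to be performed one after the other has length `s` (the span). A write conflict makes
the execution fail. Expressions outside of the parallel steps are evaluated by processor `0`. -/
inductive Exec (φ : ℝ) : Prog → Mem → Mem → ℕ → ℕ → Prop
  | skip (M : Mem) : Exec φ .skip M M 0 0
  | pardo (k g a i v : Expr) (M : Mem)
      (hw : ExclusiveWrite φ M (k.eval φ M 0) g a i) :
      Exec φ (.pardo k g a i v) M (parWrite φ M (k.eval φ M 0) g a i v)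
        (k.size + k.eval φ M 0 * (g.size + a.size + i.size + v.size + 1))
        (k.size + (g.size + a.size + i.size + v.size + 1))
  | seq {P Q : Prog} {M M₁ M₂ : Mem} {w₁ w₂ s₁ s₂ : ℕ}
      (h₁ : Exec φ P M M₁ w₁ s₁) (h₂ : Exec φ Q M₁ M₂ w₂ s₂) :
      Exec φ (.seq P Q) M M₂ (w₁ + w₂) (s₁ + s₂)
  | iteTrue {c : Expr} {P Q : Prog} {M M' : Mem} {w s : ℕ}
      (hc : c.eval φ M 0 ≠ 0) (h : Exec φ P M M' w s) :
      Exec φ (.ite c P Q) M M' (c.size + w) (c.size + s)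
  | iteFalse {c : Expr} {P Q : Prog} {M M' : Mem} {w s : ℕ}
      (hc : c.eval φ M 0 = 0) (h : Exec φ Q M M' w s) :
      Exec φ (.ite c P Q) M M' (c.size + w) (c.size + s)
  | loopDone {c : Expr} {P : Prog} {M : Mem}
      (hc : c.eval φ M 0 = 0) :
      Exec φ (.loop c P) M M c.size c.size
  | loopStep {c : Expr} {P : Prog} {M M₁ M₂ : Mem} {w₁ w₂ s₁ s₂ : ℕ}
      (hc : c.eval φ M 0 ≠ 0) (h₁ : Exec φ P M M₁ w₁ s₁)
      (h₂ : Exec φ (.loop c P) M₁ M₂ w₂ s₂) :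
      Exec φ (.loop c P) M M₂ (c.size + w₁ + w₂) (c.size + s₁ + s₂)

/-- `e` lists every edge of `G` exactly once, in any order and with any orientation. -/
def IsEdgeList {n m : ℕ} (G : SimpleGraph (Fin n)) (e : Fin m → Fin n × Fin n) : Prop :=
  Function.Injective (fun k => s((e k).1, (e k).2)) ∧
    Set.range (fun k => s((e k).1, (e k).2)) = G.edgeSet

/-- The memory at the start: array `0` holds `n` and `m`, arrays `1` and `2` hold the endpoints of
the edges, array `3` holds the indicator function of `A`, and all other cells are `0`. -/
def inputMem {n m : ℕ} (e : Fin m → Fin n × Fin n) (A : Finset (Fin n)) : Mem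
  | 0, i => if i = 0 then n else if i = 1 then m else 0
  | 1, i => if h : i < m then ((e ⟨i, h⟩).1 : ℕ) else 0
  | 2, i => if h : i < m then ((e ⟨i, h⟩).2 : ℕ) else 0
  | 3, i => if h : i < n then (if (⟨i, h⟩ : Fin n) ∈ A then 1 else 0) else 0
  | _, _ => 0

/-- The set of vertices that array `3` of the memory marks. -/
def outputSet (n : ℕ) (M : Mem) : Finset (Fin n) :=
  Finset.univ.filter (fun v => M 3 v ≠ 0)

end Pram

/-! Trimming is a flow problem. Every edge leaving `A` sends `q` units into `A`, every edge inside
has capacity `q`, and vertices absorb multiples of their degree. Suppose that on some `A' ⊆ A` all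
mass is absorbed while each vertex takes at most `L` times its degree. What enters `S ⊆ A'` from
outside `A'` is then absorbed in `S` or leaves towards `A' \ S`, so `q |E(S, V \ A')| ≤ L deg(S) + q
|E(S, A' \ S)|` (`Preflow.certificate`). With near expansion and `3 L ≤ 2 q φ` this gives the
constant `φ / 6` (`Progress.isInducedExpander`). The algorithm takes `L = n.size` and `q = ⌈3 L / (2
φ)⌉`.

Mass that cannot be absorbed exposes vertices to remove. There are `L` phases. In phase `p` a vertex
may absorb `p + 1` times its degree, and push-relabel with labels up to `h = 64 q L` runs for `T =
32 q h` synchronous rounds. Let `F` be the mass left unabsorbed before the phase. Vertices with a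
positive label are saturated, so their volume is at most `F`, and the potential argument of
`Labelled.round` leaves at most `F / 16` on active vertices. Ball growing (`exists_sparse_levelCut`)
finds a level whose cut is at most `1 / (32 q)` of the volume on or above it. Removing everything
from that level on creates at most another `F / 16` of mass, because only arcs between adjacent
levels can have residual capacity downwards across the cut. Hence the unabsorbed mass shrinks by a
factor `8` per phase (`Labelled.cut`). It starts at `q |E(A, V \ A)| ≤ q φ m < 8 ^ L`
(`start_mass_lt`), so it is zero after `L` phases.

A removed vertex holds at least its degree in mass, and this mass came from the boundary. The
invariant `Progress.cut` records the trade: the boundary never grows, and the lost volume is at most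
`16 q / 15` times the original boundary. `loss_le_log_sq` turns this into the natural logarithm.

On the machine, a round amounts to sums over the arcs of each vertex. These arcs are scattered
through the edge list, so the sums run up a binary tree over all arcs along precomputed pointers
(`pointerStep_spec`, `sumProg_spec`). At most `2 m` processors are used in each step, so the work is
at most `2 m` times the bound on the span, which is of order `L ^ 3 q ^ 2`. -/

namespace Pram

/-! ### Verification of programs -/

/-- The value of the guard `g` is nonzero. -/
def Expr.Holds (φ : ℝ) (M : Mem) (t : ℕ) (g : Expr) : Prop := g.eval φ M t ≠ 0

/-- Started on `M`, the program `P` halts in a memory that satisfies `Q`, with span at most `S` and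
work at most `N * S`. -/
def Runs (φ : ℝ) (N : ℕ) (P : Prog) (M : Mem) (S : ℕ) (Q : Mem → Prop) : Prop :=
  ∃ M' w s, Exec φ P M M' w s ∧ s ≤ S ∧ w ≤ N * S ∧ Q M'

variable {φ : ℝ} {N : ℕ} {M : Mem} {Q R : Mem → Prop}

theorem Runs.mono {P : Prog} {S S' : ℕ} (h : Runs φ N P M S Q) (hS : S ≤ S')
    (hQ : ∀ M', Q M' → R M') : Runs φ N P M S' R := by
  obtain ⟨M', w, s, h₁, h₂, h₃, h₄⟩ := h
  exact ⟨M', w, s, h₁, h₂.trans hS, h₃.trans (Nat.mul_le_mul_left _ hS), hQ _ h₄⟩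

theorem Runs.mono_cost {P : Prog} {S S' : ℕ} (h : Runs φ N P M S Q) (hS : S ≤ S') :
    Runs φ N P M S' Q := h.mono hS fun _ => id

theorem Runs.skip {S : ℕ} (h : Q M) : Runs φ N .skip M S Q :=
  ⟨M, 0, 0, .skip M, by omega, by omega, h⟩

/-- The specification of `P'` serves as the postcondition of `P`. Specifications thus chain in
continuation style, and no intermediate assertion has to be named. -/
theorem Runs.seq {P P' : Prog} {S S' : ℕ}
    (h : Runs φ N P M S fun M' => Runs φ N P' M' S' Q) : Runs φ N (.seq P P') M (S + S') Q := by
  obtain ⟨M', w, s, h₁, h₂, h₃, M'', w', s', h₁', h₂', h₃', h₄⟩ := h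
  exact ⟨M'', _, _, .seq h₁ h₁', by omega, by rw [mul_add]; omega, h₄⟩

open Classical in
/-- The memory after a parallel step in which processor `j < K` writes to cell `j` of array `a`. -/
noncomputable def store (φ : ℝ) (M : Mem) (K : ℕ) (g : Expr) (a : ℕ) (v : Expr) : Mem :=
  Function.update M a fun j => if j < K ∧ g.Holds φ M j then v.eval φ M j else M a j

theorem store_self {K a : ℕ} {g v : Expr} {j : ℕ} (hj : j < K) (hg : g.Holds φ M j) :
    store φ M K g a v a j = v.eval φ M j := by
  simp [store, hj, hg]

theorem store_of_not {K a : ℕ} {g v : Expr} {j : ℕ} (hg : ¬ g.Holds φ M j) :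
    store φ M K g a v a j = M a j := by
  simp [store, hg]

theorem store_of_le {K a : ℕ} {g v : Expr} {j : ℕ} (hj : K ≤ j) :
    store φ M K g a v a j = M a j := by
  simp [store, Nat.not_lt.2 hj]

theorem store_of_ne {K a : ℕ} {g v : Expr} {b : ℕ} (hb : b ≠ a) :
    store φ M K g a v b = M b := by
  simp [store, hb]

/-- Since processor `t` addresses only cell `t`, the writer of cell `j` can only be `j`, so the
choice made by `Nat.find` is forced. -/
theorem parWrite_eq_store {K a₀ : ℕ} {g a v : Expr} (ha : ∀ t, a.eval φ M t = a₀) :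
    parWrite φ M K g a .tid v = store φ M K g a₀ v := by
  classical
  funext b j
  unfold parWrite
  have hW : ∀ t, Writes φ M K g a .tid b j t ↔ (b = a₀ ∧ t = j ∧ j < K ∧ g.Holds φ M j) := by
    intro t
    simp only [Writes, ha, Expr.eval, Expr.Holds]
    constructor
    · rintro ⟨h₁, h₂, h₃, rfl⟩
      exact ⟨h₃.symm, rfl, h₁, h₂⟩
    · rintro ⟨rfl, rfl, h₁, h₂⟩
      exact ⟨h₁, h₂, rfl, rfl⟩
  by_cases h : b = a₀ ∧ j < K ∧ g.Holds φ M j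
  · obtain ⟨rfl, h₁, h₂⟩ := h
    have hex : ∃ t, Writes φ M K g a .tid b j t := ⟨j, (hW j).2 ⟨rfl, rfl, h₁, h₂⟩⟩
    rw [dif_pos hex, store_self h₁ h₂]
    have := ((hW _).1 (Nat.find_spec hex)).2.1
    rw [this]
  · rw [dif_neg]
    · by_cases hb : b = a₀
      · subst hb
        have : ¬ (j < K ∧ g.Holds φ M j) := fun h' => h ⟨rfl, h'⟩
        simp [store, this]
      · rw [store_of_ne hb]
    · rintro ⟨t, ht⟩
      obtain ⟨h₁, -, h₂⟩ := (hW t).1 ht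
      exact h ⟨h₁, h₂⟩

theorem Runs.pardo (hN : 0 < N) {k g a v : Expr} {K a₀ S : ℕ} (hk : k.eval φ M 0 = K) (hK : K ≤ N)
    (ha : ∀ t, a.eval φ M t = a₀) (hS : k.size + (g.size + a.size + 1 + v.size + 1) ≤ S)
    (hQ : Q (store φ M K g a₀ v)) : Runs φ N (.pardo k g a .tid v) M S Q := by
  refine ⟨_, _, _, .pardo k g a .tid v M ?_, hS, ?_, ?_⟩
  · rintro b j t t' ⟨-, -, -, h⟩ ⟨-, -, -, h'⟩
    simp only [Expr.eval] at h h'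
    omega
  · refine le_trans ?_ (Nat.mul_le_mul_left N hS)
    rw [hk, Nat.mul_add N]
    exact add_le_add (Nat.le_mul_of_pos_left _ hN) (Nat.mul_le_mul hK le_rfl)
  · rwa [parWrite_eq_store ha, hk]

/-- The scatter step: processor `t < K` writes to a cell that depends on `t`. -/
theorem Runs.scatter (hN : 0 < N) {k g a i v : Expr} {K S : ℕ} (hk : k.eval φ M 0 = K) (hK : K ≤ N)
    (hex : ∀ t t', t < K → t' < K → g.Holds φ M t → g.Holds φ M t' →
      a.eval φ M t = a.eval φ M t' → i.eval φ M t = i.eval φ M t' → t = t')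
    (hS : k.size + (g.size + a.size + i.size + v.size + 1) ≤ S)
    (hQ : ∀ M', (∀ t < K, g.Holds φ M t → M' (a.eval φ M t) (i.eval φ M t) = v.eval φ M t) →
      (∀ b j, (∀ t < K, g.Holds φ M t → a.eval φ M t = b → i.eval φ M t ≠ j) →
        M' b j = M b j) → Q M') :
    Runs φ N (.pardo k g a i v) M S Q := by
  have hew : ExclusiveWrite φ M (k.eval φ M 0) g a i := by
    rintro b j t t' ⟨h₁, h₂, h₃, h₄⟩ ⟨h₁', h₂', h₃', h₄'⟩
    exact hex t t' (hk ▸ h₁) (hk ▸ h₁') h₂ h₂' (h₃.trans h₃'.symm) (h₄.trans h₄'.symm)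
  refine ⟨_, _, _, .pardo k g a i v M hew, hS, ?_, hQ _ ?_ ?_⟩
  · refine le_trans ?_ (Nat.mul_le_mul_left N hS)
    rw [hk, Nat.mul_add N]
    exact add_le_add (Nat.le_mul_of_pos_left _ hN) (Nat.mul_le_mul hK le_rfl)
  · intro t ht hg
    have hw : Writes φ M (k.eval φ M 0) g a i (a.eval φ M t) (i.eval φ M t) t :=
      ⟨hk ▸ ht, hg, rfl, rfl⟩
    have hx : ∃ t', Writes φ M (k.eval φ M 0) g a i (a.eval φ M t) (i.eval φ M t) t' := ⟨t, hw⟩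
    classical
    unfold parWrite
    rw [dif_pos hx]
    have := hew _ _ _ _ (Nat.find_spec hx) hw
    convert congrArg (fun t' => v.eval φ M t') this
  · intro b j h
    unfold parWrite
    rw [dif_neg]
    rintro ⟨t, h₁, h₂, h₃, h₄⟩
    exact h t (hk ▸ h₁) h₂ h₃ h₄

theorem Runs.ite (hN : 0 < N) {c : Expr} {P P' : Prog} {S S' : ℕ}
    (h₁ : c.Holds φ M 0 → Runs φ N P M S Q) (h₂ : ¬ c.Holds φ M 0 → Runs φ N P' M S Q)
    (hS : c.size + S ≤ S') :
    Runs φ N (.ite c P P') M S' Q := by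
  have hc : c.size ≤ N * c.size := Nat.le_mul_of_pos_left _ hN
  have hS' := Nat.mul_le_mul_left N hS
  rw [mul_add] at hS'
  by_cases h : c.Holds φ M 0
  · obtain ⟨M', w, s, h₁, h₂, h₃, h₄⟩ := h₁ h
    exact ⟨M', _, _, .iteTrue h h₁, by omega, by omega, h₄⟩
  · obtain ⟨M', w, s, h₁, h₂, h₃, h₄⟩ := h₂ h
    exact ⟨M', _, _, .iteFalse (not_not.1 h) h₁, by omega, by omega, h₄⟩

/-- A loop that performs `n` iterations and maintains the invariant `I`. -/
theorem Runs.loop (hN : 0 < N) {c : Expr} {P : Prog} (I : ℕ → Mem → Prop) (n S : ℕ) {S' : ℕ}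
    (h₀ : I 0 M)
    (hstep : ∀ i M, i < n → I i M → c.Holds φ M 0 ∧ Runs φ N P M S (I (i + 1)))
    (hdone : ∀ M, I n M → ¬ c.Holds φ M 0) (hS : n * (c.size + S) + c.size ≤ S')
    (hQ : ∀ M', I n M' → Q M') :
    Runs φ N (.loop c P) M S' Q := by
  -- The induction is on the number `d` of remaining iterations, because the loop rule peels off the
  -- first one.
  suffices H : ∀ d i M, i + d = n → I i M →
      Runs φ N (.loop c P) M (d * (c.size + S) + c.size) (I n) from
    (H n 0 M (by omega) h₀).mono hS hQ
  have hc : c.size ≤ N * c.size := Nat.le_mul_of_pos_left _ hN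
  intro d
  induction d with
  | zero =>
    intro i M hi hI
    obtain rfl : i = n := by omega
    exact ⟨M, _, _, .loopDone (not_not.1 (hdone M hI)), by omega, by simpa using hc, hI⟩
  | succ d ih =>
    intro i M hi hI
    obtain ⟨hcond, M₁, w₁, s₁, e₁, hs₁, hw₁, hI₁⟩ := hstep i M (by omega) hI
    obtain ⟨M₂, w₂, s₂, e₂, hs₂, hw₂, hI₂⟩ := ih (i + 1) M₁ (by omega) hI₁
    refine ⟨M₂, _, _, .loopStep hcond e₁ e₂, ?_, ?_, hI₂⟩
    · rw [Nat.succ_mul]; omega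
    · have : N * ((d + 1) * (c.size + S) + c.size)
          = N * (d * (c.size + S) + c.size) + N * c.size + N * S := by ring
      omega

/-! ### Abbreviations for programs -/

/-- Cell `0` of array `a`, used as a scalar variable. -/
abbrev Expr.var (a : ℕ) : Expr := .get (.lit a) (.lit 0)

/-- The cell of array `a` whose number is the number of the processor. -/
abbrev Expr.own (a : ℕ) : Expr := .get (.lit a) .tid

abbrev Expr.dbl (x : Expr) : Expr := .add x x

abbrev Expr.lt (x y : Expr) : Expr := .le (.add x (.lit 1)) y

/-- The minimum of `x` and `y`, which is also their conjunction. -/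
abbrev Expr.min (x y : Expr) : Expr := .sub x (.sub x y)

abbrev Expr.not (x : Expr) : Expr := .le x (.lit 0)

section Holds

variable {t : ℕ} {x y : Expr}

@[simp] theorem holds_le : (Expr.le x y).Holds φ M t ↔ x.eval φ M t ≤ y.eval φ M t := by
  simp [Expr.Holds, Expr.eval]

@[simp] theorem holds_leParam :
    (Expr.leParam x y).Holds φ M t ↔ (x.eval φ M t : ℝ) ≤ (y.eval φ M t : ℝ) * φ := by
  simp [Expr.Holds, Expr.eval]

@[simp] theorem holds_lit_one : (Expr.lit 1).Holds φ M t := by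
  simp [Expr.Holds, Expr.eval]

@[simp] theorem holds_get : (Expr.get x y).Holds φ M t ↔ M (x.eval φ M t) (y.eval φ M t) ≠ 0 := by
  simp [Expr.Holds, Expr.eval]

@[simp] theorem holds_min : (Expr.min x y).Holds φ M t ↔ x.Holds φ M t ∧ y.Holds φ M t := by
  simp only [Expr.Holds, Expr.eval]
  omega

theorem holds_not : (Expr.not x).Holds φ M t ↔ ¬ x.Holds φ M t := by
  simp [Expr.Holds, Expr.eval]

end Holds

/-- Assignment to a scalar variable. -/
abbrev Prog.assign (a : ℕ) (v : Expr) : Prog := .pardo (.lit 1) (.lit 1) (.lit a) .tid v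

/-- A parallel step over all arcs, whose number is in the scalar variable `4`. -/
abbrev Prog.arcs (a : ℕ) (g v : Expr) : Prog := .pardo (.var 4) g (.lit a) .tid v

theorem Runs.assign (hN : 0 < N) {a : ℕ} {v : Expr} {S : ℕ} (hS : v.size + 5 ≤ S)
    (hQ : ∀ M', M' a 0 = v.eval φ M 0 → (∀ b, b ≠ a → M' b = M b) → Q M') :
    Runs φ N (.assign a v) M S Q := by
  refine Runs.pardo hN (K := 1) rfl hN (fun _ => rfl) ?_ (hQ _ ?_ ?_)
  · simp only [Expr.size]; omega
  · exact store_self one_pos holds_lit_one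
  · exact fun b hb => store_of_ne hb

theorem Runs.arcs (hN : 0 < N) {a : ℕ} {g v : Expr} {S : ℕ} (hM : M 4 0 = N)
    (hS : g.size + v.size + 6 ≤ S)
    (hQ : ∀ M', (∀ t < N, g.Holds φ M t → M' a t = v.eval φ M t) →
      (∀ t, ¬ g.Holds φ M t → M' a t = M a t) → (∀ t, N ≤ t → M' a t = M a t) →
      (∀ b, b ≠ a → M' b = M b) → Q M') :
    Runs φ N (.arcs a g v) M S Q := by
  refine Runs.pardo hN (K := N) hM le_rfl (fun _ => rfl) ?_ (hQ _ ?_ ?_ ?_ ?_)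
  · simp only [Expr.size]; omega
  · exact fun t ht hg => store_self ht hg
  · exact fun t hg => store_of_not hg
  · exact fun t ht => store_of_le ht
  · exact fun b hb => store_of_ne hb

end Pram

namespace Trim

/-! ### Preflows on arcs

A graph is given by its arcs: the arc `t` leaves `src t`, and `rev t` is the same edge in the
opposite direction. A flow of capacity `q` is given by the residual capacities `r t ∈ [0, 2q]`. -/

section Sums

variable {ι V : Type*} [Fintype ι] [DecidableEq V] (src : ι → V) (rev : ι → ι)

/-- The sum of `f` over the arcs that leave `v`. -/
def outSum (f : ι → ℕ) (v : V) : ℕ := ∑ t with src t = v, f t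

/-- The number of arcs that leave `v`. -/
def outDeg (v : V) : ℕ := outSum src (fun _ => 1) v

/-- The sum of `f` over the arcs from `S` to `T`. -/
def across (f : ι → ℕ) (S T : Finset V) : ℕ := ∑ t with src t ∈ S ∧ src (rev t) ∈ T, f t

theorem outSum_const (c : ℕ) (v : V) : outSum src (fun _ => c) v = c * outDeg src v := by
  simp [outDeg, outSum, mul_comm]

theorem outSum_add (f g : ι → ℕ) (v : V) :
    outSum src (fun t => f t + g t) v = outSum src f v + outSum src g v :=
  Finset.sum_add_distrib

variable {src} in
theorem outSum_mono {f g : ι → ℕ} {v : V} (h : ∀ t, src t = v → f t ≤ g t) :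
    outSum src f v ≤ outSum src g v :=
  Finset.sum_le_sum fun t ht => h t (Finset.mem_filter.1 ht).2

variable {src} in
theorem outSum_congr {f g : ι → ℕ} {v : V} (h : ∀ t, src t = v → f t = g t) :
    outSum src f v = outSum src g v :=
  Finset.sum_congr rfl fun t ht => h t (Finset.mem_filter.1 ht).2

theorem sum_outSum (f : ι → ℕ) (S : Finset V) :
    ∑ v ∈ S, outSum src f v = ∑ t with src t ∈ S, f t := by
  unfold outSum
  rw [← Finset.sum_fiberwise_of_maps_to (s := Finset.univ.filter fun t => src t ∈ S) (t := S)
    (g := src) (fun t ht => (Finset.mem_filter.1 ht).2)]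
  refine Finset.sum_congr rfl fun v hv => Finset.sum_congr ?_ fun _ _ => rfl
  ext t
  simp only [Finset.mem_filter, Finset.mem_univ, true_and]
  exact ⟨fun h => ⟨h ▸ hv, h⟩, fun h => h.2⟩

theorem sum_outSum_univ [Fintype V] (f : ι → ℕ) : ∑ v, outSum src f v = ∑ t, f t := by
  simp [sum_outSum]

theorem sum_outSum_mul [Fintype V] (f : ι → ℕ) (g : V → ℕ) :
    ∑ v, outSum src f v * g v = ∑ t, f t * g (src t) := by
  rw [← sum_outSum_univ src]
  refine Finset.sum_congr rfl fun v _ => ?_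
  unfold outSum
  rw [Finset.sum_mul]
  exact Finset.sum_congr rfl fun t ht => by simp only [(Finset.mem_filter.1 ht).2]

theorem across_add (f g : ι → ℕ) (S T : Finset V) :
    across src rev (fun t => f t + g t) S T = across src rev f S T + across src rev g S T :=
  Finset.sum_add_distrib

theorem across_const (c : ℕ) (S T : Finset V) :
    across src rev (fun _ => c) S T = c * across src rev (fun _ => 1) S T := by
  simp [across, mul_comm]

variable {src rev} in
theorem across_mono {f g : ι → ℕ} {S T : Finset V}
    (h : ∀ t, src t ∈ S → src (rev t) ∈ T → f t ≤ g t) :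
    across src rev f S T ≤ across src rev g S T :=
  Finset.sum_le_sum fun t ht => by
    have := (Finset.mem_filter.1 ht).2
    exact h t this.1 this.2

variable {src rev} in
theorem across_congr {f g : ι → ℕ} {S T : Finset V}
    (h : ∀ t, src t ∈ S → src (rev t) ∈ T → f t = g t) :
    across src rev f S T = across src rev g S T :=
  le_antisymm (across_mono fun t h₁ h₂ => (h t h₁ h₂).le)
    (across_mono fun t h₁ h₂ => (h t h₁ h₂).ge)

theorem across_union_right (f : ι → ℕ) (S : Finset V) {T T' : Finset V} (h : Disjoint T T') :
    across src rev f S (T ∪ T') = across src rev f S T + across src rev f S T' := by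
  classical
  unfold across
  rw [← Finset.sum_union]
  · refine Finset.sum_congr ?_ fun _ _ => rfl
    ext t
    simp only [Finset.mem_filter, Finset.mem_univ, true_and, Finset.mem_union]
    tauto
  · rw [Finset.disjoint_filter]
    exact fun t _ h₁ h₂ => Finset.disjoint_left.1 h h₁.2 h₂.2

theorem across_union_left (f : ι → ℕ) {S S' : Finset V} (T : Finset V) (h : Disjoint S S') :
    across src rev f (S ∪ S') T = across src rev f S T + across src rev f S' T := by
  classical
  unfold across
  rw [← Finset.sum_union]
  · refine Finset.sum_congr ?_ fun _ _ => rfl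
    ext t
    simp only [Finset.mem_filter, Finset.mem_univ, true_and, Finset.mem_union]
    tauto
  · rw [Finset.disjoint_filter]
    exact fun t _ h₁ h₂ => Finset.disjoint_left.1 h h₁.1 h₂.1

theorem sum_outSum_eq_across [Fintype V] (f : ι → ℕ) (S : Finset V) :
    ∑ v ∈ S, outSum src f v = across src rev f S Finset.univ := by
  rw [sum_outSum]
  simp [across]

variable {rev} (hrev : Function.Involutive rev)
include hrev

theorem sum_comp_rev (f : ι → ℕ) : ∑ t, f (rev t) = ∑ t, f t :=
  Equiv.sum_comp (hrev.toPerm rev) f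

theorem across_rev (f : ι → ℕ) (S T : Finset V) :
    across src rev (fun t => f (rev t)) S T = across src rev f T S := by
  unfold across
  refine Finset.sum_bij' (fun t _ => rev t) (fun t _ => rev t) ?_ ?_ ?_ ?_ ?_
  · intro t ht
    simp only [Finset.mem_filter, Finset.mem_univ, true_and] at ht ⊢
    rw [hrev t]
    exact ht.symm
  · intro t ht
    simp only [Finset.mem_filter, Finset.mem_univ, true_and] at ht ⊢
    rw [hrev t]
    exact ht.symm
  · exact fun t _ => hrev t
  · exact fun t _ => hrev t
  · exact fun t _ => rfl

end Sums

/-! ### Synchronous push-relabel and its potential -/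

section Flow

variable {ι V : Type*} [Fintype ι] [Fintype V] [DecidableEq V] (src : ι → V) (rev : ι → ι)

/-- The residual capacities `r` belong to a flow of capacity `q` inside `A`, in which every arc
from `A` to its complement brings `q` units into `A`. -/
structure Preflow (A : Finset V) (q : ℕ) (r : ι → ℕ) : Prop where
  inner : ∀ t, src t ∈ A → src (rev t) ∈ A → r t + r (rev t) = 2 * q
  boundary : ∀ t, src t ∈ A → src (rev t) ∉ A → r t = 2 * q

/-- The mass at `v`, which is `outSum src r v - q * outDeg src v`, in excess of
`(c - q) * outDeg src v`. -/
def excess (c : ℕ) (r : ι → ℕ) (v : V) : ℕ := outSum src r v - c * outDeg src v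

/-- The excess of the active vertices: those in `A` with a label less than `h`. -/
def active (A : Finset V) (h c : ℕ) (r : ι → ℕ) (l : V → ℕ) (v : V) : ℕ :=
  if v ∈ A ∧ l v < h then excess src c r v else 0

/-- The residual capacity of the admissible arcs. -/
def adm (A : Finset V) (r : ι → ℕ) (l : V → ℕ) (t : ι) : ℕ :=
  if src t ∈ A ∧ src (rev t) ∈ A ∧ l (src (rev t)) + 1 = l (src t) then r t else 0

/-- The invariant of push-relabel after `k` rounds, where each vertex absorbs `p + 1` times its
degree and all excess was absorbed except for `F` if it absorbed `p` times its degree. -/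
structure Labelled (A : Finset V) (q p h F k : ℕ) (r : ι → ℕ) (l : V → ℕ) : Prop where
  flow : Preflow src rev A q r
  valid : ∀ t, src t ∈ A → src (rev t) ∈ A → l (src (rev t)) + 1 < l (src t) → r t = 0
  le_height : ∀ v, l v ≤ h
  mem : ∀ v, 1 ≤ l v → v ∈ A ∧ 0 < outDeg src v
  sat : ∀ v, 1 ≤ l v → (q + p + 1) * outDeg src v ≤ outSum src r v
  mass : ∑ v ∈ A, excess src (q + p) r v ≤ F
  potential : k * ∑ v, active src A h (q + p + 1) r l v
      + ∑ v, active src A h (q + p + 1) r l v * l v ≤ 2 * q * ∑ v, outDeg src v * l v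

variable {src rev} {A : Finset V} {q p h F k : ℕ} {r : ι → ℕ} {l : V → ℕ}

omit [Fintype ι] [Fintype V] in
theorem Preflow.le (hr : Preflow src rev A q r) {t : ι} (ht : src t ∈ A) : r t ≤ 2 * q := by
  by_cases h' : src (rev t) ∈ A
  · have := hr.inner t ht h'; omega
  · exact (hr.boundary t ht h').le

-- The net flow into `v` along one arc is at most `q`, as residual capacities are at most `2 * q`.
-- Relabellings are charged against this bound.
omit [Fintype V] in
theorem Preflow.excess_le (hr : Preflow src rev A q r) {c : ℕ} (hc : q ≤ c) {v : V} (hv : v ∈ A) :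
    excess src c r v ≤ q * outDeg src v := by
  have h₁ : outSum src r v ≤ outSum src (fun _ => 2 * q) v :=
    outSum_mono fun t ht => hr.le (ht ▸ hv)
  rw [outSum_const] at h₁
  have h₂ := Nat.mul_le_mul_right (outDeg src v) hc
  have h₃ : 2 * q * outDeg src v = q * outDeg src v + q * outDeg src v := by ring
  unfold excess
  omega

theorem Labelled.init (hr : Preflow src rev A q r)
    (hF : ∑ v ∈ A, excess src (q + p) r v ≤ F) :
    Labelled src rev A q p h F 0 r (fun _ => 0) where
  flow := hr
  valid := by simp
  le_height := by simp
  mem := by simp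
  sat := by simp
  mass := hF
  potential := by simp

/-- An active vertex either pushes all of its excess one label down, or saturates its admissible
arcs and is relabelled. A relabelling raises the right side of `potential` by `2 * q` times the
degree. One half pays for the excess that was not pushed, the other half for lifting the excess by
one label. -/
theorem Labelled.round (hrev : Function.Involutive rev) (H : Labelled src rev A q p h F k r l)
    {push r' : ι → ℕ} {l' : V → ℕ} (hpush : ∀ t, push t ≤ adm src rev A r l t)
    (hsum : ∀ v, outSum src push v
      = min (active src A h (q + p + 1) r l v) (outSum src (adm src rev A r l) v))
    (hl' : ∀ v, l' v = if outSum src (adm src rev A r l) v < active src A h (q + p + 1) r l v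
      then l v + 1 else l v)
    (hr' : ∀ t, r' t = r t + push (rev t) - push t) :
    Labelled src rev A q p h F (k + 1) r' l' := by
  set act := active src A h (q + p + 1) r l with hact
  set act' := active src A h (q + p + 1) r' l' with hact'
  set ad := adm src rev A r l with had
  have had_le : ∀ t, ad t ≤ r t := by
    intro t; rw [had]; unfold adm; split_ifs <;> simp
  have hpush_le : ∀ t, push t ≤ r t := fun t => (hpush t).trans (had_le t)
  have hpush0 : ∀ t, ¬ (src t ∈ A ∧ src (rev t) ∈ A ∧ l (src (rev t)) + 1 = l (src t)) →
      push t = 0 := by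
    intro t ht
    have := hpush t
    rw [had] at this
    unfold adm at this
    rw [if_neg ht] at this
    omega
  have hact_pos : ∀ v, 0 < act v → v ∈ A ∧ l v < h ∧ act v = excess src (q + p + 1) r v := by
    intro v hv
    by_cases h' : v ∈ A ∧ l v < h
    · exact ⟨h'.1, h'.2, by simp [hact, active, h']⟩
    · simp [hact, active, h'] at hv
  have hflow' : Preflow src rev A q r' := by
    refine ⟨fun t h₁ h₂ => ?_, fun t h₁ h₂ => ?_⟩
    · have e := H.flow.inner t h₁ h₂
      have e₁ := hr' t
      have e₂ := hr' (rev t)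
      rw [hrev t] at e₂
      have := hpush_le t
      have := hpush_le (rev t)
      omega
    · rw [hr', hpush0 t (by tauto), hpush0 (rev t) (by rw [hrev t]; tauto)]
      exact H.flow.boundary t h₁ h₂
  have hbal : ∀ v, outSum src r' v + outSum src push v
      = outSum src r v + outSum src (fun t => push (rev t)) v := by
    intro v
    rw [← outSum_add, ← outSum_add]
    refine outSum_congr fun t _ => ?_
    have := hr' t
    have := hpush_le t
    omega
  have hout_act : ∀ v, outSum src push v ≤ act v := fun v => by rw [hsum]; exact min_le_left _ _
  have hl_le : ∀ v, l v ≤ l' v := fun v => by rw [hl']; split_ifs <;> omega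
  have hin0 : ∀ v, h ≤ l v + 1 → outSum src (fun t => push (rev t)) v = 0 := by
    intro v hv
    refine Finset.sum_eq_zero fun t ht => ?_
    have ht := (Finset.mem_filter.1 ht).2
    by_contra hne
    have hadm : l (src t) + 1 = l (src (rev t)) := by
      by_contra hcon
      refine hne (hpush0 (rev t) ?_)
      rw [hrev t]
      tauto
    have h1 : 0 < outSum src push (src (rev t)) :=
      lt_of_lt_of_le (Nat.pos_of_ne_zero hne)
        (Finset.single_le_sum (f := push) (fun _ _ => Nat.zero_le _) (by simp))
    have := (hact_pos _ (h1.trans_le (hout_act _))).2.1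
    rw [ht] at hadm
    omega
  -- Only excess above the threshold is pushed, so a saturated vertex stays saturated.
  have hsat_keep : ∀ v, (q + p + 1) * outDeg src v ≤ outSum src r v →
      (q + p + 1) * outDeg src v ≤ outSum src r' v := by
    intro v hv
    have h1 := hbal v
    have h2 := hout_act v
    by_cases h0 : 0 < act v
    · have h3 := (hact_pos v h0).2.2
      unfold excess at h3
      omega
    · omega
  -- The pushed mass lies above the threshold `q + p + 1`, so it is counted in full in the excess
  -- over `q + p`, and the truncated subtraction loses nothing.
  have hex : ∀ v, excess src (q + p) r' v + outSum src push v
      ≤ excess src (q + p) r v + outSum src (fun t => push (rev t)) v := by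
    intro v
    have h1 := hbal v
    have h2 := hout_act v
    have h4 : (q + p) * outDeg src v ≤ (q + p + 1) * outDeg src v :=
      Nat.mul_le_mul_right _ (by omega)
    by_cases h0 : 0 < act v
    · have h3 := (hact_pos v h0).2.2
      unfold excess at h3 ⊢
      omega
    · unfold excess
      omega
  have hactex : ∀ v, act' v + outSum src push v
      ≤ act v + outSum src (fun t => push (rev t)) v := by
    intro v
    have h1 := hbal v
    have h2 := hout_act v
    by_cases h5 : v ∈ A ∧ l' v < h
    · have h6 : act' v = excess src (q + p + 1) r' v := by simp [hact', active, h5]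
      have h7 : act v = excess src (q + p + 1) r v := by
        simp [hact, active, h5.1, (hl_le v).trans_lt h5.2]
      rw [h6]
      unfold excess at h7 ⊢
      omega
    · have h6 : act' v = 0 := by simp [hact', active, h5]
      omega
  have hact'_le : ∀ v, act' v ≤ q * outDeg src v := by
    intro v
    by_cases h5 : v ∈ A ∧ l' v < h
    · have h6 : act' v = excess src (q + p + 1) r' v := by simp [hact', active, h5]
      rw [h6]
      exact hflow'.excess_le (by omega) h5.1
    · have h6 : act' v = 0 := by simp [hact', active, h5]
      omega
  have hact_le : ∀ v, act v ≤ q * outDeg src v := by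
    intro v
    by_cases h0 : 0 < act v
    · obtain ⟨h1, -, h3⟩ := hact_pos v h0
      rw [h3]
      exact H.flow.excess_le (by omega) h1
    · omega
  have hin_out : ∑ v, outSum src (fun t => push (rev t)) v = ∑ v, outSum src push v := by
    rw [sum_outSum_univ, sum_outSum_univ, sum_comp_rev hrev]
  refine ⟨hflow', ?_, ?_, ?_, ?_, ?_, ?_⟩
  · intro t h₁ h₂ h₃
    have e := hr' t
    have hl2 := hl_le (src (rev t))
    have hl1 := hl' (src t)
    by_cases hrel : outSum src ad (src t) < act (src t)
    · rw [if_pos hrel] at hl1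
      have hp0 : push (rev t) = 0 := hpush0 _ (by rw [hrev t]; omega)
      by_cases hlt : l (src (rev t)) + 1 < l (src t)
      · have := H.valid t h₁ h₂ hlt
        omega
      -- An arc that becomes steep through the relabelling of its tail was admissible before. Total
      -- push equals total admissible capacity and is bounded by it arc by arc, so this arc is
      -- saturated.
      · have hadt : ad t = r t := by
          simp only [had, adm]
          rw [if_pos ⟨h₁, h₂, by omega⟩]
        have hsumeq : outSum src push (src t) = outSum src ad (src t) := by
          rw [hsum, min_eq_right hrel.le]
        have := (Finset.sum_eq_sum_iff_of_le
          (s := Finset.univ.filter fun t' => src t' = src t) (fun t' _ => hpush t')).1 hsumeq t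
            (by simp)
        omega
    · rw [if_neg hrel] at hl1
      have hp0 : push (rev t) = 0 := hpush0 _ (by rw [hrev t]; omega)
      have := H.valid t h₁ h₂ (by omega)
      omega
  · intro v
    have := hl' v
    have := H.le_height v
    by_cases hrel : outSum src ad v < act v
    · have := (hact_pos v (by omega)).2.1
      rw [if_pos hrel] at *
      omega
    · rw [if_neg hrel] at *
      omega
  · intro v hv
    by_cases hrel : outSum src ad v < act v
    · refine ⟨(hact_pos v (by omega)).1, Nat.pos_of_ne_zero fun h0 => ?_⟩
      have := hact_le v
      rw [h0] at this
      omega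
    · rw [hl', if_neg hrel] at hv
      exact H.mem v hv
  · intro v hv
    by_cases hrel : outSum src ad v < act v
    · have := (hact_pos v (by omega)).2.2
      unfold excess at this
      exact hsat_keep v (by omega)
    · rw [hl', if_neg hrel] at hv
      exact hsat_keep v (H.sat v hv)
  · refine le_trans ?_ H.mass
    have h1 := Finset.sum_le_sum fun v (_ : v ∈ A) => hex v
    rw [Finset.sum_add_distrib, Finset.sum_add_distrib] at h1
    have h2 : ∑ v ∈ A, outSum src (fun t => push (rev t)) v ≤ ∑ v ∈ A, outSum src push v := by
      calc _ ≤ ∑ v, outSum src (fun t => push (rev t)) v :=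
            Finset.sum_le_sum_of_subset (Finset.subset_univ _)
        _ = ∑ v, outSum src push v := hin_out
        _ = _ := by
            refine (Finset.sum_subset (Finset.subset_univ _) fun v _ hv => ?_).symm
            have := hout_act v
            by_contra hne
            exact hv (hact_pos v (by omega)).1
    omega
  -- The sum of `ρ` is the growth of the degree-weighted labels; the unpushed excess and the lifted
  -- excess are each at most `q` times it.
  · set ρ : V → ℕ := fun v => if outSum src ad v < act v then outDeg src v else 0 with hρ
    have hX : ∑ v, act' v ≤ ∑ v, act v := by
      have h1 := Finset.sum_le_sum fun v (_ : v ∈ Finset.univ) => hactex v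
      rw [Finset.sum_add_distrib, Finset.sum_add_distrib] at h1
      omega
    have h1 : ∑ v, act v ≤ ∑ v, outSum src push v + q * ∑ v, ρ v := by
      rw [Finset.mul_sum, ← Finset.sum_add_distrib]
      refine Finset.sum_le_sum fun v _ => ?_
      have := hact_le v
      have := hsum v
      simp only [hρ]
      split_ifs <;> omega
    have h2 : ∑ v, act' v * l' v + ∑ v, outSum src push v * l v
        ≤ ∑ v, act v * l v + ∑ v, outSum src (fun t => push (rev t)) v * l v
          + q * ∑ v, ρ v := by
      rw [Finset.mul_sum, ← Finset.sum_add_distrib, ← Finset.sum_add_distrib,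
        ← Finset.sum_add_distrib]
      refine Finset.sum_le_sum fun v _ => ?_
      have e1 : act' v * l' v ≤ act' v * l v + q * ρ v := by
        rw [hl']
        simp only [hρ]
        have := hact'_le v
        split_ifs
        · rw [mul_add]; omega
        · omega
      have e2 := Nat.mul_le_mul_right (l v) (hactex v)
      rw [add_mul, add_mul] at e2
      omega
    -- Each unit is pushed down by exactly one label.
    have h3 : ∑ v, outSum src push v * l v
        = ∑ v, outSum src (fun t => push (rev t)) v * l v + ∑ v, outSum src push v := by
      rw [sum_outSum_mul, sum_outSum_mul, sum_outSum_univ,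
        ← sum_comp_rev hrev fun t => push (rev t) * l (src t), ← Finset.sum_add_distrib]
      refine Finset.sum_congr rfl fun t _ => ?_
      rw [hrev t]
      by_cases hc : src t ∈ A ∧ src (rev t) ∈ A ∧ l (src (rev t)) + 1 = l (src t)
      · rw [← hc.2.2]; ring
      · rw [hpush0 t hc]; ring
    have h4 : ∑ v, outDeg src v * l' v = ∑ v, outDeg src v * l v + ∑ v, ρ v := by
      rw [← Finset.sum_add_distrib]
      refine Finset.sum_congr rfl fun v _ => ?_
      rw [hl']
      simp only [hρ]
      split_ifs <;> ring
    have h5 : k * ∑ v, act v + ∑ v, act v * l v ≤ 2 * q * ∑ v, outDeg src v * l v := H.potential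
    have h6 := Nat.mul_le_mul_left (k + 1) hX
    rw [h4]
    change (k + 1) * ∑ v, act' v + ∑ v, act' v * l' v ≤ _
    have e1 : (k + 1) * ∑ v, act v = k * ∑ v, act v + ∑ v, act v := by ring
    have e2 : 2 * q * (∑ v, outDeg src v * l v + ∑ v, ρ v)
      = 2 * q * ∑ v, outDeg src v * l v + (q * ∑ v, ρ v + q * ∑ v, ρ v) := by ring
    omega

end Flow

end Trim

namespace Trim

/-! ### Sparse level cuts and the flow certificate -/

section Cut

variable {ι V : Type*} [Fintype ι] [Fintype V] [DecidableEq V] (src : ι → V) (rev : ι → ι)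

/-- The number of arcs that leave vertices of `A` with a label at least `i`. -/
def levelVol (A : Finset V) (l : V → ℕ) (i : ℕ) : ℕ :=
  ∑ t, if src t ∈ A ∧ i ≤ l (src t) then 1 else 0

/-- The number of arcs inside `A` from label `i` to label `i - 1`. -/
def levelCut (A : Finset V) (l : V → ℕ) (i : ℕ) : ℕ :=
  ∑ t, if src t ∈ A ∧ src (rev t) ∈ A ∧ l (src t) = i ∧ l (src (rev t)) + 1 = i then 1 else 0

variable {src rev} {A : Finset V} {q p h F k : ℕ} {r : ι → ℕ} {l : V → ℕ}

-- The reversal of an arc from label `i + 1` to label `i` leaves a vertex of label `i`, so it counts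
-- at level `i` but not at level `i + 1`.
omit [Fintype V] in
theorem levelCut_add_levelVol_le (hrev : Function.Involutive rev) (i : ℕ) :
    levelCut src rev A l (i + 1) + levelVol src A l (i + 1) ≤ levelVol src A l i := by
  have h1 : levelCut src rev A l (i + 1) ≤ ∑ t, if src t ∈ A ∧ l (src t) = i then 1 else 0 := by
    rw [levelCut, ← sum_comp_rev hrev fun t => if src t ∈ A ∧ l (src t) = i then 1 else 0]
    refine Finset.sum_le_sum fun t _ => ?_
    split_ifs with h₁ h₂ <;> first | omega | (exfalso; apply h₂; refine ⟨h₁.2.1, ?_⟩; omega)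
  refine (Nat.add_le_add_right h1 _).trans ?_
  rw [levelVol, levelVol, ← Finset.sum_add_distrib]
  refine Finset.sum_le_sum fun t _ => ?_
  by_cases hA : src t ∈ A
  · simp only [hA, true_and]
    split_ifs <;> omega
  · simp [hA]

omit [Fintype V] in
/-- Ball growing: some level cut is sparse. -/
theorem exists_sparse_levelCut (hrev : Function.Involutive rev) {K Λ : ℕ} (hK : 0 < K)
    (hcard : Fintype.card ι < 2 ^ Λ) (l : V → ℕ) (hΛ : 0 < Λ) :
    ∃ i, 1 ≤ i ∧ i ≤ K * Λ ∧ K * levelCut src rev A l i ≤ levelVol src A l i := by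
  by_contra! hcon
  set s := levelVol src A l with hs
  -- Without sparse cuts, each step down multiplies the volume by at least `1 + 1 / K`.
  have hstep : ∀ i, i + 1 ≤ K * Λ → K * s i ≥ (K + 1) * s (i + 1) := by
    intro i hi
    have h1 := Nat.mul_le_mul_left K (levelCut_add_levelVol_le (src := src) (A := A) (l := l) hrev i)
    have h2 := hcon (i + 1) (by omega) hi
    rw [← hs, mul_add] at h1
    rw [Nat.succ_mul]
    omega
  -- A cut that is not sparse is nonempty, and its arcs count towards the volume of their level;
  -- this starts the growth.
  have htop : 1 ≤ s (K * Λ) := by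
    have h2 := hcon (K * Λ) (Nat.mul_pos hK hΛ) le_rfl
    have h3 : levelCut src rev A l (K * Λ) ≤ levelVol src A l (K * Λ) := by
      refine Finset.sum_le_sum fun t _ => ?_
      split_ifs with h₁ h₂
      · omega
      · exact absurd ⟨h₁.1, h₁.2.2.1.ge⟩ h₂
      · omega
      · omega
    rw [← hs] at h3
    by_contra h0
    have h5 : levelCut src rev A l (K * Λ) = 0 := by omega
    simp [h5] at h2
  have hgrow : ∀ j, j ≤ K * Λ → (K + 1) ^ j ≤ K ^ j * s (K * Λ - j) := by
    intro j
    induction j with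
    | zero => simpa using htop
    | succ j ih =>
      intro hj
      have h1 := ih (by omega)
      have h2 := hstep (K * Λ - (j + 1)) (by omega)
      rw [show K * Λ - (j + 1) + 1 = K * Λ - j by omega] at h2
      calc (K + 1) ^ (j + 1) = (K + 1) * (K + 1) ^ j := by ring
        _ ≤ (K + 1) * (K ^ j * s (K * Λ - j)) := Nat.mul_le_mul_left _ h1
        _ = K ^ j * ((K + 1) * s (K * Λ - j)) := by ring
        _ ≤ K ^ j * (K * s (K * Λ - (j + 1))) := Nat.mul_le_mul_left _ h2
        _ = _ := by ring
  -- Bernoulli's inequality without division: `K` levels double the volume, so `K * Λ` levels would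
  -- need at least `2 ^ Λ` arcs.
  have hbern : 2 * K ^ K ≤ (K + 1) ^ K := by
    have h1 : K ^ K + K ^ (K - 1) * K ≤ (K + 1) ^ K := by
      have h2 : ∀ j, K ^ (j + 1) + K ^ j * (j + 1) ≤ (K + 1) ^ (j + 1) := by
        intro j
        induction j with
        | zero => simp
        | succ j ih =>
          have h3 := Nat.mul_le_mul_right (K + 1) ih
          rw [← pow_succ] at h3
          refine le_trans ?_ h3
          have : (K ^ (j + 1) + K ^ j * (j + 1)) * (K + 1)
            = K ^ (j + 1 + 1) + K ^ (j + 1) * (j + 1 + 1) + K ^ j * (j + 1) := by ring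
          omega
      have h3 := h2 (K - 1)
      rwa [Nat.sub_add_cancel hK] at h3
    rw [← pow_succ, Nat.sub_add_cancel hK] at h1
    omega
  have h1 := hgrow (K * Λ) le_rfl
  rw [Nat.sub_self] at h1
  have h2 : s 0 ≤ Fintype.card ι := by
    rw [hs, levelVol, ← Finset.card_univ, Finset.card_eq_sum_ones]
    exact Finset.sum_le_sum fun t _ => by split_ifs <;> omega
  have h3 : 2 ^ Λ * K ^ (K * Λ) ≤ (K + 1) ^ (K * Λ) := by
    rw [pow_mul, pow_mul, ← mul_pow]
    exact Nat.pow_le_pow_left hbern Λ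
  have h4 : K ^ (K * Λ) * 2 ^ Λ ≤ K ^ (K * Λ) * s 0 := by
    rw [mul_comm]; exact h3.trans h1
  have := Nat.le_of_mul_le_mul_left h4 (by positivity)
  omega

-- Flow inside `S` cancels: an arc and its reversal have residual capacities that add up to `2 * q`.
omit [Fintype V] in
theorem Preflow.across_self (hrev : Function.Involutive rev) (hr : Preflow src rev A q r)
    {S : Finset V} (hSA : S ⊆ A) :
    2 * across src rev r S S = 2 * q * across src rev (fun _ => 1) S S := by
  have h1 := across_rev src hrev r S S
  rw [← across_const, two_mul]
  nth_rewrite 2 [← h1]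
  rw [← across_add]
  exact across_congr fun t h1 h2 => hr.inner t (hSA h1) (hSA h2)

/-- The effect of removing a sparse level cut after sufficiently many rounds. -/
theorem Labelled.cut (hrev : Function.Involutive rev) (hq : 0 < q) (hh : 0 < h)
    (H : Labelled src rev A q p h F (32 * q * h) r l) {i : ℕ} (hi : 1 ≤ i) (hih : i ≤ h)
    (hsparse : 32 * q * levelCut src rev A l i ≤ levelVol src A l i) {A' : Finset V} {r' : ι → ℕ}
    (hA' : ∀ v, v ∈ A' ↔ v ∈ A ∧ l v < i)
    (hr' : ∀ t, r' t = if src (rev t) ∈ A' then r t else 2 * q) :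
    Preflow src rev A' q r' ∧ (∀ v, outDeg src v = 0 → (v ∈ A' ↔ v ∈ A)) ∧
    8 * ∑ v ∈ A', excess src (q + p + 1) r' v ≤ F ∧
    16 * q * across src rev (fun _ => 1) A' A'ᶜ + 15 * ∑ v ∈ A \ A', outDeg src v
      ≤ 16 * q * across src rev (fun _ => 1) A Aᶜ := by
  have hsub : A' ⊆ A := fun v hv => ((hA' v).1 hv).1
  set S := A \ A' with hS
  have hSmem : ∀ v, v ∈ S ↔ v ∈ A ∧ i ≤ l v := by
    intro v
    rw [hS, Finset.mem_sdiff, hA']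
    constructor
    · rintro ⟨h1, h2⟩
      exact ⟨h1, by by_contra h3; exact h2 ⟨h1, by omega⟩⟩
    · rintro ⟨h1, h2⟩
      exact ⟨h1, fun h3 => by omega⟩
  have hAS : A = A' ∪ S := by rw [hS, Finset.union_sdiff_of_subset hsub]
  have hdis : Disjoint A' S := Finset.disjoint_sdiff
  -- the volume of `S`
  have hvolS : ∑ v ∈ S, outDeg src v = levelVol src A l i := by
    unfold outDeg levelVol
    rw [sum_outSum, Finset.sum_filter]
    exact Finset.sum_congr rfl fun t _ => by simp only [hSmem]
  -- Saturation at `q + p + 1` means an excess over `q + p` of at least the degree.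
  have hvolF : ∑ v ∈ S, outDeg src v ≤ F := by
    refine le_trans ?_ H.mass
    refine (Finset.sum_le_sum fun v hv => ?_).trans
      (Finset.sum_le_sum_of_subset (Finset.sdiff_subset : S ⊆ A))
    have h1 := H.sat v (hi.trans ((hSmem v).1 hv).2)
    have h2 : (q + p + 1) * outDeg src v = (q + p) * outDeg src v + outDeg src v := by ring
    unfold excess
    omega
  -- the mass that is still active
  have hactive : 16 * ∑ v, active src A h (q + p + 1) r l v ≤ F := by
    have h1 : ∑ v, outDeg src v * l v ≤ h * F := by
      refine le_trans ?_ (Nat.mul_le_mul_left h H.mass)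
      rw [Finset.mul_sum, ← Finset.sum_subset (Finset.subset_univ A)]
      · refine Finset.sum_le_sum fun v _ => ?_
        rcases Nat.eq_zero_or_pos (l v) with h0 | h0
        · simp [h0]
        · have h1 := H.sat v h0
          have h2 : (q + p + 1) * outDeg src v = (q + p) * outDeg src v + outDeg src v := by ring
          rw [mul_comm]
          refine Nat.mul_le_mul (H.le_height v) ?_
          unfold excess
          omega
      · intro v _ hv
        have : l v = 0 := by
          by_contra h0
          exact hv (H.mem v (by omega)).1
        simp [this]
    have h2 := H.potential
    -- After `32 * q * h` rounds the potential inequality has the common factor `2 * q * h`, which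
    -- leaves the `16`.
    have h3 : 2 * q * h * (16 * ∑ v, active src A h (q + p + 1) r l v) ≤ 2 * q * h * F := by
      have e1 : 2 * q * h * (16 * ∑ v, active src A h (q + p + 1) r l v)
        = 32 * q * h * ∑ v, active src A h (q + p + 1) r l v := by ring
      have e2 := Nat.mul_le_mul_left (2 * q) h1
      have e3 : 2 * q * (h * F) = 2 * q * h * F := by ring
      omega
    exact Nat.le_of_mul_le_mul_left h3 (by positivity)
  -- the flow from `S` to `A'`
  have hcross : across src rev r S A' ≤ 2 * q * levelCut src rev A l i := by
    unfold across levelCut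
    rw [Finset.mul_sum, Finset.sum_filter]
    refine Finset.sum_le_sum fun t _ => ?_
    split_ifs with h1 h2 h2
    · have := H.flow.le ((hSmem _).1 h1.1).1
      omega
    · obtain ⟨h3, h4⟩ := (hSmem _).1 h1.1
      obtain ⟨h5, h6⟩ := (hA' _).1 h1.2
      -- An arc into `A'` that is not in the level cut skips a level, so its residual capacity is
      -- zero.
      have := H.valid t h3 h5 (by
        by_contra h7
        exact h2 ⟨h3, h5, by omega, by omega⟩)
      omega
    · omega
    · omega
  have hcross' : 16 * across src rev r S A' ≤ ∑ v ∈ S, outDeg src v := by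
    have : 16 * (2 * q * levelCut src rev A l i) = 32 * q * levelCut src rev A l i := by ring
    omega
  refine ⟨⟨?_, ?_⟩, ?_, ?_, ?_⟩
  · intro t h1 h2
    rw [hr', hr', if_pos h2, if_pos (by rwa [hrev t])]
    exact H.flow.inner t (hsub h1) (hsub h2)
  · intro t h1 h2
    rw [hr', if_neg h2]
  · intro v hv
    rw [hA']
    refine ⟨fun h1 => h1.1, fun h1 => ⟨h1, ?_⟩⟩
    by_contra h2
    have := (H.mem v (by omega)).2
    omega
  -- An arc from `A'` to `S` becomes a boundary arc. Raising its residual capacity to `2 * q` adds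
  -- that of its reversal, so the new mass is the residual capacity from `S` to `A'`. The old excess
  -- on `A'` is all active, since labels there are below `i ≤ h`. Each of the two terms is at most
  -- `F / 16`.
  · have h1 : ∑ v ∈ A', excess src (q + p + 1) r' v
        ≤ ∑ v ∈ A', active src A h (q + p + 1) r l v + across src rev r S A' := by
      have h2 : ∀ v ∈ A', outSum src r' v
          = outSum src r v + outSum src (fun t => if src (rev t) ∈ S then r (rev t) else 0) v := by
        intro v hv
        rw [← outSum_add]
        refine outSum_congr fun t ht => ?_
        rw [hr']
        by_cases h3 : src (rev t) ∈ A'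
        · rw [if_pos h3, if_neg (Finset.disjoint_left.1 hdis h3)]; rfl
        · rw [if_neg h3]
          by_cases h4 : src (rev t) ∈ S
          · rw [if_pos h4]
            exact (H.flow.inner t (ht ▸ hsub hv) (Finset.sdiff_subset h4)).symm
          · rw [if_neg h4]
            have h5 : src (rev t) ∉ A := by
              rw [hAS, Finset.mem_union]; tauto
            rw [H.flow.boundary t (ht ▸ hsub hv) h5]; rfl
      have h3 : across src rev r S A'
          = ∑ v ∈ A', outSum src (fun t => if src (rev t) ∈ S then r (rev t) else 0) v := by
        rw [← across_rev src hrev r A' S, sum_outSum, ← Finset.sum_filter, Finset.filter_filter]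
        rfl
      rw [h3, ← Finset.sum_add_distrib]
      refine Finset.sum_le_sum fun v hv => ?_
      have h4 := h2 v hv
      have h5 : active src A h (q + p + 1) r l v = excess src (q + p + 1) r v := by
        have := (hA' v).1 hv
        rw [active, if_pos ⟨this.1, by omega⟩]
      rw [h5]
      unfold excess
      omega
    have h2 : ∑ v ∈ A', active src A h (q + p + 1) r l v
        ≤ ∑ v, active src A h (q + p + 1) r l v :=
      Finset.sum_le_sum_of_subset (Finset.subset_univ _)
    omega
  · have hA'c : A'ᶜ = Aᶜ ∪ S := by
      ext v
      simp only [Finset.mem_compl, Finset.mem_union, hS, Finset.mem_sdiff]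
      have := @hsub v
      tauto
    have hdis' : Disjoint Aᶜ S :=
      Finset.disjoint_left.2 fun v h1 h2 => (Finset.mem_compl.1 h1) (Finset.sdiff_subset h2)
    have e1 : across src rev (fun _ => 1) A' A'ᶜ
        = across src rev (fun _ => 1) A' Aᶜ + across src rev (fun _ => 1) S A' := by
      rw [hA'c, across_union_right _ _ _ _ hdis', ← across_rev src hrev (fun _ => 1) A' S]
    have e2 : across src rev (fun _ => 1) A Aᶜ
        = across src rev (fun _ => 1) A' Aᶜ + across src rev (fun _ => 1) S Aᶜ := by
      have := across_union_left src rev (fun _ => 1) Aᶜ hdis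
      rwa [← hAS] at this
    have huniv : (Finset.univ : Finset V) = S ∪ (A' ∪ Aᶜ) := by
      ext v
      simp only [Finset.mem_univ, Finset.mem_union, hS, Finset.mem_sdiff, Finset.mem_compl]
      tauto
    have hd1 : Disjoint S (A' ∪ Aᶜ) := by
      rw [Finset.disjoint_union_right]
      exact ⟨hdis.symm, hdis'.symm⟩
    have hd2 : Disjoint A' Aᶜ :=
      Finset.disjoint_left.2 fun v h1 h2 => (Finset.mem_compl.1 h2) (hsub h1)
    have e3 : ∑ v ∈ S, outDeg src v = across src rev (fun _ => 1) S S
        + (across src rev (fun _ => 1) S A' + across src rev (fun _ => 1) S Aᶜ) := by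
      unfold outDeg
      rw [sum_outSum_eq_across src rev, huniv, across_union_right _ _ _ _ hd1,
        across_union_right _ _ _ _ hd2]
    have e4 : ∑ v ∈ S, outSum src r v = across src rev r S S
        + (across src rev r S A' + across src rev r S Aᶜ) := by
      rw [sum_outSum_eq_across src rev, huniv, across_union_right _ _ _ _ hd1,
        across_union_right _ _ _ _ hd2]
    have e5 := H.flow.across_self hrev (Finset.sdiff_subset : S ⊆ A)
    have e6 : across src rev r S Aᶜ = 2 * q * across src rev (fun _ => 1) S Aᶜ := by
      rw [← across_const]
      exact across_congr fun t h1 h2 =>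
        H.flow.boundary t (Finset.sdiff_subset h1) (Finset.mem_compl.1 h2)
    -- The mass held by `S` is at least its volume. With `e3` to `e6` this says `vol S + q |E(S,
    -- A')| ≤ q |E(S, Aᶜ)| + r(S, A')`, and `hcross'` bounds the last term by `vol S / 16`.
    have e7 : (q + 1) * ∑ v ∈ S, outDeg src v ≤ ∑ v ∈ S, outSum src r v := by
      rw [Finset.mul_sum]
      refine Finset.sum_le_sum fun v hv => le_trans (Nat.mul_le_mul_right _ (by omega))
        (H.sat v (hi.trans ((hSmem v).1 hv).2))
    rw [e1, e2]
    nlinarith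

/-- A flow in which all mass is absorbed certifies expansion. -/
theorem Preflow.certificate (hrev : Function.Involutive rev) (hr : Preflow src rev A q r)
    {c : ℕ} (hex : ∑ v ∈ A, excess src (q + c) r v = 0) {S : Finset V} (hSA : S ⊆ A) :
    q * across src rev (fun _ => 1) S Aᶜ
      ≤ c * ∑ v ∈ S, outDeg src v + q * across src rev (fun _ => 1) S (A \ S) := by
  have hd : Disjoint S (A \ S) := Finset.disjoint_sdiff
  have hd' : Disjoint (S ∪ A \ S) Aᶜ := by
    rw [Finset.union_sdiff_of_subset hSA]
    exact disjoint_compl_right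
  have huniv : (Finset.univ : Finset V) = (S ∪ A \ S) ∪ Aᶜ := by
    rw [Finset.union_sdiff_of_subset hSA, Finset.union_compl]
  have e3 : ∑ v ∈ S, outDeg src v = across src rev (fun _ => 1) S S
      + across src rev (fun _ => 1) S (A \ S) + across src rev (fun _ => 1) S Aᶜ := by
    unfold outDeg
    rw [sum_outSum_eq_across src rev, huniv, across_union_right _ _ _ _ hd',
      across_union_right _ _ _ _ hd]
  have e4 : ∑ v ∈ S, outSum src r v = across src rev r S S
      + across src rev r S (A \ S) + across src rev r S Aᶜ := by
    rw [sum_outSum_eq_across src rev, huniv, across_union_right _ _ _ _ hd',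
      across_union_right _ _ _ _ hd]
  have e5 := hr.across_self hrev hSA
  have e6 : across src rev r S Aᶜ = 2 * q * across src rev (fun _ => 1) S Aᶜ := by
    rw [← across_const]
    exact across_congr fun t h1 h2 => hr.boundary t (hSA h1) (Finset.mem_compl.1 h2)
  have e7 : ∑ v ∈ S, outSum src r v ≤ (q + c) * ∑ v ∈ S, outDeg src v := by
    rw [Finset.mul_sum]
    refine Finset.sum_le_sum fun v hv => ?_
    have := Finset.sum_eq_zero_iff.1 hex v (hSA hv)
    unfold excess at this
    omega
  -- By `e3` to `e6`, `e7` compares `q |E(S, S)| + r(S, A \ S) + 2 q |E(S, Aᶜ)|` (with ordered pairs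
  -- in `E(S, S)`) with `(q + c)` times the volume; the term `r(S, A \ S)` is dropped.
  nlinarith

end Cut

end Trim

namespace Pram

open Trim

/-! ### Sums over arcs

The arcs `t < N` have the positions `2 ^ Λ + t` among the leaves of a binary tree. -/

/-- The number of the ancestor of the leaf `t` that has height `l`. -/
def block (Λ l t : ℕ) : ℕ := (2 ^ Λ + t) / 2 ^ l

theorem block_succ (Λ l t : ℕ) : block Λ (l + 1) t = block Λ l t / 2 := by
  rw [block, block, pow_succ, Nat.div_div_eq_div_mul]

theorem block_mono {Λ l t t' : ℕ} (h : t ≤ t') : block Λ l t ≤ block Λ l t' :=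
  Nat.div_le_div_right (by omega)

theorem block_top {Λ t : ℕ} (h : t < 2 ^ Λ) : block Λ Λ t = 1 := by
  rw [block]
  exact Nat.div_eq_of_lt_le (by omega) (by omega)

/-- Either `s` is an arc with the same source as `t` in the sibling of the block of `t` of
height `l`, or `s = N` and there is no such arc. -/
def IsSibling {n N : ℕ} (src : Fin N → Fin n) (Λ l : ℕ) (t : Fin N) (s : ℕ) : Prop :=
  (s = N ∧ ∀ t', src t' = src t → block Λ (l + 1) t' = block Λ (l + 1) t →
      block Λ l t' = block Λ l t) ∨
    ∃ s' : Fin N, s = s' ∧ src s' = src t ∧ block Λ (l + 1) s' = block Λ (l + 1) t ∧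
      block Λ l s' ≠ block Λ l t

/-- The part of the memory that stays unchanged throughout the main loop. -/
structure Static {n N : ℕ} (src : Fin N → Fin n) (rev : Fin N → Fin N) (L q h T : ℕ)
    (A : Finset (Fin n)) (M : Mem) : Prop where
  pos : 0 < N
  le_pow : N < 2 ^ (L + L)
  input : ∀ v : Fin n, M 3 v = if v ∈ A then 1 else 0
  arcs : M 4 0 = N
  levels : M 5 0 = L
  cap : M 6 0 = q
  height : M 7 0 = h
  rounds : M 8 0 = T
  source : ∀ t : Fin N, M 16 t = src t
  reverse : ∀ t : Fin N, M 17 t = rev t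
  leader : ∀ t : Fin N, M 27 t = if ∃ t' < t, src t' = src t then 0 else 1
  sibling : ∀ l < L + L, ∀ t : Fin N, IsSibling src (L + L) l t (M (40 + (l + l)) t)
  zero₁ : ∀ j, N ≤ j → M 22 j = 0
  zero₂ : ∀ j, N ≤ j → M 29 j = 0

section

variable {φ : ℝ} {n N : ℕ} {src : Fin N → Fin n} {rev : Fin N → Fin N} {L q h T : ℕ}
  {A : Finset (Fin n)} {M M' : Mem}

/-- The numbers of the arrays that the main loop writes to. -/
def Scratch (a : ℕ) : Prop := 10 ≤ a ∧ a < 31 ∧ a ≠ 16 ∧ a ≠ 17 ∧ a ≠ 27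

/-- Arrays `22` and `29` may be overwritten only below `N`: their zeros from `N` on make the null
pointer `N` and reads past the last arc contribute nothing. -/
theorem Static.step (hM : Static src rev L q h T A M) {a : ℕ} (ha : Scratch a)
    (hz : a = 22 ∨ a = 29 → ∀ j, N ≤ j → M' a j = M a j) (hne : ∀ b, b ≠ a → M' b = M b) :
    Static src rev L q h T A M' := by
  obtain ⟨h1, h2, h3, h4, h5⟩ := ha
  have e3 := hne 3 (by omega)
  have e4 := hne 4 (by omega)
  have e5 := hne 5 (by omega)
  have e6 := hne 6 (by omega)
  have e7 := hne 7 (by omega)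
  have e8 := hne 8 (by omega)
  have e16 := hne 16 (by omega)
  have e17 := hne 17 (by omega)
  have e27 := hne 27 (by omega)
  refine ⟨hM.pos, hM.le_pow, ?_, ?_, ?_, ?_, ?_, ?_, ?_, ?_, ?_, ?_, ?_, ?_⟩
  · rw [e3]; exact hM.input
  · rw [e4]; exact hM.arcs
  · rw [e5]; exact hM.levels
  · rw [e6]; exact hM.cap
  · rw [e7]; exact hM.height
  · rw [e8]; exact hM.rounds
  · rw [e16]; exact hM.source
  · rw [e17]; exact hM.reverse
  · rw [e27]; exact hM.leader
  · intro l hl t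
    rw [hne (40 + (l + l)) (by omega)]
    exact hM.sibling l hl t
  · intro j hj
    by_cases h22 : a = 22
    · subst h22; rw [hz (Or.inl rfl) j hj]; exact hM.zero₁ j hj
    · rw [hne 22 (Ne.symm h22)]; exact hM.zero₁ j hj
  · intro j hj
    by_cases h29 : a = 29
    · subst h29; rw [hz (Or.inr rfl) j hj]; exact hM.zero₂ j hj
    · rw [hne 29 (Ne.symm h29)]; exact hM.zero₂ j hj

/-- Assignment to a scalar variable in the main loop. -/
theorem Static.assign (hM : Static src rev L q h T A M) {a : ℕ} {v : Expr} {S : ℕ}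
    {Q : Mem → Prop} (hS : v.size + 5 ≤ S)
    (hQ : ∀ M', Static src rev L q h T A M' → M' a 0 = v.eval φ M 0 →
      (∀ b, b ≠ a → M' b = M b) → Q M')
    (ha : Scratch a := by unfold Scratch; decide) (ha' : a ≠ 22 ∧ a ≠ 29 := by decide) :
    Runs φ N (.assign a v) M S Q :=
  Runs.assign hM.pos hS fun M' h1 h2 =>
    hQ M' (hM.step ha (fun h => by omega) h2) h1 h2

/-- A parallel step over all arcs in the main loop. -/
theorem Static.parallel (hM : Static src rev L q h T A M) {a : ℕ} {g v : Expr} {S : ℕ}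
    {Q : Mem → Prop} (hS : g.size + v.size + 6 ≤ S)
    (hQ : ∀ M', Static src rev L q h T A M' →
      (∀ t : Fin N, g.Holds φ M t → M' a t = v.eval φ M t) →
      (∀ t : Fin N, ¬ g.Holds φ M t → M' a t = M a t) →
      (∀ b, b ≠ a → M' b = M b) → Q M')
    (ha : Scratch a := by unfold Scratch; decide) :
    Runs φ N (.arcs a g v) M S Q :=
  Runs.arcs hM.pos hM.arcs hS fun M' h1 h2 h3 h4 =>
    hQ M' (hM.step ha (fun _ => h3) h4) (fun t ht => h1 t t.2 ht) (fun t ht => h2 t ht) h4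

/-- An unconditional parallel step over all arcs in the main loop. -/
theorem Static.parallel' (hM : Static src rev L q h T A M) {a : ℕ} {v : Expr} {S : ℕ}
    {Q : Mem → Prop} (hS : v.size + 7 ≤ S)
    (hQ : ∀ M', Static src rev L q h T A M' →
      (∀ t : Fin N, M' a t = v.eval φ M t) → (∀ b, b ≠ a → M' b = M b) → Q M')
    (ha : Scratch a := by unfold Scratch; decide) :
    Runs φ N (.arcs a (.lit 1) v) M S Q :=
  hM.parallel (by simp only [Expr.size]; omega)
    (fun M' h1 h2 _ h4 => hQ M' h1 (fun t => h2 t holds_lit_one) h4) ha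

/-- The pointer of an arc at the current level. -/
abbrev ptr : Expr := .get (.add (.lit 40) (.dbl (.var 10))) .tid

/-- For each arc `t`, this computes in array `22` the sum of the values of array `21` over the arcs
with the same source, and in array `23` the sum over those before `t`. -/
def sumProg : Prog :=
  .seq (.arcs 22 (.lit 1) (.own 21)) <|
  .seq (.arcs 23 (.lit 1) (.lit 0)) <|
  .seq (.assign 10 (.lit 0)) <|
  .loop (.lt (.var 10) (.dbl (.var 5))) <|
  .seq (.arcs 23 (.lt ptr .tid) (.add (.own 23) (.get (.lit 22) ptr))) <|
  .seq (.arcs 22 (.lit 1) (.add (.own 22) (.get (.lit 22) ptr))) <|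
  .assign 10 (.add (.var 10) (.lit 1))

/-- A block is the union of its two children. The predicate `P` is trivial for sums over a vertex
and `· < t` for prefix sums. -/
theorem sum_block_succ {Λ l : ℕ} (x : Fin N → ℕ) (t s : Fin N) (P : Fin N → Prop)
    [DecidablePred P] (hsrc : src s = src t) (h1 : block Λ (l + 1) s = block Λ (l + 1) t)
    (h2 : block Λ l s ≠ block Λ l t) :
    ∑ t' with src t' = src t ∧ block Λ (l + 1) t' = block Λ (l + 1) t ∧ P t', x t'
      = ∑ t' with src t' = src t ∧ block Λ l t' = block Λ l t ∧ P t', x t'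
        + ∑ t' with src t' = src s ∧ block Λ l t' = block Λ l s ∧ P t', x t' := by
  rw [← Finset.sum_union]
  · refine Finset.sum_congr ?_ fun _ _ => rfl
    ext t'
    simp only [Finset.mem_filter, Finset.mem_univ, true_and, Finset.mem_union, hsrc]
    rw [block_succ, block_succ] at h1 ⊢
    constructor
    · rintro ⟨h3, h4, h5⟩
      have : block Λ l t' = block Λ l t ∨ block Λ l t' = block Λ l s := by omega
      tauto
    · rintro (⟨h3, h4, h5⟩ | ⟨h3, h4, h5⟩)
      · exact ⟨h3, by rw [h4], h5⟩
      · exact ⟨h3, by rw [h4, h1], h5⟩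
  · rw [Finset.disjoint_filter]
    rintro t' - ⟨-, h3, -⟩ ⟨-, h4, -⟩
    exact h2 (h4.symm.trans h3)

theorem sum_block_succ_of_none {Λ l : ℕ} (x : Fin N → ℕ) (t : Fin N) (P : Fin N → Prop)
    [DecidablePred P] (h : ∀ t', src t' = src t → block Λ (l + 1) t' = block Λ (l + 1) t →
      block Λ l t' = block Λ l t) :
    ∑ t' with src t' = src t ∧ block Λ (l + 1) t' = block Λ (l + 1) t ∧ P t', x t'
      = ∑ t' with src t' = src t ∧ block Λ l t' = block Λ l t ∧ P t', x t' := by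
  refine Finset.sum_congr ?_ fun _ _ => rfl
  ext t'
  simp only [Finset.mem_filter, Finset.mem_univ, true_and]
  constructor
  · rintro ⟨h3, h4, h5⟩
    exact ⟨h3, h t' h3 h4, h5⟩
  · rintro ⟨h3, h4, h5⟩
    exact ⟨h3, by rw [block_succ, block_succ, h4], h5⟩

/-- At height `l`, array `22` holds for each arc the sum over the arcs of its vertex in its block.
Any arc of the vertex in the sibling block holds the missing part of the next sum, so one pointer
per arc and height suffices. At height `L + L` a single block contains all arcs. -/
theorem sumProg_spec (hM : Static src rev L q h T A M) {Q : Mem → Prop} {x : Fin N → ℕ}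
    (hx : ∀ t : Fin N, M 21 t = x t)
    (hQ : ∀ M', Static src rev L q h T A M' → (∀ t : Fin N, M' 22 t = outSum src x (src t)) →
      (∀ t : Fin N, M' 23 t = ∑ t' with src t' = src t ∧ t' < t, x t') →
      (∀ b, b ≠ 10 → b ≠ 22 → b ≠ 23 → M' b = M b) → Q M') :
    Runs φ N sumProg M (100 * (L + L + 1)) Q := by
  refine Runs.mono_cost (S := 20 + (20 + (20 + ((L + L) * (13 + 80) + 13)))) ?_ (by omega)
  refine Runs.seq (hM.parallel' (by decide) fun M₁ hM₁ h₁ n₁ => ?_)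
  refine Runs.seq (hM₁.parallel' (by decide) fun M₂ hM₂ h₂ n₂ => ?_)
  refine Runs.seq (hM₂.assign (by decide) fun M₃ hM₃ h₃ n₃ => ?_)
  simp only [Expr.eval] at h₁ h₂ h₃
  refine Runs.loop hM.pos (fun l M' => Static src rev L q h T A M' ∧ M' 10 0 = l ∧
      (∀ t : Fin N, M' 22 t
        = ∑ t' with src t' = src t ∧ block (L + L) l t' = block (L + L) l t ∧ True, x t') ∧
      (∀ t : Fin N, M' 23 t
        = ∑ t' with src t' = src t ∧ block (L + L) l t' = block (L + L) l t ∧ t' < t, x t') ∧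
      ∀ b, b ≠ 10 → b ≠ 22 → b ≠ 23 → M' b = M b) (L + L) 80 ?_ ?_ ?_ (by simp [Expr.size]) ?_
  · refine ⟨hM₃, h₃, fun t => ?_, fun t => ?_, fun b h1 h2 h3 => ?_⟩
    · rw [n₃ _ (by decide), n₂ _ (by decide), h₁, hx]
      rw [Finset.sum_eq_single t]
      · intro t' ht' hne
        simp only [Finset.mem_filter, block, pow_zero, Nat.div_one] at ht'
        exact absurd (Fin.ext (by omega)) hne
      · simp
    · rw [n₃ _ (by decide), h₂]
      symm
      refine Finset.sum_eq_zero fun t' ht' => ?_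
      simp only [Finset.mem_filter, block, pow_zero, Nat.div_one, Fin.lt_def] at ht'
      omega
    · rw [n₃ _ h1, n₂ _ h3, n₁ _ h2]
  · rintro l M₄ hl ⟨hM₄, e10, e22, e23, n₄⟩
    refine ⟨by simp [Expr.eval, e10, hM₄.levels]; omega, ?_⟩
    refine Runs.mono_cost (S := 40 + (25 + 15)) ?_ (by omega)
    refine Runs.seq (hM₄.parallel (by decide) fun M₅ hM₅ h₅ h₅' n₅ => ?_)
    refine Runs.seq (hM₅.parallel' (by decide) fun M₆ hM₆ h₆ n₆ => ?_)
    refine hM₆.assign (by decide) fun M₇ hM₇ h₇ n₇ => ?_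
    simp only [Expr.eval, holds_le, e10] at h₅ h₅' h₆ h₇
    rw [n₅ 10 (by decide), n₅ 22 (by decide), n₅ (40 + (M₄ 10 0 + M₄ 10 0)) (by omega), e10] at h₆
    rw [n₆ 10 (by decide), n₅ 10 (by decide), e10] at h₇
    refine ⟨hM₇, h₇, fun t => ?_, fun t => ?_, fun b h1 h2 h3 => ?_⟩
    · rw [n₇ _ (by decide), h₆, e22]
      rcases hM₄.sibling l hl t with ⟨h1, h2⟩ | ⟨s, h1, h2, h3, h4⟩
      · rw [h1, hM₄.zero₁ N le_rfl, sum_block_succ_of_none x t (fun _ => True) h2, add_zero]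
      · rw [h1, e22, sum_block_succ x t s (fun _ => True) h2 h3 h4]
    · rw [n₇ _ (by decide), n₆ _ (by decide)]
      rcases hM₄.sibling l hl t with ⟨h1, h2⟩ | ⟨s, h1, h2, h3, h4⟩
      · rw [h₅' t (by rw [h1]; omega), e23, sum_block_succ_of_none x t (· < t) h2]
      · rw [sum_block_succ x t s (· < t) h2 h3 h4]
        -- Blocks are intervals: if `s` precedes `t`, so does its whole block, and otherwise no arc
        -- of that block does.
        by_cases hst : s < t
        · rw [h₅ t (by rw [h1]; exact hst), h1, e22, e23]
          congr 1
          refine Finset.sum_congr ?_ fun _ _ => rfl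
          ext t'
          simp only [Finset.mem_filter, Finset.mem_univ, true_and, and_true]
          constructor
          · rintro ⟨h5, h6⟩
            refine ⟨h5, h6, ?_⟩
            by_contra h7
            have h8 := block_mono (Λ := L + L) (l := l) (not_lt.1 h7)
            have h9 := block_mono (Λ := L + L) (l := l) (Fin.lt_def.1 hst).le
            omega
          · tauto
        · rw [h₅' t (by rw [h1, Nat.succ_le_iff]; exact hst), e23]
          symm
          refine (Nat.add_eq_left).2 (Finset.sum_eq_zero fun t' ht' => ?_)
          simp only [Finset.mem_filter, Finset.mem_univ, true_and] at ht'
          have h8 := block_mono (Λ := L + L) (l := l) (not_lt.1 hst)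
          have h9 := block_mono (Λ := L + L) (l := l) (Fin.lt_def.1 ht'.2.2).le
          omega
    · rw [n₇ _ h1, n₆ _ h2, n₅ _ h3, n₄ b h1 h2 h3]
  · rintro M₄ ⟨hM₄, e10, -⟩
    simp [Expr.eval, e10, hM₄.levels]
  · rintro M₄ ⟨hM₄, e10, e22, e23, n₄⟩
    have htop : ∀ t : Fin N, block (L + L) (L + L) t = 1 := fun t =>
      block_top (t.2.trans hM.le_pow)
    refine hQ M₄ hM₄ (fun t => ?_) (fun t => ?_) n₄
    · rw [e22]; simp [htop, outSum]
    · rw [e23]; simp [htop]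

/-- This computes in cell `0` of array `29` the sum of the values of array `21` over all arcs. -/
def totalProg : Prog :=
  .seq (.arcs 29 (.lit 1) (.own 21)) <|
  .seq (.assign 15 (.lit 1)) <|
  .seq (.assign 10 (.lit 0)) <|
  .loop (.lt (.var 10) (.dbl (.var 5))) <|
  .seq (.arcs 29 (.lit 1) (.add (.own 29) (.get (.lit 29) (.add .tid (.var 15))))) <|
  .seq (.assign 15 (.dbl (.var 15))) <|
  .assign 10 (.add (.var 10) (.lit 1))

/-- Window doubling: cell `t` holds the sum over the `2 ^ l` arcs from `t` on, and adding cell `t +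
2 ^ l` doubles the window. Cells past the last arc are zero. -/
theorem totalProg_spec (hM : Static src rev L q h T A M) {Q : Mem → Prop} {x : Fin N → ℕ}
    (hx : ∀ t : Fin N, M 21 t = x t)
    (hQ : ∀ M', Static src rev L q h T A M' → M' 29 0 = ∑ t, x t →
      (∀ b, b ≠ 10 → b ≠ 15 → b ≠ 29 → M' b = M b) → Q M') :
    Runs φ N totalProg M (100 * (L + L + 1)) Q := by
  refine Runs.mono_cost (S := 20 + (20 + (20 + ((L + L) * (13 + 80) + 13)))) ?_ (by omega)
  refine Runs.seq (hM.parallel' (by decide) fun M₁ hM₁ h₁ n₁ => ?_)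
  refine Runs.seq (hM₁.assign (by decide) fun M₂ hM₂ h₂ n₂ => ?_)
  refine Runs.seq (hM₂.assign (by decide) fun M₃ hM₃ h₃ n₃ => ?_)
  simp only [Expr.eval] at h₁ h₂ h₃
  refine Runs.loop hM.pos (fun l M' => Static src rev L q h T A M' ∧ M' 10 0 = l ∧
      M' 15 0 = 2 ^ l ∧
      (∀ t : Fin N, M' 29 t = ∑ t' : Fin N with t ≤ t' ∧ (t' : ℕ) < t + 2 ^ l, x t') ∧
      ∀ b, b ≠ 10 → b ≠ 15 → b ≠ 29 → M' b = M b) (L + L) 80 ?_ ?_ ?_ (by simp [Expr.size]) ?_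
  · refine ⟨hM₃, h₃, by rw [n₃ _ (by decide), h₂]; rfl, fun t => ?_, fun b h1 h2 h3 => ?_⟩
    · rw [n₃ _ (by decide), n₂ _ (by decide), h₁, hx]
      rw [Finset.sum_eq_single t]
      · intro t' ht' hne
        simp only [Finset.mem_filter, pow_zero, Fin.le_def] at ht'
        exact absurd (Fin.ext (by omega)) hne
      · simp
    · rw [n₃ _ h1, n₂ _ h2, n₁ _ h3]
  · rintro l M₄ hl ⟨hM₄, e10, e15, e29, n₄⟩
    refine ⟨by simp [Expr.eval, e10, hM₄.levels]; omega, ?_⟩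
    refine Runs.mono_cost (S := 40 + (25 + 15)) ?_ (by omega)
    refine Runs.seq (hM₄.parallel' (by decide) fun M₅ hM₅ h₅ n₅ => ?_)
    refine Runs.seq (hM₅.assign (by decide) fun M₆ hM₆ h₆ n₆ => ?_)
    refine hM₆.assign (by decide) fun M₇ hM₇ h₇ n₇ => ?_
    simp only [Expr.eval, e15] at h₅ h₆ h₇
    rw [n₅ 15 (by decide), e15] at h₆
    rw [n₆ 10 (by decide), n₅ 10 (by decide), e10] at h₇
    refine ⟨hM₇, h₇, by rw [n₇ _ (by decide), h₆, pow_succ]; omega, fun t => ?_,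
      fun b h1 h2 h3 => ?_⟩
    · rw [n₇ _ (by decide), n₆ _ (by decide), h₅, e29]
      have hsplit : ∑ t' : Fin N with t ≤ t' ∧ (t' : ℕ) < t + 2 ^ (l + 1), x t'
          = ∑ t' : Fin N with t ≤ t' ∧ (t' : ℕ) < t + 2 ^ l, x t'
            + ∑ t' ∈ Finset.univ.filter
                fun t' : Fin N => (t : ℕ) + 2 ^ l ≤ t' ∧ (t' : ℕ) < t + 2 ^ l + 2 ^ l, x t' := by
        rw [← Finset.sum_union]
        · refine Finset.sum_congr ?_ fun _ _ => rfl
          ext t'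
          simp only [Finset.mem_filter, Finset.mem_univ, true_and, Finset.mem_union, Fin.le_def,
            pow_succ]
          omega
        · rw [Finset.disjoint_filter]
          intro t' _ h1 h2
          omega
      rw [hsplit]
      congr 1
      by_cases hN : (t : ℕ) + 2 ^ l < N
      · rw [show (t : ℕ) + 2 ^ l = ((⟨t + 2 ^ l, hN⟩ : Fin N) : ℕ) from rfl, e29]
        rfl
      · rw [hM₄.zero₂ _ (by omega)]
        symm
        refine Finset.sum_eq_zero fun t' ht' => ?_
        simp only [Finset.mem_filter] at ht'
        omega
    · rw [n₇ _ h1, n₆ _ h2, n₅ _ h3, n₄ b h1 h2 h3]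
  · rintro M₄ ⟨hM₄, e10, -⟩
    simp [Expr.eval, e10, hM₄.levels]
  · rintro M₄ ⟨hM₄, e10, e15, e29, n₄⟩
    refine hQ M₄ hM₄ ?_ n₄
    have := e29 ⟨0, hM.pos⟩
    simp only at this
    rw [this]
    refine Finset.sum_congr ?_ fun _ _ => rfl
    ext t'
    have := hM.le_pow
    simp only [Finset.mem_filter, Finset.mem_univ, true_and, Fin.le_def, iff_true]
    omega

end

end Pram

namespace Pram

open Trim

/-- Greedy distribution: an arc takes what the earlier arcs of its vertex leave of `E`, so every
running total is the minimum of `E` and the prefix sum of `x`. Prefix sums thus let all arcs choose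
their pushes at the same time. -/
theorem outSum_min_prefix {V : Type*} [DecidableEq V] {N : ℕ} (src : Fin N → V)
    {x push : Fin N → ℕ} {E : V → ℕ}
    (hpush : ∀ t, push t
      = min (x t) (E (src t) - ∑ t' with src t' = src t ∧ t' < t, x t')) (v : V) :
    outSum src push v = min (E v) (outSum src x v) := by
  suffices H : ∀ k, k ≤ N → ∑ t : Fin N with src t = v ∧ (t : ℕ) < k, push t
      = min (E v) (∑ t : Fin N with src t = v ∧ (t : ℕ) < k, x t) by
    simpa [outSum] using H N le_rfl
  intro k
  induction k with
  | zero => simp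
  | succ k ih =>
    intro hk
    have h1 := ih (by omega)
    set a : Fin N := ⟨k, hk⟩ with ha
    by_cases hv : src a = v
    · have hins : (Finset.univ.filter fun t : Fin N => src t = v ∧ (t : ℕ) < k + 1)
          = insert a (Finset.univ.filter fun t : Fin N => src t = v ∧ (t : ℕ) < k) := by
        ext t
        simp only [Finset.mem_filter, Finset.mem_univ, true_and, Finset.mem_insert, ha, Fin.ext_iff]
        constructor
        · rintro ⟨h2, h3⟩
          by_cases h4 : (t : ℕ) = k
          · exact Or.inl h4
          · exact Or.inr ⟨h2, by omega⟩
        · rintro (h2 | ⟨h2, h3⟩)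
          · exact ⟨by rw [← hv]; congr 1; exact Fin.ext h2, by omega⟩
          · exact ⟨h2, by omega⟩
      have hnot : a ∉ Finset.univ.filter fun t : Fin N => src t = v ∧ (t : ℕ) < k := by
        simp [ha]
      rw [hins, Finset.sum_insert hnot, Finset.sum_insert hnot, h1, hpush a, hv]
      have : (Finset.univ.filter fun t' : Fin N => src t' = v ∧ t' < a)
          = Finset.univ.filter fun t : Fin N => src t = v ∧ (t : ℕ) < k := by
        simp [ha, Fin.lt_def]
      rw [this]
      omega
    · have hsame : (Finset.univ.filter fun t : Fin N => src t = v ∧ (t : ℕ) < k + 1)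
          = Finset.univ.filter fun t : Fin N => src t = v ∧ (t : ℕ) < k := by
        ext t
        simp only [Finset.mem_filter, Finset.mem_univ, true_and]
        constructor
        · rintro ⟨h2, h3⟩
          refine ⟨h2, ?_⟩
          by_contra h4
          have : t = a := Fin.ext (by simp only [ha]; omega)
          exact hv (this ▸ h2)
        · rintro ⟨h2, h3⟩
          exact ⟨h2, by omega⟩
      rw [hsame, h1]

/-! ### The main loop -/

/-- The set `A'`, the labels `l` and the residual capacities `r` are in the memory. -/
structure Stored {n N : ℕ} (src : Fin N → Fin n) (A' : Finset (Fin n)) (r : Fin N → ℕ)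
    (l : Fin n → ℕ) (M : Mem) : Prop where
  mem : ∀ t : Fin N, M 18 t = if src t ∈ A' then 1 else 0
  label : ∀ t : Fin N, M 19 t = l (src t)
  res : ∀ t : Fin N, M 20 t = r t

/-- The content of array `a` at the reverse of an arc. -/
abbrev revOf (a : ℕ) : Expr := .get (.lit a) (.own 17)

/-- The guard of the arcs in the current set. -/
abbrev inside : Expr := .min (.own 18) (revOf 18)

/-- One round of push-relabel. -/
def roundProg : Prog :=
  .seq (.arcs 21 (.lit 1) (.own 20)) <|
  .seq sumProg <|
  .seq (.arcs 30 (.lit 1) (.own 22)) <|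
  .seq (.arcs 21 (.lit 1) (.add (.add (.var 6) (.var 11)) (.lit 1))) <|
  .seq sumProg <|
  .seq (.arcs 24 (.lit 1) (.lit 0)) <|
  .seq (.arcs 24 (.min (.own 18) (.lt (.own 19) (.var 7))) (.sub (.own 30) (.own 22))) <|
  .seq (.arcs 21 (.lit 1) (.lit 0)) <|
  .seq (.arcs 21 (.min inside (.min (.le (.add (revOf 19) (.lit 1)) (.own 19))
    (.le (.own 19) (.add (revOf 19) (.lit 1))))) (.own 20)) <|
  .seq sumProg <|
  .seq (.arcs 25 (.lit 1) (.min (.own 21) (.sub (.own 24) (.own 23)))) <|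
  .seq (.arcs 19 (.lt (.own 22) (.own 24)) (.add (.own 19) (.lit 1))) <|
  .arcs 20 (.lit 1) (.sub (.add (.own 20) (revOf 25)) (.own 25))

section

variable {φ : ℝ} {n N : ℕ} {src : Fin N → Fin n} {rev : Fin N → Fin N} {L q h T : ℕ}
  {A A' : Finset (Fin n)} {M : Mem} {r : Fin N → ℕ} {l : Fin n → ℕ} {p F k : ℕ}

theorem roundProg_spec (hrev : Function.Involutive rev) (hM : Static src rev L q h T A M)
    (hS : Stored src A' r l M) (hp : M 11 0 = p) (H : Labelled src rev A' q p h F k r l)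
    {Q : Mem → Prop}
    (hQ : ∀ M' r' l', Static src rev L q h T A M' → Stored src A' r' l' M' →
      Labelled src rev A' q p h F (k + 1) r' l' → M' 11 = M 11 → M' 12 = M 12 → Q M') :
    Runs φ N roundProg M (1000 * (L + L + 1)) Q := by
  refine Runs.mono_cost (S := 50 + (100 * (L + L + 1) + (50 + (50 + (100 * (L + L + 1) +
    (50 + (50 + (50 + (150 + (100 * (L + L + 1) + (50 + (50 + 50)))))))))))) ?_ (by linarith)
  obtain ⟨s18, s19, s20⟩ := hS
  refine Runs.seq (hM.parallel' (by decide) fun M₁ hM₁ h₁ n₁ => ?_)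
  refine Runs.seq (sumProg_spec hM₁ (x := r)
    (fun t => by rw [h₁]; simp only [Expr.eval]; exact s20 t) fun M₂ hM₂ h₂ _ n₂ => ?_)
  refine Runs.seq (hM₂.parallel' (by decide) fun M₃ hM₃ h₃ n₃ => ?_)
  refine Runs.seq (hM₃.parallel' (by decide) fun M₄ hM₄ h₄ n₄ => ?_)
  -- Summing a constant over the arcs of a vertex gives its product with the degree, without a
  -- multiplication.
  refine Runs.seq (sumProg_spec hM₄ (x := fun _ => q + p + 1)
    (fun t => by
      rw [h₄]
      simp only [Expr.eval]
      rw [hM₃.cap, n₃ 11 (by decide), n₂ 11 (by decide) (by decide) (by decide),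
        n₁ 11 (by decide), hp]) fun M₅ hM₅ h₅ _ n₅ => ?_)
  refine Runs.seq (hM₅.parallel' (by decide) fun M₆ hM₆ h₆ n₆ => ?_)
  refine Runs.seq (hM₆.parallel (by decide) fun M₇ hM₇ h₇ h₇' n₇ => ?_)
  have n05 : ∀ b, b ≠ 10 → b ≠ 21 → b ≠ 22 → b ≠ 23 → b ≠ 30 → M₅ b = M b := by
    intro b _ _ _ _ _
    rw [n₅ b, n₄ b, n₃ b, n₂ b, n₁ b] <;> assumption
  have n07 : ∀ b, b ≠ 10 → b ≠ 21 → b ≠ 22 → b ≠ 23 → b ≠ 24 → b ≠ 30 → M₇ b = M b := by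
    intro b _ _ _ _ _ _
    rw [n₇ b, n₆ b, n05 b] <;> assumption
  have e30 : ∀ t : Fin N, M₅ 30 t = outSum src r (src t) := by
    intro t
    rw [n₅ 30 (by decide) (by decide) (by decide), n₄ 30 (by decide), h₃]
    exact h₂ t
  have e24 : ∀ t : Fin N, M₇ 24 t = active src A' h (q + p + 1) r l (src t) := by
    intro t
    have hiff : (Expr.min (.own 18) (.lt (.own 19) (.var 7))).Holds φ M₆ t
        ↔ src t ∈ A' ∧ l (src t) < h := by
      simp only [holds_min, holds_get, holds_le, Expr.eval, hM₆.height]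
      rw [n₆ 18 (by decide), n₆ 19 (by decide), n05 18, n05 19, s18, s19, Nat.succ_le_iff]
        <;> first | decide | skip
      simp
    unfold active
    split_ifs with hcase
    · rw [h₇ t (hiff.2 hcase)]
      simp only [Expr.eval]
      rw [n₆ 30 (by decide), n₆ 22 (by decide), e30, h₅, excess, outSum_const]
    · rw [h₇' t (mt hiff.1 hcase), h₆]
      rfl
  refine Runs.seq (hM₇.parallel' (by decide) fun M₈ hM₈ h₈ n₈ => ?_)
  refine Runs.seq (hM₈.parallel (by decide) fun M₉ hM₉ h₉ h₉' n₉ => ?_)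
  have e21 : ∀ t : Fin N, M₉ 21 t = adm src rev A' r l t := by
    intro t
    have hiff : (Expr.min inside (.min (.le (.add (revOf 19) (.lit 1)) (.own 19))
        (.le (.own 19) (.add (revOf 19) (.lit 1))))).Holds φ M₈ t
        ↔ src t ∈ A' ∧ src (rev t) ∈ A' ∧ l (src (rev t)) + 1 = l (src t) := by
      simp only [holds_min, holds_get, holds_le, Expr.eval, hM₈.reverse]
      rw [n₈ 18 (by decide), n₈ 19 (by decide), n07 18, n07 19, s18, s19, s18, s19]
        <;> first | decide | skip
      have : l (src (rev t)) + 1 ≤ l (src t) ∧ l (src t) ≤ l (src (rev t)) + 1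
        ↔ l (src (rev t)) + 1 = l (src t) := by omega
      rw [this]
      simp [and_assoc]
    unfold adm
    split_ifs with hcase
    · rw [h₉ t (hiff.2 hcase)]
      simp only [Expr.eval]
      rw [n₈ 20 (by decide), n07 20, s20] <;> decide
    · rw [h₉' t (mt hiff.1 hcase), h₈]
      rfl
  refine Runs.seq (sumProg_spec hM₉ e21 fun M₁₀ hM₁₀ h₁₀ h₁₀' n₁₀ => ?_)
  refine Runs.seq (hM₁₀.parallel' (by decide) fun M₁₁ hM₁₁ h₁₁ n₁₁ => ?_)
  refine Runs.seq (hM₁₁.parallel (by decide) fun M₁₂ hM₁₂ h₁₂ h₁₂' n₁₂ => ?_)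
  refine hM₁₂.parallel' (by decide) fun M₁₃ hM₁₃ h₁₃ n₁₃ => ?_
  have n10 : ∀ b, b ≠ 10 → b ≠ 21 → b ≠ 22 → b ≠ 23 → M₁₀ b = M₇ b := by
    intro b _ _ _ _
    rw [n₁₀ b, n₉ b, n₈ b] <;> assumption
  have e21' : ∀ t : Fin N, M₁₀ 21 t = adm src rev A' r l t := by
    intro t
    rw [n₁₀ 21 (by decide) (by decide) (by decide), e21]
  set push : Fin N → ℕ := fun t => M₁₁ 25 t with hpush
  have epush : ∀ t, push t = min (adm src rev A' r l t) (active src A' h (q + p + 1) r l (src t)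
      - ∑ t' with src t' = src t ∧ t' < t, adm src rev A' r l t') := by
    intro t
    simp only [hpush]
    rw [h₁₁]
    simp only [Expr.eval]
    rw [h₁₀', n10 24, e24, e21'] <;> first | decide | skip
    omega
  set l' : Fin n → ℕ := fun v => if outSum src (adm src rev A' r l) v
    < active src A' h (q + p + 1) r l v then l v + 1 else l v with hl'
  set r' : Fin N → ℕ := fun t => r t + push (rev t) - push t with hr'
  refine hQ M₁₃ r' l' hM₁₃ ⟨fun t => ?_, fun t => ?_, fun t => ?_⟩
    (H.round hrev (fun t => (epush t).trans_le (min_le_left _ _))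
      (outSum_min_prefix src epush) (fun _ => rfl) (fun _ => rfl)) ?_ ?_
  · rw [n₁₃ 18 (by decide), n₁₂ 18 (by decide), n₁₁ 18 (by decide), n10 18, n07 18, s18] <;> decide
  · rw [n₁₃ 19 (by decide)]
    have hiff : (Expr.lt (.own 22) (.own 24)).Holds φ M₁₁ t
        ↔ outSum src (adm src rev A' r l) (src t) < active src A' h (q + p + 1) r l (src t) := by
      simp only [holds_le, Expr.eval]
      rw [n₁₁ 22 (by decide), n₁₁ 24 (by decide), h₁₀, n10 24, e24, Nat.succ_le_iff] <;> decide
    have e19 : M₁₁ 19 t = l (src t) := by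
      rw [n₁₁ 19 (by decide), n10 19, n07 19, s19] <;> decide
    simp only [hl']
    split_ifs with hcase
    · rw [h₁₂ t (hiff.2 hcase)]
      simp only [Expr.eval]
      rw [e19]
    · rw [h₁₂' t (mt hiff.1 hcase), e19]
  · rw [h₁₃]
    simp only [Expr.eval, hM₁₂.reverse]
    rw [n₁₂ 25 (by decide), n₁₂ 20 (by decide), n₁₁ 20 (by decide), n10 20, n07 20, s20] <;> decide
  · rw [n₁₃ 11 (by decide), n₁₂ 11 (by decide), n₁₁ 11 (by decide), n10 11, n07 11] <;> decide
  · rw [n₁₃ 12 (by decide), n₁₂ 12 (by decide), n₁₁ 12 (by decide), n10 12, n07 12] <;> decide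

end

end Pram

/-! ### Phases, the search for a level cut, and the output -/

namespace Pram

open Trim

/-- One step of the search for a sparse level cut: the variable `13` is the level, and the variable
`14` receives it if the cut is sparse. -/
def levelProg : Prog :=
  .seq (.assign 13 (.add (.var 13) (.lit 1))) <|
  .seq (.arcs 21 (.lit 1) (.lit 0)) <|
  .seq (.arcs 21 (.min inside (.min (.min (.le (.own 19) (.var 13)) (.le (.var 13) (.own 19)))
      (.min (.le (.add (revOf 19) (.lit 1)) (.var 13))
        (.le (.var 13) (.add (revOf 19) (.lit 1))))))
    (.dbl (.dbl (.dbl (.dbl (.dbl (.var 6))))))) <|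
  .seq totalProg <|
  .seq (.assign 28 (.var 29)) <|
  .seq (.arcs 21 (.lit 1) (.lit 0)) <|
  .seq (.arcs 21 (.min (.own 18) (.le (.var 13) (.own 19))) (.lit 1)) <|
  .seq totalProg <|
  .ite (.le (.var 28) (.var 29)) (.assign 14 (.var 13)) .skip

/-- Push-relabel from zero labels, followed by the removal of a sparse level cut. -/
def phaseProg : Prog :=
  .seq (.arcs 19 (.lit 1) (.lit 0)) <|
  .seq (.assign 12 (.lit 0)) <|
  .seq (.loop (.lt (.var 12) (.var 8))
    (.seq roundProg (.assign 12 (.add (.var 12) (.lit 1))))) <|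
  .seq (.assign 13 (.lit 0)) <|
  .seq (.assign 14 (.lit 0)) <|
  .seq (.loop (.lt (.var 13) (.var 7)) levelProg) <|
  .seq (.arcs 18 (.le (.var 14) (.own 19)) (.lit 0)) <|
  .arcs 20 (.not (revOf 18)) (.dbl (.var 6))

/-- The main loop and the output. -/
def mainProg : Prog :=
  .seq (.assign 11 (.lit 0)) <|
  .seq (.loop (.lt (.var 11) (.var 5))
    (.seq phaseProg (.assign 11 (.add (.var 11) (.lit 1))))) <|
  .pardo (.var 4) (.min (.own 27) (.not (.own 18))) (.lit 3) (.own 16) (.lit 0)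

/-- The invariant of the main loop, after `p` phases. -/
structure Progress {n N : ℕ} (src : Fin N → Fin n) (rev : Fin N → Fin N) (q p : ℕ)
    (A A' : Finset (Fin n)) (r : Fin N → ℕ) : Prop where
  subset : A' ⊆ A
  isolated : ∀ v, outDeg src v = 0 → (v ∈ A' ↔ v ∈ A)
  flow : Preflow src rev A' q r
  mass : 8 ^ p * ∑ v ∈ A', excess src (q + p) r v ≤ q * across src rev (fun _ => 1) A Aᶜ
  cut : 16 * q * across src rev (fun _ => 1) A' A'ᶜ + 15 * ∑ v ∈ A \ A', outDeg src v
    ≤ 16 * q * across src rev (fun _ => 1) A Aᶜ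

section

variable {φ : ℝ} {n N : ℕ} {src : Fin N → Fin n} {rev : Fin N → Fin N} {L q h T : ℕ}
  {A A' : Finset (Fin n)} {M : Mem} {r : Fin N → ℕ} {l : Fin n → ℕ} {p : ℕ}

theorem Progress.step {A'' : Finset (Fin n)} {r' : Fin N → ℕ} (H : Progress src rev q p A A' r)
    (hsub : A'' ⊆ A') (hr : Preflow src rev A'' q r')
    (hiso : ∀ v, outDeg src v = 0 → (v ∈ A'' ↔ v ∈ A'))
    (hmass : 8 * ∑ v ∈ A'', excess src (q + p + 1) r' v ≤ ∑ v ∈ A', excess src (q + p) r v)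
    (hcut : 16 * q * across src rev (fun _ => 1) A'' A''ᶜ + 15 * ∑ v ∈ A' \ A'', outDeg src v
      ≤ 16 * q * across src rev (fun _ => 1) A' A'ᶜ) :
    Progress src rev q (p + 1) A A'' r' where
  subset := hsub.trans H.subset
  isolated v hv := (hiso v hv).trans (H.isolated v hv)
  flow := hr
  mass := by
    refine le_trans ?_ H.mass
    rw [pow_succ, mul_assoc]
    exact Nat.mul_le_mul_left _ hmass
  cut := by
    have h1 : A \ A'' = (A \ A') ∪ (A' \ A'') := by
      ext v
      have h2 := @hsub v
      have h3 := @H.subset v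
      simp only [Finset.mem_sdiff, Finset.mem_union]
      tauto
    have h2 : Disjoint (A \ A') (A' \ A'') :=
      Finset.disjoint_left.2 fun v h3 h4 =>
        (Finset.mem_sdiff.1 h3).2 (Finset.mem_sdiff.1 h4).1
    rw [h1, Finset.sum_union h2]
    have := H.cut
    omega

theorem Stored.congr {M' : Mem} (hS : Stored src A' r l M) (h18 : M' 18 = M 18)
    (h19 : M' 19 = M 19) (h20 : M' 20 = M 20) : Stored src A' r l M' :=
  ⟨fun t => by rw [h18]; exact hS.mem t, fun t => by rw [h19]; exact hS.label t,
    fun t => by rw [h20]; exact hS.res t⟩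

/-- To avoid a multiplication, every arc of the cut contributes `32 * q` to the first total instead
of `1`. -/
theorem levelProg_spec (hM : Static src rev L q h T A M)
    (hS : Stored src A' r l M) {i : ℕ} (hi : M 13 0 = i) {Q : Mem → Prop}
    (hQ : ∀ M', Static src rev L q h T A M' → Stored src A' r l M' → M' 11 = M 11 →
      M' 13 0 = i + 1 → M' 14 0 = (if 32 * q * levelCut src rev A' l (i + 1)
        ≤ levelVol src A' l (i + 1) then i + 1 else M 14 0) → Q M') :
    Runs φ N levelProg M (1000 * (L + L + 1)) Q := by
  refine Runs.mono_cost (S := 50 + (50 + (300 + (100 * (L + L + 1) + (50 + (50 + (50 +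
    (100 * (L + L + 1) + 50)))))))) ?_ (by linarith)
  refine Runs.seq (hM.assign (by decide) fun M₁ hM₁ h₁ n₁ => ?_)
  refine Runs.seq (hM₁.parallel' (by decide) fun M₂ hM₂ h₂ n₂ => ?_)
  refine Runs.seq (hM₂.parallel (by decide) fun M₃ hM₃ h₃ h₃' n₃ => ?_)
  have e13 : M₂ 13 0 = i + 1 := by
    rw [n₂ 13 (by decide), h₁]
    simp only [Expr.eval, hi]
  have n2 : ∀ b, b ≠ 13 → b ≠ 21 → M₂ b = M b := by
    intro b _ _
    rw [n₂ b, n₁ b] <;> assumption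
  have e18 := hS.mem
  have e19 := hS.label
  have x3 : ∀ t : Fin N, M₃ 21 t = if src t ∈ A' ∧ src (rev t) ∈ A' ∧ l (src t) = i + 1 ∧
      l (src (rev t)) + 1 = i + 1 then 32 * q else 0 := by
    intro t
    have hiff : (Expr.min inside (.min (.min (.le (.own 19) (.var 13)) (.le (.var 13) (.own 19)))
      (.min (.le (.add (revOf 19) (.lit 1)) (.var 13))
        (.le (.var 13) (.add (revOf 19) (.lit 1)))))).Holds φ M₂ t
        ↔ src t ∈ A' ∧ src (rev t) ∈ A' ∧ l (src t) = i + 1 ∧ l (src (rev t)) + 1 = i + 1 := by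
      simp only [holds_min, holds_get, holds_le, Expr.eval, hM₂.reverse, e13]
      rw [n2 18, n2 19, e18, e19, e18, e19] <;> first | decide | skip
      rw [← le_antisymm_iff, ← le_antisymm_iff]
      simp [and_assoc]
    split_ifs with hcase
    · rw [h₃ t (hiff.2 hcase)]
      simp only [Expr.eval, hM₂.cap]
      ring
    · rw [h₃' t (mt hiff.1 hcase), h₂]
      rfl
  refine Runs.seq (totalProg_spec hM₃ x3 fun M₄ hM₄ h₄ n₄ => ?_)
  refine Runs.seq (hM₄.assign (by decide) fun M₅ hM₅ h₅ n₅ => ?_)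
  refine Runs.seq (hM₅.parallel' (by decide) fun M₆ hM₆ h₆ n₆ => ?_)
  refine Runs.seq (hM₆.parallel (by decide) fun M₇ hM₇ h₇ h₇' n₇ => ?_)
  have n6 : ∀ b, b ≠ 10 → b ≠ 13 → b ≠ 15 → b ≠ 21 → b ≠ 28 → b ≠ 29 → M₆ b = M b := by
    intro b _ _ _ _ _ _
    rw [n₆ b, n₅ b, n₄ b, n₃ b, n2 b] <;> assumption
  have e13' : M₆ 13 0 = i + 1 := by
    rw [n₆ 13, n₅ 13, n₄ 13, n₃ 13, e13] <;> decide
  have x7 : ∀ t : Fin N, M₇ 21 t = if src t ∈ A' ∧ i + 1 ≤ l (src t) then 1 else 0 := by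
    intro t
    have hiff : (Expr.min (.own 18) (.le (.var 13) (.own 19))).Holds φ M₆ t
        ↔ src t ∈ A' ∧ i + 1 ≤ l (src t) := by
      simp only [holds_min, holds_get, holds_le, Expr.eval, e13']
      rw [n6 18, n6 19, e18, e19] <;> first | decide | skip
      simp
    split_ifs with hcase
    · rw [h₇ t (hiff.2 hcase)]
      rfl
    · rw [h₇' t (mt hiff.1 hcase), h₆]
      rfl
  refine Runs.seq (totalProg_spec hM₇ x7 fun M₈ hM₈ h₈ n₈ => ?_)
  have n8 : ∀ b, b ≠ 10 → b ≠ 13 → b ≠ 15 → b ≠ 21 → b ≠ 28 → b ≠ 29 → M₈ b = M b := by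
    intro b _ _ _ _ _ _
    rw [n₈ b, n₇ b, n6 b] <;> assumption
  have e13'' : M₈ 13 0 = i + 1 := by
    rw [n₈ 13, n₇ 13, e13'] <;> decide
  have hiff : (Expr.le (.var 28) (.var 29)).Holds φ M₈ 0
      ↔ 32 * q * levelCut src rev A' l (i + 1) ≤ levelVol src A' l (i + 1) := by
    simp only [holds_le, Expr.eval]
    rw [h₈, n₈ 28 (by decide) (by decide) (by decide), n₇ 28 (by decide), n₆ 28 (by decide), h₅]
    simp only [Expr.eval]
    rw [h₄, levelCut, levelVol, Finset.mul_sum]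
    simp only [mul_ite, mul_one, mul_zero]
  have hS₈ : Stored src A' r l M₈ := hS.congr (n8 _ (by decide) (by decide) (by decide) (by decide)
    (by decide) (by decide)) (n8 _ (by decide) (by decide) (by decide) (by decide)
    (by decide) (by decide)) (n8 _ (by decide) (by decide) (by decide) (by decide)
    (by decide) (by decide))
  refine Runs.ite (S := 20) hM.pos (fun hc => ?_) (fun hc => Runs.skip ?_) (by decide)
  · refine hM₈.assign (by decide) fun M₉ hM₉ h₉ n₉ => ?_
    refine hQ M₉ hM₉ (hS₈.congr (n₉ _ (by decide)) (n₉ _ (by decide)) (n₉ _ (by decide))) ?_ ?_ ?_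
    · rw [n₉ 11, n8 11] <;> decide
    · rw [n₉ 13, e13'']; decide
    · rw [if_pos (hiff.1 hc), h₉]
      exact e13''
  · refine hQ M₈ hM₈ hS₈ ?_ e13'' ?_
    · rw [n8 11] <;> decide
    · rw [if_neg (mt hiff.2 hc), n8 14] <;> decide

theorem phaseProg_spec (hrev : Function.Involutive rev) (hM : Static src rev L q h T A M)
    (hq : 0 < q) (hL : 0 < L) (hh : h = 32 * q * (L + L)) (hT : T = 32 * q * h)
    (h18 : ∀ t : Fin N, M 18 t = if src t ∈ A' then 1 else 0) (h20 : ∀ t : Fin N, M 20 t = r t)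
    (hp : M 11 0 = p) (H : Progress src rev q p A A' r) {Q : Mem → Prop}
    (hQ : ∀ M' A'' r', Static src rev L q h T A M' →
      (∀ t : Fin N, M' 18 t = if src t ∈ A'' then 1 else 0) → (∀ t : Fin N, M' 20 t = r' t) →
      M' 11 0 = p → Progress src rev q (p + 1) A A'' r' → Q M') :
    Runs φ N phaseProg M (1500 * (L + L + 1) * (T + h + 1)) Q := by
  have hcost : 50 + (50 + ((T * (9 + (1000 * (L + L + 1) + 50)) + 9) + (50 + (50 +
      ((h * (9 + 1000 * (L + L + 1)) + 9) + (50 + 50)))))) ≤ 1500 * (L + L + 1) * (T + h + 1) := by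
    have e1 : T ≤ (L + L + 1) * T := Nat.le_mul_of_pos_left _ (by omega)
    have e2 : h ≤ (L + L + 1) * h := Nat.le_mul_of_pos_left _ (by omega)
    nlinarith
  refine Runs.mono_cost ?_ hcost
  have hhpos : 0 < h := by rw [hh]; positivity
  refine Runs.seq (hM.parallel' (by decide) fun M₁ hM₁ h₁ n₁ => ?_)
  refine Runs.seq (hM₁.assign (by decide) fun M₂ hM₂ h₂ n₂ => ?_)
  set F := ∑ v ∈ A', excess src (q + p) r v with hF
  refine Runs.seq ?_
  refine Runs.loop hM.pos (fun k M' => Static src rev L q h T A M' ∧ M' 12 0 = k ∧ M' 11 0 = p ∧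
    ∃ r' l', Stored src A' r' l' M' ∧ Labelled src rev A' q p h F k r' l') T
    (1000 * (L + L + 1) + 50) ?_ ?_ ?_ (by simp [Expr.size]) ?_
  · refine ⟨hM₂, h₂, ?_, r, fun _ => 0, ⟨fun t => ?_, fun t => ?_, fun t => ?_⟩,
      Labelled.init H.flow le_rfl⟩
    · rw [n₂ 11, n₁ 11, hp] <;> decide
    · rw [n₂ 18, n₁ 18, h18] <;> decide
    · rw [n₂ 19, h₁] <;> first | decide | rfl
    · rw [n₂ 20, n₁ 20, h20] <;> decide
  · rintro k M₃ hk ⟨hM₃, e12, e11, r', l', hS, hl⟩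
    refine ⟨by simp [Expr.eval, e12, hM₃.rounds]; omega, Runs.seq ?_⟩
    refine roundProg_spec hrev hM₃ hS e11 hl fun M₄ r'' l'' hM₄ hS₄ hl₄ n11 n12 => ?_
    refine hM₄.assign (by decide) fun M₅ hM₅ h₅ n₅ => ?_
    refine ⟨hM₅, ?_, ?_, r'', l'', hS₄.congr (n₅ _ (by decide)) (n₅ _ (by decide))
      (n₅ _ (by decide)), hl₄⟩
    · rw [h₅]
      simp only [Expr.eval]
      rw [n12, e12]
    · rw [n₅ 11 (by decide), n11, e11]
  · rintro M₃ ⟨hM₃, e12, -⟩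
    simp [Expr.eval, e12, hM₃.rounds]
  rintro M₃ ⟨hM₃, -, e11, r', l', hS, hl⟩
  refine Runs.seq (hM₃.assign (by decide) fun M₄ hM₄ h₄ n₄ => ?_)
  refine Runs.seq (hM₄.assign (by decide) fun M₅ hM₅ h₅ n₅ => ?_)
  refine Runs.seq ?_
  -- Variable `14` remembers a sparse level found so far. The value `0` means that there is none,
  -- which is unambiguous because levels start at `1`.
  refine Runs.loop hM.pos (fun i M' => Static src rev L q h T A M' ∧ Stored src A' r' l' M' ∧
    M' 11 0 = p ∧ M' 13 0 = i ∧
    (∀ j, 1 ≤ j → j ≤ i → 32 * q * levelCut src rev A' l' j ≤ levelVol src A' l' j →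
      M' 14 0 ≠ 0) ∧
    (M' 14 0 ≠ 0 → M' 14 0 ≤ i ∧ 32 * q * levelCut src rev A' l' (M' 14 0)
      ≤ levelVol src A' l' (M' 14 0))) h (1000 * (L + L + 1)) ?_ ?_ ?_ (by simp [Expr.size]) ?_
  · refine ⟨hM₅, hS.congr ?_ ?_ ?_, ?_, ?_, fun j _ _ => by omega, fun h0 => absurd h₅ h0⟩
    · rw [n₅, n₄] <;> decide
    · rw [n₅, n₄] <;> decide
    · rw [n₅, n₄] <;> decide
    · rw [n₅, n₄, e11] <;> decide
    · rw [n₅, h₄] <;> first | decide | rfl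
  · rintro i M₆ hi ⟨hM₆, hS₆, e11, e13, hsome, hall⟩
    refine ⟨by simp [Expr.eval, e13, hM₆.height]; omega, ?_⟩
    refine levelProg_spec hM₆ hS₆ e13 fun M₇ hM₇ hS₇ n11 e13' e14 => ?_
    refine ⟨hM₇, hS₇, by rw [n11, e11], e13', fun j h1 h2 h3 => ?_, fun h0 => ?_⟩
    · rw [e14]
      split_ifs with hc
      · omega
      · rcases Nat.lt_or_ge i j with hj | hj
        · obtain rfl : j = i + 1 := by omega
          exact absurd h3 hc
        · exact hsome j h1 hj h3
    · by_cases hc : 32 * q * levelCut src rev A' l' (i + 1) ≤ levelVol src A' l' (i + 1)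
      · rw [if_pos hc] at e14
        rw [e14]
        exact ⟨le_rfl, hc⟩
      · rw [if_neg hc] at e14
        rw [e14] at h0 ⊢
        exact ⟨(hall h0).1.trans (Nat.le_succ _), (hall h0).2⟩
  · rintro M₆ ⟨hM₆, -, -, e13, -⟩
    simp [Expr.eval, e13, hM₆.height]
  rintro M₆ ⟨hM₆, hS₆, e11, e13, hsome, hall⟩
  -- The height `h` is exactly the number `K * Λ` of levels that ball growing needs.
  obtain ⟨j, hj1, hj2, hj3⟩ := exists_sparse_levelCut (src := src) (A := A') hrev
    (K := 32 * q) (Λ := L + L) (by omega) (by simpa using hM.le_pow) l' (by omega)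
  have hne := hsome j hj1 (hh ▸ hj2) hj3
  obtain ⟨hih, hsparse⟩ := hall hne
  set i := M₆ 14 0 with hi
  refine Runs.seq (hM₆.parallel (by decide) fun M₇ hM₇ h₇ h₇' n₇ => ?_)
  refine hM₇.parallel (by decide) fun M₈ hM₈ h₈ h₈' n₈ => ?_
  set A'' := A'.filter (fun v => l' v < i) with hA''
  have e18 : ∀ t : Fin N, M₇ 18 t = if src t ∈ A'' then 1 else 0 := by
    intro t
    have hiff : (Expr.le (.var 14) (.own 19)).Holds φ M₆ t ↔ i ≤ l' (src t) := by
      simp only [holds_le, Expr.eval, hS₆.label]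
      rfl
    by_cases hc : i ≤ l' (src t)
    · rw [h₇ t (hiff.2 hc), if_neg]
      · rfl
      · simp [hA'', hc]
    · rw [h₇' t (mt hiff.1 hc), hS₆.mem]
      simp [hA'', not_le.1 hc]
  set r'' : Fin N → ℕ := fun t => if src (rev t) ∈ A'' then r' t else 2 * q with hr''
  subst hT
  obtain ⟨c1, c2, c3, c4⟩ := hl.cut hrev hq hhpos (by omega) hih hsparse (A' := A'') (r' := r'')
    (fun v => by simp [hA'']) (fun _ => rfl)
  refine hQ M₈ A'' r'' hM₈ (fun t => ?_) (fun t => ?_) ?_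
    (H.step (Finset.filter_subset _ _) c1 c2 c3 c4)
  · rw [n₈ 18 (by decide), e18]
  · have hiff : (Expr.not (revOf 18)).Holds φ M₇ t ↔ src (rev t) ∉ A'' := by
      simp only [holds_not, holds_get, Expr.eval, hM₇.reverse, e18]
      simp
    simp only [hr'']
    split_ifs with hc
    · rw [h₈' t (fun hcon => hiff.1 hcon hc), n₇ 20 (by decide), hS₆.res]
    · rw [h₈ t (hiff.2 hc)]
      simp only [Expr.eval, hM₇.cap]
      ring
  · rw [n₈ 11, n₇ 11, e11] <;> decide

/-- Only the first arc of a removed vertex clears its mark, which makes the output writes exclusive.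
A vertex without arcs is never cleared, and `Progress.isolated` says that it is never removed. -/
theorem mainProg_spec (hrev : Function.Involutive rev) (hM : Static src rev L q h T A M)
    (hq : 0 < q) (hL : 0 < L) (hh : h = 32 * q * (L + L)) (hT : T = 32 * q * h)
    (h18 : ∀ t : Fin N, M 18 t = if src t ∈ A then 1 else 0) (h20 : ∀ t : Fin N, M 20 t = r t)
    (H : Progress src rev q 0 A A r) {Q : Mem → Prop}
    (hQ : ∀ M' A' r', outputSet n M' = A' → Progress src rev q L A A' r' → Q M') :
    Runs φ N mainProg M (1600 * (L + L + 1) * (T + h + 1) * (L + 1)) Q := by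
  have hcost : 50 + ((L * (9 + (1500 * (L + L + 1) * (T + h + 1) + 50)) + 9) + 50)
      ≤ 1600 * (L + L + 1) * (T + h + 1) * (L + 1) := by
    have e1 : 1 ≤ (L + L + 1) * (T + h + 1) := Nat.mul_pos (by omega) (by omega)
    nlinarith
  refine Runs.mono_cost ?_ hcost
  refine Runs.seq (hM.assign (by decide) fun M₁ hM₁ h₁ n₁ => ?_)
  refine Runs.seq ?_
  refine Runs.loop hM.pos (fun p M' => ∃ A' r', Static src rev L q h T A M' ∧
    (∀ t : Fin N, M' 18 t = if src t ∈ A' then 1 else 0) ∧ (∀ t : Fin N, M' 20 t = r' t) ∧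
    M' 11 0 = p ∧ Progress src rev q p A A' r') L (1500 * (L + L + 1) * (T + h + 1) + 50)
    ?_ ?_ ?_ (by simp [Expr.size]) ?_
  · refine ⟨A, r, hM₁, fun t => ?_, fun t => ?_, h₁, H⟩
    · rw [n₁ 18 (by decide), h18]
    · rw [n₁ 20 (by decide), h20]
  · rintro p M₂ hp ⟨A', r', hM₂, e18, e20, e11, hP⟩
    refine ⟨by simp [Expr.eval, e11, hM₂.levels]; omega, Runs.seq ?_⟩
    refine phaseProg_spec hrev hM₂ hq hL hh hT e18 e20 e11 hP
      fun M₃ A'' r'' hM₃ e18' e20' e11' hP' => ?_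
    refine hM₃.assign (by decide) fun M₄ hM₄ h₄ n₄ => ?_
    refine ⟨A'', r'', hM₄, fun t => ?_, fun t => ?_, ?_, hP'⟩
    · rw [n₄ 18 (by decide), e18']
    · rw [n₄ 20 (by decide), e20']
    · rw [h₄]
      simp only [Expr.eval]
      rw [e11']
  · rintro M₂ ⟨A', r', hM₂, -, -, e11, -⟩
    simp [Expr.eval, e11, hM₂.levels]
  rintro M₂ ⟨A', r', hM₂, e18, -, -, hP⟩
  have hiff : ∀ t : Fin N, (Expr.min (.own 27) (.not (.own 18))).Holds φ M₂ t
      ↔ (∀ t' < t, src t' ≠ src t) ∧ src t ∉ A' := by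
    intro t
    simp only [holds_min, holds_not, holds_get, Expr.eval, hM₂.leader, e18]
    simp
  refine Runs.scatter hM.pos (K := N) hM₂.arcs le_rfl ?_ (by decide) fun M₃ h₃ h₃' => ?_
  · intro t t' ht ht' hg hg' _ hi
    have g1 := ((hiff ⟨t, ht⟩).1 hg).1
    have g2 := ((hiff ⟨t', ht'⟩).1 hg').1
    simp only [Expr.eval] at hi
    have e1 := hM₂.source ⟨t, ht⟩
    have e2 := hM₂.source ⟨t', ht'⟩
    simp only at e1 e2
    rw [e1, e2] at hi
    have hi := Fin.ext hi
    rcases lt_trichotomy t t' with hlt | heq | hlt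
    · exact absurd hi (g2 ⟨t, ht⟩ hlt)
    · exact heq
    · exact absurd hi.symm (g1 ⟨t', ht'⟩ hlt)
  · refine hQ M₃ A' r' ?_ hP
    ext v
    simp only [outputSet, Finset.mem_filter, Finset.mem_univ, true_and]
    by_cases hv : v ∈ A'
    · have : M₃ 3 v = M₂ 3 v := by
        refine h₃' 3 v fun t ht hg _ hi => ?_
        have g1 := ((hiff ⟨t, ht⟩).1 hg).2
        have e1 := hM₂.source ⟨t, ht⟩
        simp only [Expr.eval] at hi e1
        rw [e1] at hi
        rw [Fin.ext hi] at g1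
        exact g1 hv
      rw [this, hM₂.input, if_pos (hP.subset hv)]
      simpa using hv
    · simp only [hv, iff_false, not_not]
      by_cases harc : ∃ t, src t = v
      · obtain ⟨t, ht, hmin⟩ := Finset.exists_min_image (Finset.univ.filter fun t => src t = v) id
          (by obtain ⟨t, ht⟩ := harc; exact ⟨t, by simpa using ht⟩)
        simp only [Finset.mem_filter, Finset.mem_univ, true_and, id] at ht hmin
        have := h₃ t t.2 ((hiff t).2 ⟨fun t' h1 h2 => absurd h1 (not_lt.2 (hmin t' (h2.trans ht))),
          ht ▸ hv⟩)
        simp only [Expr.eval, hM₂.source, ht] at this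
        exact this
      · have hA : v ∉ A := by
          rw [← hP.isolated v]
          · exact hv
          · unfold outDeg outSum
            refine Finset.sum_eq_zero fun t ht => ?_
            exact absurd ⟨t, (Finset.mem_filter.1 ht).2⟩ harc
        rw [h₃' 3 v, hM₂.input, if_neg hA]
        intro t ht hg _ hi
        have e1 := hM₂.source ⟨t, ht⟩
        simp only [Expr.eval] at hi e1
        rw [e1] at hi
        exact harc ⟨_, Fin.ext hi⟩

end

end Pram

namespace Pram

open Trim

/-! ### Initialization -/

/-- `32` times the capacity. -/
abbrev cap32 : Expr := .dbl (.dbl (.dbl (.dbl (.dbl (.var 6)))))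

/-- Computation of the scalar parameters. -/
def paramProg : Prog :=
  .seq (.assign 4 (.dbl (.get (.lit 0) (.lit 1)))) <|
  .seq (.assign 28 (.var 0)) <|
  .seq (.loop (.lt (.lit 0) (.var 28))
    (.seq (.assign 28 (.half (.var 28))) (.assign 5 (.add (.var 5) (.lit 1))))) <|
  .seq (.loop (.not (.leParam (.add (.dbl (.var 5)) (.var 5)) (.dbl (.var 6))))
    (.assign 6 (.add (.var 6) (.lit 1)))) <|
  .seq (.loop (.lt (.var 10) (.dbl (.var 5)))
    (.seq (.assign 7 (.add (.var 7) cap32)) (.assign 10 (.add (.var 10) (.lit 1))))) <|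
  .seq (.loop (.lt (.var 11) (.var 7))
    (.seq (.assign 8 (.add (.var 8) cap32)) (.assign 11 (.add (.var 11) (.lit 1))))) <|
  .seq (.assign 9 (.lit 1)) <|
  .loop (.lt (.var 12) (.dbl (.var 5)))
    (.seq (.assign 9 (.dbl (.var 9))) (.assign 12 (.add (.var 12) (.lit 1))))

/-- Computation of the sources and the reversals of the arcs. -/
def arcProg : Prog :=
  .seq (.arcs 16 (.lt .tid (.get (.lit 0) (.lit 1))) (.own 1)) <|
  .seq (.arcs 16 (.le (.get (.lit 0) (.lit 1)) .tid)
    (.get (.lit 2) (.sub .tid (.get (.lit 0) (.lit 1))))) <|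
  .seq (.arcs 17 (.lt .tid (.get (.lit 0) (.lit 1))) (.add .tid (.get (.lit 0) (.lit 1)))) <|
  .arcs 17 (.le (.get (.lit 0) (.lit 1)) .tid) (.sub .tid (.get (.lit 0) (.lit 1)))

/-- The table of a vertex, which contains one arc for each block. -/
abbrev table : Expr := .add (.lit 41) (.dbl (.own 16))

/-- The sibling of the block of an arc. -/
abbrev sibling : Expr :=
  .sub (.add (.dbl (.dbl (.half (.own 26)))) (.lit 1)) (.own 26)

/-- One level of the computation of the pointers. -/
def pointerStep : Prog :=
  .seq (.pardo (.var 4) (.own 27) table (.own 26) (.sub (.var 4) .tid)) <|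
  .seq (.pardo (.var 4) (.lit 1) (.add (.lit 40) (.dbl (.var 10))) .tid
    (.sub (.var 4) (.get table sibling))) <|
  .seq (.arcs 27 (.lt ptr .tid) (.lit 0)) <|
  .seq (.arcs 26 (.lit 1) (.half (.own 26))) <|
  .assign 10 (.add (.var 10) (.lit 1))

/-- Computation of the pointers of the arcs. -/
def pointerProg : Prog :=
  .seq (.arcs 26 (.lit 1) (.add (.var 9) .tid)) <|
  .seq (.arcs 27 (.lit 1) (.lit 1)) <|
  .seq (.assign 10 (.lit 0)) <|
  .loop (.lt (.var 10) (.dbl (.var 5))) pointerStep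

/-- Computation of the flow at the start. -/
def flowProg : Prog :=
  .seq (.arcs 18 (.lit 1) (.get (.lit 3) (.own 16))) <|
  .seq (.arcs 20 (.lit 1) (.var 6)) <|
  .arcs 20 (.not (revOf 18)) (.dbl (.var 6))

section

variable {φ : ℝ} {M : Mem}

/-- Products are formed by repeated addition, at a cost linear in `h` and hence dominated by the
main loop. The capacity is found by linear search: `3 * L ≤ 2 * i * φ` first holds when `i` is the
ceiling, and `0 < φ` makes the search end. -/
theorem paramProg_spec {n m : ℕ} (hm : 0 < m) (hφ : 0 < φ) (h0 : M 0 0 = n) (h1 : M 0 1 = m)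
    (hz : ∀ b j, 4 ≤ b → M b j = 0) {L q h T : ℕ} (hL : L = n.size)
    (hq : q = ⌈(3 * L : ℝ) / (2 * φ)⌉₊) (hh : h = 32 * q * (L + L)) (hT : T = 32 * q * h)
    {Q : Mem → Prop}
    (hQ : ∀ M', M' 4 0 = m + m → M' 5 0 = L → M' 6 0 = q → M' 7 0 = h → M' 8 0 = T →
      M' 9 0 = 2 ^ (L + L) → (∀ b, b < 4 ∨ 13 ≤ b ∧ b ≠ 28 → M' b = M b) → Q M') :
    Runs φ (m + m) paramProg M (1000 * (L + q + h + 1)) Q := by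
  have hN : 0 < m + m := by omega
  refine Runs.mono_cost (S := 20 + (20 + ((L * (20 + 60) + 20) + ((q * (40 + 60) + 40) +
    (((L + L) * (20 + 250) + 20) + ((h * (20 + 250) + 20) + (20 + ((L + L) * (20 + 60) + 20)))))))) ?_
    (by linarith)
  refine Runs.seq (Runs.assign hN (by decide) fun M₁ h₁ n₁ => ?_)
  refine Runs.seq (Runs.assign hN (by decide) fun M₂ h₂ n₂ => ?_)
  simp only [Expr.eval] at h₁ h₂
  refine Runs.seq (Runs.loop hN (fun i M' => M' 28 0 = n / 2 ^ i ∧ M' 5 0 = i ∧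
    ∀ b, b ≠ 28 → b ≠ 5 → M' b = M₂ b) L 60 ?_ ?_ ?_ (by simp [Expr.size]; omega) ?_)
  · refine ⟨by rw [h₂, n₁ 0 (by decide), h0]; simp, ?_, fun _ _ _ => rfl⟩
    rw [n₂ 5 (by decide), n₁ 5 (by decide), hz]; decide
  · rintro i M₃ hi ⟨e28, e5, n₃⟩
    rw [hL, Nat.lt_size] at hi
    refine ⟨by simp only [holds_le, Expr.eval, e28]; exact Nat.div_pos hi (by positivity), ?_⟩
    refine Runs.mono_cost (S := 20 + 20) ?_ (by omega)
    refine Runs.seq (Runs.assign hN (by decide) fun M₄ h₄ n₄ => ?_)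
    refine Runs.assign hN (by decide) fun M₅ h₅ n₅ => ?_
    simp only [Expr.eval] at h₄ h₅
    refine ⟨?_, ?_, fun b hb hb' => by rw [n₅ b hb', n₄ b hb, n₃ b hb hb']⟩
    · rw [n₅ 28 (by decide), h₄, e28, Nat.div_div_eq_div_mul, pow_succ]
    · rw [h₅, n₄ 5 (by decide), e5]
  · rintro M₃ ⟨e28, -, -⟩
    simp only [holds_le, Expr.eval, e28]
    rw [Nat.div_eq_of_lt (hL ▸ Nat.lt_size_self n)]
    decide
  rintro M₃ ⟨-, e5, n₃⟩
  have n03 : ∀ b, b ≠ 4 → b ≠ 5 → b ≠ 28 → M₃ b = M b := by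
    intro b _ _ _
    rw [n₃ b, n₂ b, n₁ b] <;> assumption
  refine Runs.seq (Runs.loop hN (fun i M' => M' 6 0 = i ∧ ∀ b, b ≠ 6 → M' b = M₃ b) q 60 ?_ ?_ ?_
    (by simp [Expr.size]; omega) ?_)
  · exact ⟨by rw [n03, hz] <;> decide, fun _ _ => rfl⟩
  · rintro i M₄ hi ⟨e6, n₄⟩
    refine ⟨?_, Runs.assign hN (by decide) fun M₅ h₅ n₅ => ⟨?_, fun b hb => ?_⟩⟩
    · rw [hq, Nat.lt_ceil, lt_div_iff₀ (by positivity)] at hi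
      simp only [holds_not, holds_leParam, Expr.eval, e6, n₄ 5 (by decide), e5]
      push_cast
      linarith
    · rw [h₅]
      simp only [Expr.eval]
      rw [e6]
    · rw [n₅ b hb, n₄ b hb]
  · rintro M₄ ⟨e6, n₄⟩
    have := Nat.le_ceil ((3 * L : ℝ) / (2 * φ))
    rw [← hq, div_le_iff₀ (by positivity)] at this
    simp only [holds_not, holds_leParam, Expr.eval, e6, n₄ 5 (by decide), e5, not_not]
    push_cast
    linarith
  rintro M₄ ⟨e6, n₄⟩
  have n04 : ∀ b, b ≠ 4 → b ≠ 5 → b ≠ 6 → b ≠ 28 → M₄ b = M b := by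
    intro b _ _ _ _
    rw [n₄ b, n03 b] <;> assumption
  have e5' : M₄ 5 0 = L := by rw [n₄ 5 (by decide), e5]
  refine Runs.seq (Runs.loop hN (fun i M' => M' 7 0 = 32 * q * i ∧ M' 10 0 = i ∧
    ∀ b, b ≠ 7 → b ≠ 10 → M' b = M₄ b) (L + L) 250 ?_ ?_ ?_ (by simp [Expr.size]; omega) ?_)
  · exact ⟨by rw [n04, hz, mul_zero] <;> decide, by rw [n04, hz] <;> decide, fun _ _ _ => rfl⟩
  · rintro i M₅ hi ⟨e7, e10, n₅⟩
    refine ⟨by simp only [holds_le, Expr.eval, e10, n₅ 5 (by decide) (by decide), e5']; omega, ?_⟩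
    refine Runs.mono_cost (S := 230 + 20) ?_ (by omega)
    refine Runs.seq (Runs.assign hN (by decide) fun M₆ h₆ n₆ => ?_)
    refine Runs.assign hN (by decide) fun M₇ h₇ n₇ => ?_
    simp only [Expr.eval] at h₆ h₇
    refine ⟨?_, ?_, fun b hb hb' => by rw [n₇ b hb', n₆ b hb, n₅ b hb hb']⟩
    · rw [n₇ 7 (by decide), h₆, e7, n₅ 6 (by decide) (by decide), e6]
      ring
    · rw [h₇, n₆ 10 (by decide), e10]
  · rintro M₅ ⟨-, e10, n₅⟩
    simp [Expr.eval, e10, n₅ 5, e5']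
  rintro M₅ ⟨e7, e10, n₅⟩
  rw [← hh] at e7
  refine Runs.seq (Runs.loop hN (fun i M' => M' 8 0 = 32 * q * i ∧ M' 11 0 = i ∧
    ∀ b, b ≠ 8 → b ≠ 11 → M' b = M₅ b) h 250 ?_ ?_ ?_ (by simp [Expr.size]; omega) ?_)
  · exact ⟨by rw [n₅, n04, hz, mul_zero] <;> decide, by rw [n₅, n04, hz] <;> decide, fun _ _ _ => rfl⟩
  · rintro i M₆ hi ⟨e8, e11, n₆⟩
    refine ⟨by simp only [holds_le, Expr.eval, e11, n₆ 7 (by decide) (by decide), e7]; omega, ?_⟩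
    refine Runs.mono_cost (S := 230 + 20) ?_ (by omega)
    refine Runs.seq (Runs.assign hN (by decide) fun M₇ h₇ n₇ => ?_)
    refine Runs.assign hN (by decide) fun M₈ h₈ n₈ => ?_
    simp only [Expr.eval] at h₇ h₈
    refine ⟨?_, ?_, fun b hb hb' => by rw [n₈ b hb', n₇ b hb, n₆ b hb hb']⟩
    · rw [n₈ 8 (by decide), h₇, e8, n₆ 6 (by decide) (by decide), n₅ 6 (by decide) (by decide), e6]
      ring
    · rw [h₈, n₇ 11 (by decide), e11]
  · rintro M₆ ⟨-, e11, n₆⟩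
    simp [Expr.eval, e11, n₆ 7, e7]
  rintro M₆ ⟨e8, -, n₆⟩
  rw [← hT] at e8
  refine Runs.seq (Runs.assign hN (by decide) fun M₇ h₇ n₇ => ?_)
  simp only [Expr.eval] at h₇
  have n07 : ∀ b, b < 4 ∨ 12 ≤ b ∧ b ≠ 28 → M₇ b = M b := by
    intro b _
    rw [n₇ b, n₆ b, n₅ b, n04 b] <;> omega
  have e5'' : M₇ 5 0 = L := by rw [n₇ 5, n₆ 5, n₅ 5, e5'] <;> decide
  refine Runs.loop hN (fun i M' => M' 9 0 = 2 ^ i ∧ M' 12 0 = i ∧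
    ∀ b, b ≠ 9 → b ≠ 12 → M' b = M₇ b) (L + L) 60 ?_ ?_ ?_ (by simp [Expr.size]; omega) ?_
  · exact ⟨h₇, by rw [n07, hz] <;> decide, fun _ _ _ => rfl⟩
  · rintro i M₈ hi ⟨e9, e12, n₈⟩
    refine ⟨by simp only [holds_le, Expr.eval, e12, n₈ 5 (by decide) (by decide), e5'']; omega, ?_⟩
    refine Runs.mono_cost (S := 20 + 20) ?_ (by omega)
    refine Runs.seq (Runs.assign hN (by decide) fun M₉ h₉ n₉ => ?_)
    refine Runs.assign hN (by decide) fun M₁₀ h₁₀ n₁₀ => ?_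
    simp only [Expr.eval] at h₉ h₁₀
    refine ⟨?_, ?_, fun b hb hb' => by rw [n₁₀ b hb', n₉ b hb, n₈ b hb hb']⟩
    · rw [n₁₀ 9 (by decide), h₉, e9]
      ring
    · rw [h₁₀, n₉ 12 (by decide), e12]
  · rintro M₈ ⟨-, e12, n₈⟩
    simp [Expr.eval, e12, n₈ 5, e5'']
  rintro M₈ ⟨e9, -, n₈⟩
  refine hQ M₈ ?_ ?_ ?_ ?_ ?_ e9 ?_
  · rw [n₈ 4, n₇ 4, n₆ 4, n₅ 4, n₄ 4, n₃ 4, n₂ 4, h₁, h1] <;> decide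
  · rw [n₈ 5, e5''] <;> decide
  · rw [n₈ 6, n₇ 6, n₆ 6, n₅ 6, e6] <;> decide
  · rw [n₈ 7, n₇ 7, n₆ 7, e7] <;> decide
  · rw [n₈ 8, n₇ 8, e8] <;> decide
  · intro b hb
    rw [n₈ b, n07 b] <;> omega

theorem arcProg_spec {m : ℕ} (hm : 0 < m) (h1 : M 0 1 = m) (h4 : M 4 0 = m + m) {Q : Mem → Prop}
    (hQ : ∀ M', (∀ t, t < m → M' 16 t = M 1 t ∧ M' 17 t = t + m) →
      (∀ t, m ≤ t → t < m + m → M' 16 t = M 2 (t - m) ∧ M' 17 t = t - m) →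
      (∀ b, b ≠ 16 → b ≠ 17 → M' b = M b) → Q M') :
    Runs φ (m + m) arcProg M 200 Q := by
  have hN : 0 < m + m := by omega
  refine Runs.mono_cost (S := 50 + (50 + (50 + 50))) ?_ (by omega)
  refine Runs.seq (Runs.arcs hN h4 (by decide) fun M₁ h₁ h₁' _ n₁ => ?_)
  rw [← n₁ 4 (by decide)] at h4
  refine Runs.seq (Runs.arcs hN h4 (by decide) fun M₂ h₂ h₂' _ n₂ => ?_)
  rw [← n₂ 4 (by decide)] at h4
  refine Runs.seq (Runs.arcs hN h4 (by decide) fun M₃ h₃ h₃' _ n₃ => ?_)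
  rw [← n₃ 4 (by decide)] at h4
  refine Runs.arcs hN h4 (by decide) fun M₄ h₄ h₄' _ n₄ => ?_
  have x1 : M₁ 0 1 = m := by rw [n₁ 0 (by decide), h1]
  have x2 : M₂ 0 1 = m := by rw [n₂ 0 (by decide), x1]
  have x3 : M₃ 0 1 = m := by rw [n₃ 0 (by decide), x2]
  simp only [holds_le, Expr.eval, h1, x1, x2, x3, Nat.succ_le_iff] at h₁ h₁' h₂ h₂' h₃ h₃' h₄ h₄'
  refine hQ M₄ (fun t ht => ⟨?_, ?_⟩) (fun t ht ht' => ⟨?_, ?_⟩) fun b hb hb' => ?_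
  · rw [n₄ 16 (by decide), n₃ 16 (by decide), h₂' t (by omega), h₁ t (by omega) ht]
  · rw [h₄' t (by omega), h₃ t (by omega) ht]
  · rw [n₄ 16 (by decide), n₃ 16 (by decide), h₂ t ht' ht, n₁ 2 (by decide)]
  · rw [h₄ t ht' ht]
  · rw [n₄ b hb', n₃ b hb', n₂ b hb, n₁ b hb]

end

/-! ### The pointer structure on the arcs and the initial flow -/

section

variable {φ : ℝ} {n N : ℕ} {src : Fin N → Fin n} {rev : Fin N → Fin N} {L q h T : ℕ}
  {A : Finset (Fin n)} {M : Mem}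

theorem le_block {Λ l t : ℕ} (hl : l ≤ Λ) : 2 ^ (Λ - l) ≤ block Λ l t := by
  rw [block, Nat.le_div_iff_mul_le (by positivity), ← pow_add, Nat.sub_add_cancel hl]
  omega

theorem block_lt {Λ l t : ℕ} (hl : l ≤ Λ) (ht : t < 2 ^ Λ) : block Λ l t < 2 * 2 ^ (Λ - l) := by
  rw [block, Nat.div_lt_iff_lt_mul (by positivity), mul_assoc, ← pow_add, Nat.sub_add_cancel hl]
  omega

/-- The invariant of the computation of the pointers, after `l` levels. -/
structure Pointers (src : Fin N → Fin n) (Λ l : ℕ) (M₀ M : Mem) : Prop where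
  counter : M 10 0 = l
  position : ∀ t : Fin N, M 26 t = block Λ l t
  leader : ∀ t : Fin N, M 27 t
    = if ∃ t' < t, src t' = src t ∧ block Λ l t' = block Λ l t then 0 else 1
  unused : ∀ v j, j < 2 * 2 ^ (Λ - l) → M (41 + (v + v)) j = 0
  sibling : ∀ l' < l, ∀ t : Fin N, IsSibling src Λ l' t (M (40 + (l' + l')) t)
  frame : ∀ b, b < 40 → b ≠ 10 → b ≠ 26 → b ≠ 27 → M b = M₀ b

/-- In the block of an arc, there is a first arc with the same source. -/
theorem exists_first (src : Fin N → Fin n) (Λ l : ℕ) (t : Fin N) :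
    ∃ s : Fin N, src s = src t ∧ block Λ l s = block Λ l t ∧
      ∀ t' < s, ¬ (src t' = src s ∧ block Λ l t' = block Λ l s) := by
  obtain ⟨s, hs, hmin⟩ := Finset.exists_min_image
    (Finset.univ.filter fun s => src s = src t ∧ block Λ l s = block Λ l t) id ⟨t, by simp⟩
  simp only [Finset.mem_filter, Finset.mem_univ, true_and, id] at hs hmin
  refine ⟨s, hs.1, hs.2, fun t' h1 h2 => ?_⟩
  exact absurd h1 (not_lt.2 (hmin t' ⟨h2.1.trans hs.1, h2.2.trans hs.2⟩))

/-- The first arc of a vertex in a block registers in the vertex's table under the block number, and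
every arc then looks up its sibling block. The table stores `N - t`, so that an untouched cell
decodes to the null pointer `N`. Pointers use even array numbers and tables odd ones, so they never
collide. -/
theorem pointerStep_spec {M₀ : Mem} {Λ l : ℕ} (hN : 0 < N) (hNΛ : N < 2 ^ Λ) (hl : l < Λ)
    (h4 : M₀ 4 0 = N) (h16 : ∀ t : Fin N, M₀ 16 t = src t) (H : Pointers src Λ l M₀ M) :
    Runs φ N pointerStep M 300 (Pointers src Λ (l + 1) M₀) := by
  have f4 : M 4 0 = N := by rw [H.frame, h4] <;> decide
  have f16 : ∀ t : Fin N, M 16 t = src t := fun t => by rw [H.frame, h16] <;> decide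
  have hlead : ∀ t : Fin N, M 27 t ≠ 0
      ↔ ∀ t' < t, ¬ (src t' = src t ∧ block Λ l t' = block Λ l t) := by
    intro t
    rw [H.leader]
    simp
  refine Runs.mono_cost (S := 50 + (70 + (50 + (50 + 50)))) ?_ (by omega)
  refine Runs.seq (Runs.scatter hN (K := N) f4 le_rfl ?_ (by decide) fun M₁ h₁ h₁' => ?_)
  · intro t t' ht ht' hg hg' ha hi
    lift t to Fin N using ht
    lift t' to Fin N using ht'
    simp only [Expr.eval, holds_get, f16, H.position] at hg hg' ha hi
    rw [hlead] at hg hg'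
    have hsrc : src t = src t' := Fin.ext (by omega)
    rcases lt_trichotomy t t' with hlt | heq | hlt
    · exact absurd ⟨hsrc, hi⟩ (hg' t hlt)
    · rw [heq]
    · exact absurd ⟨hsrc.symm, hi.symm⟩ (hg t' hlt)
  have h₁a : ∀ t : Fin N, (∀ t' < t, ¬ (src t' = src t ∧ block Λ l t' = block Λ l t)) →
      M₁ (41 + (src t + src t)) (block Λ l t) = N - t := by
    intro t ht
    have := h₁ t t.2 (by rw [holds_get]; exact (hlead t).2 ht)
    simpa only [Expr.eval, f16, H.position, f4] using this
  have h₁b : ∀ b j, (∀ t : Fin N, 41 + ((src t : ℕ) + src t) = b → block Λ l t ≠ j) →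
      M₁ b j = M b j := by
    intro b j hbj
    refine h₁' b j fun t ht _ => ?_
    lift t to Fin N using ht
    simp only [Expr.eval, f16, H.position]
    exact hbj t
  have n₁ : ∀ b, b < 41 → M₁ b = M b := by
    intro b hb
    funext j
    exact h₁b b j fun t ht => by omega
  have n₁' : ∀ l', M₁ (40 + (l' + l')) = M (40 + (l' + l')) := by
    intro l'
    funext j
    exact h₁b _ j fun t ht => by omega
  have k10 : M₁ 10 0 = l := by rw [n₁ 10 (by decide), H.counter]
  have k26 : ∀ t : Fin N, M₁ 26 t = block Λ l t := fun t => by rw [n₁ 26 (by decide), H.position]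
  have k4 : M₁ 4 0 = N := by rw [n₁ 4 (by decide), f4]
  have k16 : ∀ t : Fin N, M₁ 16 t = src t := fun t => by rw [n₁ 16 (by decide), f16]
  refine Runs.seq (Runs.pardo hN (K := N) (a₀ := 40 + (l + l)) k4 le_rfl
    (fun t => by simp only [Expr.eval, k10]) (by decide) ?_)
  set M₂ := store φ M₁ N (.lit 1) (40 + (l + l)) (.sub (.var 4) (.get table sibling)) with hM₂
  have n₂ : ∀ b, b ≠ 40 + (l + l) → M₂ b = M₁ b := fun b hb => store_of_ne hb
  have h₂ : ∀ t : Fin N, IsSibling src Λ l t (M₂ (40 + (l + l)) t) := by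
    intro t
    rw [hM₂, store_self t.2 holds_lit_one]
    simp only [Expr.eval, k4, k16, k26]
    -- Siblings are numbered `2 b` and `2 b + 1`, with sum `4 b + 1`, so `j` is the sibling of the
    -- block of `t`.
    set j := block Λ l t / 2 + block Λ l t / 2 + (block Λ l t / 2 + block Λ l t / 2) + 1
      - block Λ l t with hj
    by_cases hex : ∃ t', src t' = src t ∧ block Λ l t' = j
    · right
      obtain ⟨t', ht', hb'⟩ := hex
      obtain ⟨s, hs, hbs, hfirst⟩ := exists_first src Λ l t'
      refine ⟨s, ?_, hs.trans ht', ?_, by omega⟩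
      · have := h₁a s hfirst
        rw [hs, ht', hbs, hb'] at this
        rw [this]
        omega
      · rw [block_succ, block_succ]
        omega
    · left
      push Not at hex
      refine ⟨?_, fun t' h1 h2 => ?_⟩
      · rw [h₁b _ _ fun t' ht' => hex t' (Fin.ext (by omega)), H.unused]
        · rfl
        · have := block_lt (Λ := Λ) (l := l) (t := t) hl.le (t.2.trans hNΛ)
          omega
      · have := hex t' h1
        rw [block_succ, block_succ] at h2
        omega
  have k4' : M₂ 4 0 = N := by rw [n₂ 4 (by omega), k4]
  have k10' : M₂ 10 0 = l := by rw [n₂ 10 (by omega), k10]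
  refine Runs.seq (Runs.arcs hN k4' (by decide) fun M₃ h₃ h₃' _ n₃ => ?_)
  have k4'' : M₃ 4 0 = N := by rw [n₃ 4 (by omega), k4']
  refine Runs.seq (Runs.arcs hN k4'' (by decide) fun M₄ h₄ _ _ n₄ => ?_)
  refine Runs.assign hN (by decide) fun M₅ h₅ n₅ => ?_
  simp only [holds_le, Expr.eval, k10', Nat.succ_le_iff] at h₃ h₃'
  simp only [Expr.eval] at h₄ h₅
  refine ⟨?_, fun t => ?_, fun t => ?_, fun v j hj => ?_, fun l' hl' t => ?_, fun b h1 h2 h3 h4 => ?_⟩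
  · rw [h₅, n₄ 10 (by decide), n₃ 10 (by decide), k10']
  · rw [n₅ 26 (by decide), h₄ t t.2 holds_lit_one, n₃ 26 (by decide), n₂ 26 (by omega), k26,
      block_succ]
  · rw [n₅ 27 (by decide), n₄ 27 (by decide)]
    have hold : M₂ 27 t = if ∃ t' < t, src t' = src t ∧ block Λ l t' = block Λ l t then 0 else 1 := by
      rw [n₂ 27 (by omega), n₁ 27 (by decide), H.leader]
    rcases h₂ t with ⟨e1, e2⟩ | ⟨s, e1, e2, e3, e4⟩
    · rw [h₃' t (by rw [e1]; omega), hold]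
      refine if_congr ⟨?_, ?_⟩ rfl rfl
      · rintro ⟨t', h1, h2, h3⟩
        exact ⟨t', h1, h2, by rw [block_succ, block_succ, h3]⟩
      · rintro ⟨t', h1, h2, h3⟩
        exact ⟨t', h1, h2, e2 t' h2 h3⟩
    · by_cases hst : s < t
      · rw [h₃ t t.2 (by rw [e1]; exact hst), if_pos ⟨s, hst, e2, e3⟩]
      · rw [h₃' t (by rw [e1]; exact hst), hold]
        refine if_congr ⟨?_, ?_⟩ rfl rfl
        · rintro ⟨t', h1, h2, h3⟩
          exact ⟨t', h1, h2, by rw [block_succ, block_succ, h3]⟩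
        · rintro ⟨t', h1, h2, h3⟩
          refine ⟨t', h1, h2, ?_⟩
          have h5 := block_mono (Λ := Λ) (l := l) (not_lt.1 hst)
          have h6 := block_mono (Λ := Λ) (l := l) (Fin.lt_def.1 h1).le
          rw [block_succ, block_succ] at e3 h3
          omega
  -- Block numbers at height `l` lie in `[2 ^ (Λ - l), 2 * 2 ^ (Λ - l))`. Different heights
  -- therefore use disjoint cells, and the tables are never cleared.
  · have hpow : 2 * 2 ^ (Λ - (l + 1)) = 2 ^ (Λ - l) := by
      rw [← pow_succ']
      congr 1
      omega
    rw [hpow] at hj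
    rw [n₅ _ (by omega), n₄ _ (by omega), n₃ _ (by omega), n₂ _ (by omega),
      h₁b _ _ fun t _ => (hj.trans_le (le_block hl.le)).ne', H.unused v j (by omega)]
  · rw [n₅ _ (by omega), n₄ _ (by omega), n₃ _ (by omega)]
    rcases Nat.lt_succ_iff_lt_or_eq.1 hl' with h1 | rfl
    · rw [n₂ _ (by omega), n₁']
      exact H.sibling l' h1 t
    · exact h₂ t
  · rw [n₅ b h2, n₄ b h3, n₃ b h4, n₂ b (by omega), n₁ b (by omega), H.frame b h1 h2 h3 h4]

theorem pointerProg_spec {Λ : ℕ} (hN : 0 < N) (hNΛ : N < 2 ^ (L + L)) (h4 : M 4 0 = N)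
    (h5 : M 5 0 = L) (h9 : M 9 0 = 2 ^ (L + L)) (hΛ : Λ = L + L)
    (h16 : ∀ t : Fin N, M 16 t = src t) (hz : ∀ b j, 40 ≤ b → M b j = 0) {Q : Mem → Prop}
    (hQ : ∀ M', Pointers src Λ Λ M M' → Q M') :
    Runs φ N pointerProg M (1000 * (L + L + 1)) Q := by
  subst hΛ
  refine Runs.mono_cost (S := 50 + (50 + (50 + ((L + L) * (20 + 300) + 20)))) ?_ (by linarith)
  refine Runs.seq (Runs.arcs hN h4 (by decide) fun M₁ h₁ _ _ n₁ => ?_)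
  have k4 : M₁ 4 0 = N := by rw [n₁ 4 (by decide), h4]
  refine Runs.seq (Runs.arcs hN k4 (by decide) fun M₂ h₂ _ _ n₂ => ?_)
  refine Runs.seq (Runs.assign hN (by decide) fun M₃ h₃ n₃ => ?_)
  simp only [Expr.eval] at h₁ h₂ h₃
  refine Runs.loop hN (fun l M' => Pointers src (L + L) l M M') (L + L) 300 ?_ ?_ ?_
    (by simp [Expr.size]; omega) hQ
  · refine ⟨h₃, fun t => ?_, fun t => ?_, fun v j _ => ?_, fun l' hl' => by omega,
      fun b _ h1 h2 h3 => by rw [n₃ b h1, n₂ b h3, n₁ b h2]⟩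
    · rw [n₃ 26 (by decide), n₂ 26 (by decide), h₁ t t.2 holds_lit_one, h9, block, pow_zero,
        Nat.div_one]
    · rw [n₃ 27 (by decide), h₂ t t.2 holds_lit_one, if_neg]
      rintro ⟨t', e1, -, e2⟩
      simp only [block, pow_zero, Nat.div_one, Fin.lt_def] at e1 e2
      omega
    · rw [n₃ _ (by omega), n₂ _ (by omega), n₁ _ (by omega), hz _ _ (by omega)]
  · intro l M₄ hl H
    refine ⟨?_, pointerStep_spec hN hNΛ hl h4 h16 H⟩
    simp only [holds_le, Expr.eval, H.counter]
    rw [H.frame 5, h5] <;> omega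
  · intro M₄ H
    simp only [holds_le, Expr.eval, H.counter]
    rw [H.frame 5, h5] <;> omega

/-- This is the zero flow inside `A`: the excess of a vertex of `A` is `q` times the number of its
boundary arcs. -/
theorem Progress.start (src : Fin N → Fin n) {rev : Fin N → Fin N}
    (hrev : Function.Involutive rev) (q : ℕ) (A : Finset (Fin n)) :
    Progress src rev q 0 A A (fun t => if src (rev t) ∈ A then q else 2 * q) where
  subset := subset_rfl
  isolated _ _ := Iff.rfl
  flow := by
    refine ⟨fun t h1 h2 => ?_, fun t _ h2 => if_neg h2⟩
    rw [hrev t, if_pos h1, if_pos h2]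
    ring
  mass := by
    have h1 : ∀ v, excess src (q + 0) (fun t => if src (rev t) ∈ A then q else 2 * q) v
        = outSum src (fun t => if src (rev t) ∈ Aᶜ then q else 0) v := by
      intro v
      have h2 : outSum src (fun t => if src (rev t) ∈ A then q else 2 * q) v
          = outSum src (fun t => q + if src (rev t) ∈ Aᶜ then q else 0) v := by
        refine outSum_congr fun t _ => ?_
        simp only [Finset.mem_compl, ite_not]
        split_ifs <;> ring
      rw [excess, h2, outSum_add, outSum_const, add_zero, Nat.add_sub_cancel_left]
    simp only [h1]
    rw [sum_outSum, ← Finset.sum_filter, Finset.filter_filter, ← across_const, pow_zero, one_mul]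
    rfl
  cut := by simp

theorem flowProg_spec (hM : Static src rev L q h T A M) {Q : Mem → Prop}
    (hQ : ∀ M', Static src rev L q h T A M' →
      (∀ t : Fin N, M' 18 t = if src t ∈ A then 1 else 0) →
      (∀ t : Fin N, M' 20 t = if src (rev t) ∈ A then q else 2 * q) → Q M') :
    Runs φ N flowProg M 200 Q := by
  refine Runs.mono_cost (S := 50 + (50 + 50)) ?_ (by omega)
  refine Runs.seq (hM.parallel' (by decide) fun M₁ hM₁ h₁ n₁ => ?_)
  refine Runs.seq (hM₁.parallel' (by decide) fun M₂ hM₂ h₂ n₂ => ?_)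
  refine hM₂.parallel (by decide) fun M₃ hM₃ h₃ h₃' n₃ => ?_
  simp only [Expr.eval, hM.source, hM.input] at h₁
  simp only [Expr.eval, hM₁.cap] at h₂
  refine hQ M₃ hM₃ (fun t => ?_) (fun t => ?_)
  · rw [n₃ 18 (by decide), n₂ 18 (by decide), h₁]
  · have hiff : (Expr.not (revOf 18)).Holds φ M₂ t ↔ src (rev t) ∉ A := by
      simp only [holds_not, holds_get, Expr.eval, hM₂.reverse, n₂ 18 (by decide), h₁]
      simp
    split_ifs with hc
    · rw [h₃' t (fun hcon => hiff.1 hcon hc), h₂]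
    · rw [h₃ t (hiff.2 hc)]
      simp only [Expr.eval, hM₂.cap]
      ring

end

end Pram

namespace Pram

open Trim

/-! ### Arcs of a graph with a list of its edges -/

section Arcs

variable {n m : ℕ} (e : Fin m → Fin n × Fin n)

/-- The source of an arc: the arc `k < m` is the edge number `k`, and `k + m` is its reversal. -/
def arcSrc (t : Fin (m + m)) : Fin n :=
  if h : (t : ℕ) < m then (e ⟨t, h⟩).1 else (e ⟨t - m, by omega⟩).2

/-- The reversal of an arc. -/
def arcRev (t : Fin (m + m)) : Fin (m + m) :=
  if h : (t : ℕ) < m then ⟨t + m, by omega⟩ else ⟨t - m, by omega⟩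

/-- The number of the edge of an arc. -/
def arcEdge (t : Fin (m + m)) : Fin m :=
  if h : (t : ℕ) < m then ⟨t, h⟩ else ⟨t - m, by omega⟩

theorem arcRev_involutive : Function.Involutive (arcRev (m := m)) := by
  intro t
  by_cases h : (t : ℕ) < m
  · simp [arcRev, h]
  · have h2 : (t : ℕ) - m < m := by omega
    ext
    simp only [arcRev, h, h2, dite_true, dite_false]
    omega

theorem arc_cases (t : Fin (m + m)) :
    ((t : ℕ) = arcEdge t ∧ arcSrc e t = (e (arcEdge t)).1 ∧ arcSrc e (arcRev t) = (e (arcEdge t)).2) ∨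
    ((t : ℕ) = arcEdge t + m ∧ arcSrc e t = (e (arcEdge t)).2 ∧
      arcSrc e (arcRev t) = (e (arcEdge t)).1) := by
  by_cases h : (t : ℕ) < m
  · left; simp [arcRev, arcSrc, arcEdge, h]
  · right
    have h2 : (t : ℕ) - m < m := by omega
    simp [arcRev, arcSrc, arcEdge, h, h2]
    omega

variable {e} {G : SimpleGraph (Fin n)} [DecidableRel G.Adj]

omit [DecidableRel G.Adj] in
theorem IsEdgeList.adj (he : IsEdgeList G e) (k : Fin m) : G.Adj (e k).1 (e k).2 := by
  rw [← SimpleGraph.mem_edgeSet, ← he.2]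
  exact ⟨k, rfl⟩

/-- Arcs are ordered pairs of adjacent vertices: each edge is listed once, and its two arcs give
different pairs because a simple graph has no loops. -/
theorem IsEdgeList.across_eq (he : IsEdgeList G e) (S T : Finset (Fin n)) :
    across (arcSrc e) arcRev (fun _ => 1) S T = cutSize G S T := by
  rw [across, cutSize, ← Finset.card_eq_sum_ones]
  refine Finset.card_bij (fun t _ => (arcSrc e t, arcSrc e (arcRev t))) ?_ ?_ ?_
  · intro t ht
    simp only [Finset.mem_filter, Finset.mem_univ, true_and] at ht
    rw [SimpleGraph.mem_interedges_iff]
    refine ⟨ht.1, ht.2, ?_⟩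
    rcases arc_cases e t with ⟨-, h1, h2⟩ | ⟨-, h1, h2⟩
    · simp only [h1, h2]; exact he.adj _
    · simp only [h1, h2]; exact (he.adj _).symm
  · intro t _ t' _ htt
    simp only [Prod.mk.injEq] at htt
    have hk : arcEdge t = arcEdge t' := by
      apply he.1
      simp only [Sym2.eq_iff]
      rcases arc_cases e t with ⟨-, h1, h2⟩ | ⟨-, h1, h2⟩ <;>
      rcases arc_cases e t' with ⟨-, h3, h4⟩ | ⟨-, h3, h4⟩ <;>
      rw [h1, h2, h3, h4] at htt <;> tauto
    have hne := (he.adj (arcEdge t)).ne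
    rcases arc_cases e t with ⟨h0, h1, h2⟩ | ⟨h0, h1, h2⟩ <;>
    rcases arc_cases e t' with ⟨h5, h3, h4⟩ | ⟨h5, h3, h4⟩ <;>
    rw [h1, h2, h3, h4, ← hk] at htt
    · exact Fin.ext (by rw [h0, h5, hk])
    · exact absurd htt.1 hne
    · exact absurd htt.2 hne
    · exact Fin.ext (by rw [h0, h5, hk])
  · rintro ⟨a, b⟩ hab
    rw [SimpleGraph.mem_interedges_iff] at hab
    obtain ⟨h1, h2, h3⟩ := hab
    have : s(a, b) ∈ Set.range (fun k => s((e k).1, (e k).2)) := by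
      rw [he.2]; exact h3
    obtain ⟨k, hk⟩ := this
    simp only [Sym2.eq_iff] at hk
    have e1 : arcSrc e ⟨k, by omega⟩ = (e k).1 := by simp [arcSrc]
    have e2 : arcSrc e ⟨k + m, by omega⟩ = (e k).2 := by simp [arcSrc]
    have e3 : arcRev (m := m) ⟨k, by omega⟩ = ⟨k + m, by omega⟩ := by simp [arcRev]
    have e4 : arcRev (m := m) ⟨k + m, by omega⟩ = ⟨k, by omega⟩ := by simp [arcRev]
    rcases hk with ⟨ha, hb⟩ | ⟨ha, hb⟩
    · refine ⟨⟨k, by omega⟩, ?_, ?_⟩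
      · rw [Finset.mem_filter, e3, e1, e2, ha, hb]
        exact ⟨Finset.mem_univ _, h1, h2⟩
      · rw [e3, e1, e2, ha, hb]
    · refine ⟨⟨k + m, by omega⟩, ?_, ?_⟩
      · rw [Finset.mem_filter, e4, e1, e2, ha, hb]
        exact ⟨Finset.mem_univ _, h1, h2⟩
      · rw [e4, e1, e2, ha, hb]

theorem IsEdgeList.outDeg_eq (he : IsEdgeList G e) (v : Fin n) :
    outDeg (arcSrc e) v = G.degree v := by
  have h1 : outDeg (arcSrc e) v = across (arcSrc e) arcRev (fun _ => 1) {v} Finset.univ := by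
    rw [← sum_outSum_eq_across, Finset.sum_singleton]
    rfl
  rw [h1, he.across_eq, cutSize, ← SimpleGraph.card_neighborFinset_eq_degree]
  refine (Finset.card_bij (fun w _ => (v, w)) ?_ ?_ ?_).symm
  · intro w hw
    simpa [SimpleGraph.mem_interedges_iff] using hw
  · intro w _ w' _ h
    simpa using h
  · rintro ⟨a, b⟩ hab
    rw [SimpleGraph.mem_interedges_iff] at hab
    obtain ⟨h1, -, h2⟩ := hab
    simp only [Finset.mem_singleton] at h1
    subst h1
    exact ⟨b, by simpa using h2, rfl⟩

theorem IsEdgeList.vol_eq (he : IsEdgeList G e) (S : Finset (Fin n)) :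
    ∑ v ∈ S, outDeg (arcSrc e) v = vol G S :=
  Finset.sum_congr rfl fun v _ => he.outDeg_eq v

end Arcs

/-- The trimming algorithm. -/
def trimProg : Prog :=
  .ite (.le (.var 0) (.lit 2)) .skip <|
  .ite (.leParam (.lit 1) (.get (.lit 0) (.lit 1)))
    -- The machine's test is not strict while `isInducedExpander_of_one_lt` needs `1 < φ`, hence a
    -- threshold above `1`. The value `9 / 8` is small enough for `loss_le_log_sq`.
    (.ite (.leParam (.lit 9) (.lit 8)) .skip <|
      .seq paramProg <| .seq arcProg <| .seq pointerProg <| .seq flowProg mainProg) .skip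

section

variable {φ : ℝ} {n m : ℕ}

theorem inputMem_of_le (e : Fin m → Fin n × Fin n) (A : Finset (Fin n)) {b j : ℕ} (hb : 4 ≤ b) :
    inputMem e A b j = 0 := by
  match b, hb with
  | b + 4, _ => rfl

theorem setup_spec (hm : 0 < m) (hφ : 0 < φ) (e : Fin m → Fin n × Fin n) (A : Finset (Fin n))
    {L q h T : ℕ} (hL : L = n.size) (hLpos : 0 < L) (hcard : m + m < 2 ^ (L + L))
    (hq : q = ⌈(3 * L : ℝ) / (2 * φ)⌉₊) (hh : h = 32 * q * (L + L)) (hT : T = 32 * q * h)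
    {Q : Mem → Prop}
    (hQ : ∀ M' A' r', outputSet n M' = A' → Progress (arcSrc e) arcRev q L A A' r' → Q M') :
    Runs φ (m + m) (.seq paramProg <| .seq arcProg <| .seq pointerProg <| .seq flowProg mainProg)
      (inputMem e A) (1000 * (L + q + h + 1) + (200 + (1000 * (L + L + 1) + (200 +
        1600 * (L + L + 1) * (T + h + 1) * (L + 1))))) Q := by
  have hN : 0 < m + m := by omega
  have hqpos : 0 < q := by
    rw [hq, Nat.ceil_pos]
    positivity
  refine Runs.seq (paramProg_spec hm hφ rfl rfl (fun b j hb => inputMem_of_le e A hb) hL hq hh hT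
    fun M₁ k4 k5 k6 k7 k8 k9 n₁ => ?_)
  refine Runs.seq (arcProg_spec hm (by rw [n₁ 0 (by decide)]; rfl) k4 fun M₂ h₂ h₂' n₂ => ?_)
  have hsrc : ∀ t : Fin (m + m), M₂ 16 t = arcSrc e t := by
    intro t
    by_cases ht : (t : ℕ) < m
    · rw [(h₂ t ht).1, n₁ 1 (by decide)]
      simp [inputMem, arcSrc, ht]
    · rw [(h₂' t (by omega) t.2).1, n₁ 2 (by decide)]
      have : (t : ℕ) - m < m := by omega
      simp [inputMem, arcSrc, ht, this]
  have hrev : ∀ t : Fin (m + m), M₂ 17 t = arcRev t := by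
    intro t
    by_cases ht : (t : ℕ) < m
    · rw [(h₂ t ht).2]
      simp [arcRev, ht]
    · rw [(h₂' t (by omega) t.2).2]
      simp [arcRev, ht]
  have hz : ∀ b j, 18 ≤ b → b ≠ 28 → M₂ b j = 0 := by
    intro b j hb hb'
    rw [n₂ b (by omega) (by omega), n₁ b (by omega)]
    exact inputMem_of_le e A (by omega)
  refine Runs.seq (pointerProg_spec hN hcard (by rw [n₂ 4, k4] <;> decide)
    (by rw [n₂ 5, k5] <;> decide) (by rw [n₂ 9, k9] <;> decide) rfl hsrc
    (fun b j hb => hz b j (by omega) (by omega)) fun M₃ H => ?_)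
  have hS : Static (arcSrc e) arcRev L q h T A M₃ := by
    refine ⟨hN, hcard, fun v => ?_, ?_, ?_, ?_, ?_, ?_, fun t => ?_, fun t => ?_, fun t => ?_,
      H.sibling, fun j _ => ?_, fun j _ => ?_⟩
    · rw [H.frame 3, n₂ 3, n₁ 3] <;> first | decide | skip
      simp [inputMem]
    · rw [H.frame 4, n₂ 4, k4] <;> decide
    · rw [H.frame 5, n₂ 5, k5] <;> decide
    · rw [H.frame 6, n₂ 6, k6] <;> decide
    · rw [H.frame 7, n₂ 7, k7] <;> decide
    · rw [H.frame 8, n₂ 8, k8] <;> decide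
    · rw [H.frame 16, hsrc] <;> decide
    · rw [H.frame 17, hrev] <;> decide
    · rw [H.leader]
      simp only [block_top (lt_trans (Fin.is_lt _) hcard), and_true]
    · rw [H.frame 22, hz] <;> decide
    · rw [H.frame 29, hz] <;> decide
  refine Runs.seq (flowProg_spec hS fun M₄ hS₄ h18 h20 => ?_)
  exact mainProg_spec arcRev_involutive hS₄ hqpos hLpos hh hT h18 h20
    (Progress.start _ arcRev_involutive q A) hQ

end

end Pram

/-! ### From the flow invariant to the graph -/

namespace Pram

open Trim

section

variable {n m : ℕ} {G : SimpleGraph (Fin n)} [DecidableRel G.Adj] {φ : ℝ} {A A' : Finset (Fin n)}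

theorem cutSize_union_right (S : Finset (Fin n)) {T T' : Finset (Fin n)} (h : Disjoint T T') :
    cutSize G S (T ∪ T') = cutSize G S T + cutSize G S T' := by
  rw [cutSize, cutSize, cutSize, ← Finset.card_union_of_disjoint]
  · congr 1
    ext p
    simp only [SimpleGraph.mem_interedges_iff, Finset.mem_union]
    tauto
  · rw [Finset.disjoint_left]
    intro p h1 h2
    rw [SimpleGraph.mem_interedges_iff] at h1 h2
    exact Finset.disjoint_left.1 h h1.2.1 h2.2.1

theorem cutSize_compl {S : Finset (Fin n)} (hS : S ⊆ A) :
    cutSize G S Sᶜ = cutSize G S (A \ S) + cutSize G S Aᶜ := by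
  rw [← cutSize_union_right]
  · congr 1
    ext v
    have := @hS v
    simp only [Finset.mem_compl, Finset.mem_union, Finset.mem_sdiff]
    tauto
  · exact Finset.disjoint_left.2 fun v h1 h2 =>
      (Finset.mem_compl.1 h2) (Finset.mem_sdiff.1 h1).1

theorem vol_mono {S T : Finset (Fin n)} (h : S ⊆ T) : vol G S ≤ vol G T :=
  Finset.sum_le_sum_of_subset h

/-- Graphs with at most two vertices do not have to be trimmed. -/
theorem isInducedExpander_of_le_two (hn : n ≤ 2) (hφ : 0 ≤ φ) (h : IsNearlyExpander G φ A) :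
    IsInducedExpander G (φ / 6) A := by
  intro S hS hvol
  have h6 : φ / 6 * vol G S ≤ φ * vol G S :=
    mul_le_mul_of_nonneg_right (by linarith) (Nat.cast_nonneg _)
  by_cases hA : A = Finset.univ
  · subst hA
    rw [← Finset.compl_eq_univ_sdiff]
    exact h6.trans (h S hS hvol)
  · have hcard : A.card ≤ 1 := by
      have := Finset.card_lt_univ_of_notMem (s := A) (x := (Finset.univ \ A).min' (by
        rw [Finset.sdiff_nonempty]
        exact fun h' => hA (Finset.univ_subset_iff.1 h')))
        (Finset.mem_sdiff.1 (Finset.min'_mem _ _)).2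
      rw [Fintype.card_fin] at this
      omega
    have hzero : vol G S = 0 := by
      rcases S.eq_empty_or_nonempty with rfl | hne
      · simp [vol]
      · have : S = A := Finset.eq_of_subset_of_card_le hS (by
          have := hne.card_pos
          omega)
        subst this
        simpa [vol] using hvol
    simp [hzero]

/-- A set without boundary does not have to be trimmed. -/
theorem isInducedExpander_of_cutSize_eq_zero (hφ : 0 ≤ φ) (h : IsNearlyExpander G φ A)
    (h0 : cutSize G A Aᶜ = 0) : IsInducedExpander G (φ / 6) A := by
  intro S hS hvol
  have h6 : φ / 6 * vol G S ≤ φ * vol G S :=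
    mul_le_mul_of_nonneg_right (by linarith) (Nat.cast_nonneg _)
  have h1 : cutSize G S Aᶜ = 0 := by
    refine Nat.le_zero.1 (le_trans (Finset.card_le_card fun p hp => ?_) h0.le)
    rw [SimpleGraph.mem_interedges_iff] at hp ⊢
    exact ⟨hS hp.1, hp.2⟩
  have h2 := h S hS hvol
  rw [cutSize_compl hS, h1, add_zero] at h2
  exact h6.trans h2

theorem IsEdgeList.cutSize_le_vol {e : Fin m → Fin n × Fin n} (he : IsEdgeList G e)
    (S T : Finset (Fin n)) : cutSize G S T ≤ vol G S := by
  rw [← he.across_eq, ← he.vol_eq]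
  unfold outDeg
  rw [sum_outSum]
  exact Finset.sum_le_sum_of_subset fun t ht => by
    simp only [Finset.mem_filter] at ht ⊢
    exact ⟨ht.1, ht.2.1⟩

/-- For `φ > 1` nothing has to be trimmed. -/
theorem isInducedExpander_of_one_lt {e : Fin m → Fin n × Fin n} (he : IsEdgeList G e)
    (hφ : 1 < φ) (h : IsNearlyExpander G φ A) :
    IsInducedExpander G (φ / 6) A := by
  intro S hS hvol
  have h1 := h S hS hvol
  have h2 : (cutSize G S Sᶜ : ℝ) ≤ vol G S := by exact_mod_cast he.cutSize_le_vol S Sᶜ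
  have h3 : (vol G S : ℝ) = 0 := by
    have : (0 : ℝ) ≤ vol G S := Nat.cast_nonneg _
    nlinarith
  rw [h3, mul_zero]
  exact Nat.cast_nonneg _

/-- The set that remains at the end is an expander. -/
theorem Progress.isInducedExpander {e : Fin m → Fin n × Fin n} (he : IsEdgeList G e)
    {q L : ℕ} {r : Fin (m + m) → ℕ} (H : Progress (arcSrc e) arcRev q L A A' r) (hq : 0 < q)
    (hex : ∑ v ∈ A', excess (arcSrc e) (q + L) r v = 0)
    (hqφ : (3 * L : ℝ) ≤ 2 * q * φ) (h : IsNearlyExpander G φ A) :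
    IsInducedExpander G (φ / 6) A' := by
  intro S hS hvol
  have hSA := hS.trans H.subset
  have h1 := h S hSA (hvol.trans (vol_mono (Finset.sdiff_subset_sdiff H.subset subset_rfl)))
  have h2 := H.flow.certificate arcRev_involutive hex hS
  rw [he.across_eq, he.across_eq, he.vol_eq] at h2
  rw [cutSize_compl hS] at h1
  by_contra! h3
  have h2' : (q : ℝ) * cutSize G S A'ᶜ ≤ L * vol G S + q * cutSize G S (A' \ S) := by
    exact_mod_cast h2
  push_cast at h1
  have hq' : (0 : ℝ) < q := by exact_mod_cast hq
  have h4 := mul_le_mul_of_nonneg_left h1 hq'.le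
  have h5 := mul_lt_mul_of_pos_left h3 hq'
  have h6 := mul_le_mul_of_nonneg_right hqφ (Nat.cast_nonneg (vol G S) : (0 : ℝ) ≤ vol G S)
  -- The facts combine to `q φ vol S ≤ L vol S + 2 q |E(S, A' \ S)|`. As `L ≤ 2 q φ / 3`, at least
  -- `q φ vol S / 3` remains for the last term, against `h3`.
  nlinarith

theorem Progress.cutSize_le {e : Fin m → Fin n × Fin n} (he : IsEdgeList G e)
    {q L : ℕ} {r : Fin (m + m) → ℕ} (H : Progress (arcSrc e) arcRev q L A A' r) (hq : 0 < q) :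
    cutSize G A' A'ᶜ ≤ cutSize G A Aᶜ := by
  have h1 := H.cut
  rw [he.across_eq, he.across_eq] at h1
  exact Nat.le_of_mul_le_mul_left (Nat.le_of_add_right_le h1) (by positivity)

theorem Progress.vol_le {e : Fin m → Fin n × Fin n} (he : IsEdgeList G e)
    {q L : ℕ} {r : Fin (m + m) → ℕ} (H : Progress (arcSrc e) arcRev q L A A' r) :
    15 * vol G A ≤ 15 * vol G A' + 16 * q * cutSize G A Aᶜ := by
  have h1 := H.cut
  rw [he.across_eq, he.across_eq, he.vol_eq] at h1
  have h2 : vol G A = vol G (A \ A') + vol G A' := (Finset.sum_sdiff H.subset).symm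
  omega

end

/-! ### Numerical estimates -/

/-- From `2 ≤ n.size` follows `n.size ≤ 2 (n.size - 1) ≤ 2 log n / log 2`, and `2 / log 2 < 3`. -/
theorem size_le_three_mul_log {n : ℕ} (hn : 2 ≤ n) : (n.size : ℝ) ≤ 3 * Real.log n := by
  have h1 : 2 ^ (n.size - 1) ≤ n := Nat.lt_size.1 (by
    have : 0 < n.size := Nat.size_pos.2 (by omega)
    omega)
  have h2 : 2 ≤ n.size := by
    have : 1 < n.size := Nat.lt_size.2 (by simpa using hn)
    omega
  have h3 : ((n.size - 1 : ℕ) : ℝ) * Real.log 2 ≤ Real.log n := by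
    rw [← Real.log_pow]
    exact Real.log_le_log (by positivity) (by exact_mod_cast h1)
  rw [Nat.cast_sub (by omega)] at h3
  have h4 := Real.log_two_gt_d9
  have h5 : (2 : ℝ) ≤ n.size := by exact_mod_cast h2
  push_cast at h3
  nlinarith

/-- For `φ < 9 / 8` the bracket on the left bounds `q φ`, so this matches the loss `16 q / 15` with
`4 log² n / φ`. It fails for `n = 2`. -/
theorem loss_le_log_sq {n : ℕ} (hn : 3 ≤ n) :
    16 * ((3 / 2 : ℝ) * n.size + 9 / 8) ≤ 15 * (4 * Real.log n ^ 2) := by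
  have h4 := Real.log_two_gt_d9
  rcases Nat.lt_or_ge n 4 with h | h
  · obtain rfl : n = 3 := by omega
    have hs : Nat.size 3 = 2 := by decide
    rw [hs]
    -- Bounding `log n` through `n.size` is too weak for `n = 3`; `2 ^ 19 ≤ 3 ^ 12` is sharp enough.
    have h3 : 19 * Real.log 2 ≤ 12 * Real.log 3 := by
      have := Real.log_le_log (x := 2 ^ 19) (y := 3 ^ 12) (by positivity) (by norm_num)
      rw [Real.log_pow, Real.log_pow] at this
      exact_mod_cast this
    have h5 : (1.09 : ℝ) ≤ Real.log 3 := by linarith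
    push_cast
    nlinarith
  · have h2 : 3 ≤ n.size := by
      have : 2 < n.size := Nat.lt_size.2 (by simpa using h)
      omega
    have h1 : 2 ^ (n.size - 1) ≤ n := Nat.lt_size.1 (by omega)
    have h3 : ((n.size - 1 : ℕ) : ℝ) * Real.log 2 ≤ Real.log n := by
      rw [← Real.log_pow]
      exact Real.log_le_log (by positivity) (by exact_mod_cast h1)
    rw [Nat.cast_sub (by omega)] at h3
    push_cast at h3
    have h5 : (3 : ℝ) ≤ n.size := by exact_mod_cast h2
    have h6 : ((n.size : ℝ) - 1) * 0.69 ≤ Real.log n := by nlinarith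
    have h7 : (((n.size : ℝ) - 1) * 0.69) ^ 2 ≤ Real.log n ^ 2 :=
      pow_le_pow_left₀ (by nlinarith) h6 2
    nlinarith

/-- The factor `4 ^ L` absorbs `2 * m`, and the remaining `2 ^ L ≥ L + 1` exceeds `3 / 4 * L + 9 /
16`. -/
theorem start_mass_lt {L : ℕ} (hL : 0 < L) {m : ℝ} (hm0 : 0 ≤ m) (hm : 2 * m ≤ 4 ^ L) :
    ((3 / 2 : ℝ) * L + 9 / 8) * m < 8 ^ L := by
  have h1 : ((L : ℝ) + 1) ≤ 2 ^ L := by exact_mod_cast Nat.lt_two_pow_self (n := L)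
  have h2 : (8 : ℝ) ^ L = 2 ^ L * 4 ^ L := by rw [← mul_pow]; norm_num
  have h3 : (1 : ℝ) ≤ L := by exact_mod_cast hL
  have h4 : (0 : ℝ) < 4 ^ L := by positivity
  rw [h2]
  nlinarith

/-- The number of time steps, up to constants. -/
theorem cost_le {L q h T : ℕ} (hL : 0 < L) (hq : 0 < q) (hh : h = 32 * q * (L + L))
    (hT : T = 32 * q * h) :
    50 + (1000 * (L + q + h + 1) + (200 + (1000 * (L + L + 1) + (200 +
      1600 * (L + L + 1) * (T + h + 1) * (L + 1))))) ≤ 10 ^ 8 * (L ^ 3 * q ^ 2) := by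
  have e1 : L ≤ L ^ 3 * q ^ 2 :=
    (Nat.le_self_pow (by norm_num) L).trans (Nat.le_mul_of_pos_right _ (by positivity))
  have e2 : q ≤ L ^ 3 * q ^ 2 :=
    (Nat.le_self_pow (by norm_num) q).trans (Nat.le_mul_of_pos_left _ (by positivity))
  have e3 : 1 ≤ L ^ 3 * q ^ 2 := Nat.one_le_iff_ne_zero.2 (by positivity)
  have e4 : h ≤ 64 * (L ^ 3 * q ^ 2) := by
    have a1 : L ≤ L ^ 3 := Nat.le_self_pow (by norm_num) L
    have a2 : q ≤ q ^ 2 := Nat.le_self_pow (by norm_num) q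
    have := Nat.mul_le_mul a1 a2
    rw [hh]
    nlinarith
  have e5 : T + h + 1 ≤ 2113 * (L * q ^ 2) := by
    have a2 : q ≤ q ^ 2 := Nat.le_self_pow (by norm_num) q
    have a3 := Nat.mul_le_mul_left L a2
    have a4 : 1 ≤ L * q ^ 2 := Nat.one_le_iff_ne_zero.2 (by positivity)
    have a5 : T = 2048 * (L * q ^ 2) := by rw [hT, hh]; ring
    have a6 : h = 64 * (L * q) := by rw [hh]; ring
    omega
  have e6 : 1600 * (L + L + 1) * (T + h + 1) * (L + 1)
      ≤ 1600 * (3 * L) * (2113 * (L * q ^ 2)) * (2 * L) := by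
    gcongr
    · omega
    · omega
  have e7 : 1600 * (3 * L) * (2113 * (L * q ^ 2)) * (2 * L) = 20284800 * (L ^ 3 * q ^ 2) := by ring
  linarith

end Pram

/-! ### Correctness and cost of the whole algorithm -/

namespace Pram

open Trim

/-- The properties of the output `A'` of the algorithm on the input `A`. -/
def IsTrimmed {n : ℕ} (G : SimpleGraph (Fin n)) [DecidableRel G.Adj] (φ : ℝ)
    (A A' : Finset (Fin n)) : Prop :=
  A' ⊆ A ∧ IsInducedExpander G (φ / 6) A' ∧
    (vol G A : ℝ) - 4 * Real.log n ^ 2 / φ * (cutSize G A Aᶜ : ℝ) ≤ (vol G A' : ℝ) ∧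
    cutSize G A' A'ᶜ ≤ 2 * cutSize G A Aᶜ

/-- In three cases `A` itself is returned: `n ≤ 2`; `m φ < 1`, where the boundary of `A` is empty
(this covers `φ = 0`); and `φ ≥ 9 / 8`, where near expansion only allows sets of volume zero. The
maximum with `1` accounts for graphs without edges. -/
theorem trimProg_spec {n m : ℕ} {G : SimpleGraph (Fin n)} [DecidableRel G.Adj] {φ : ℝ}
    {A : Finset (Fin n)} {e : Fin m → Fin n × Fin n} (hm : m = G.edgeFinset.card)
    (he : IsEdgeList G e) (hφ : 0 ≤ φ) (hnear : IsNearlyExpander G φ A)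
    (hcut : (cutSize G A Aᶜ : ℝ) ≤ φ * m) :
    ∃ S, Runs φ (max 1 (m + m)) trimProg (inputMem e A) S
        (fun M => IsTrimmed G φ A (outputSet n M)) ∧
      (0 < φ → φ ≤ 1 → 1 ≤ m → (S : ℝ) ≤ 4 * 10 ^ 11 * Real.log n ^ 5 / φ ^ 2) := by
  have hNpos : 0 < max 1 (m + m) := by omega
  have hmcard : 2 * m ≤ n * (n - 1) := by
    have h1 := SimpleGraph.card_edgeFinset_le_card_choose_two (G := G)
    rw [← hm, Fintype.card_fin, Nat.choose_two_right] at h1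
    have := Nat.div_mul_le_self (n * (n - 1)) 2
    omega
  have htriv : IsInducedExpander G (φ / 6) A → IsTrimmed G φ A (outputSet n (inputMem e A)) := by
    intro h
    have hout : outputSet n (inputMem e A) = A := by
      ext v
      simp [outputSet, inputMem]
    rw [hout]
    refine ⟨subset_rfl, h, ?_, by omega⟩
    have : 0 ≤ 4 * Real.log n ^ 2 / φ * (cutSize G A Aᶜ : ℝ) := by positivity
    linarith
  -- The early exits must meet the cost bound too; an edge forces `2 ≤ n`, so `log n ≥ 1 / 2`.
  have hlow : 0 < φ → φ ≤ 1 → 1 ≤ m → (50 : ℝ) ≤ 4 * 10 ^ 11 * Real.log n ^ 5 / φ ^ 2 := by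
    intro hφ0 hφ1 hm1
    have hn : 2 ≤ n := by
      by_contra hn
      have : n * (n - 1) = 0 := Nat.mul_eq_zero.2 (by omega)
      omega
    have h1 : Real.log 2 ≤ Real.log n := Real.log_le_log (by norm_num) (by exact_mod_cast hn)
    have h2 : (1 / 2 : ℝ) ≤ Real.log n := by
      have := Real.log_two_gt_d9
      linarith
    have h3 : (1 / 2 : ℝ) ^ 5 ≤ Real.log n ^ 5 := pow_le_pow_left₀ (by norm_num) h2 5
    rw [le_div_iff₀ (by positivity)]
    have h4 : φ ^ 2 ≤ 1 := pow_le_one₀ hφ hφ1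
    norm_num at h3
    linarith
  by_cases hn : n ≤ 2
  · refine ⟨50, Runs.ite (S := 40) hNpos (fun _ => Runs.skip (htriv ?_)) (fun hc => ?_)
      (by decide), by exact_mod_cast hlow⟩
    · exact isInducedExpander_of_le_two hn hφ hnear
    · exact absurd hn (by simpa [Expr.eval, inputMem] using hc)
  by_cases hmφ : (1 : ℝ) ≤ m * φ
  swap
  · refine ⟨50, Runs.ite (S := 40) hNpos (fun hc => ?_) (fun _ => Runs.ite (S := 20) hNpos
      (fun hc => ?_) (fun _ => Runs.skip (htriv ?_)) (by decide)) (by decide),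
      by exact_mod_cast hlow⟩
    · exact absurd (by simpa [Expr.eval, inputMem] using hc) hn
    · exact absurd (by simpa [Expr.eval, inputMem] using hc) hmφ
    · refine isInducedExpander_of_cutSize_eq_zero hφ hnear ?_
      have : (cutSize G A Aᶜ : ℝ) < 1 := by linarith
      exact Nat.lt_one_iff.1 (by exact_mod_cast this)
  by_cases hφ8 : (9 : ℝ) ≤ 8 * φ
  · refine ⟨50, Runs.ite (S := 40) hNpos (fun hc => ?_) (fun _ => Runs.ite (S := 30) hNpos
      (fun _ => Runs.ite (S := 20) hNpos (fun _ => Runs.skip (htriv ?_)) (fun hc => ?_) (by decide))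
      (fun hc => ?_) (by decide)) (by decide), by exact_mod_cast hlow⟩
    · exact absurd (by simpa [Expr.eval, inputMem] using hc) hn
    · exact isInducedExpander_of_one_lt he (by linarith) hnear
    · exact absurd hφ8 (by simpa [Expr.eval] using hc)
    · exact absurd hmφ (by simpa [Expr.eval, inputMem] using hc)
  have hmpos : 0 < m := Nat.pos_of_ne_zero fun h0 => by
    rw [h0] at hmφ
    norm_num at hmφ
  have hφ0 : 0 < φ := by
    rcases hφ.lt_or_eq with h | h
    · exact h
    · rw [← h] at hmφ
      norm_num at hmφ
  rw [max_eq_right (by omega)]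
  rw [max_eq_right (by omega)] at hNpos
  set L := n.size with hL
  have hLpos : 0 < L := Nat.size_pos.2 (by omega)
  obtain ⟨q, hq⟩ : ∃ q, q = ⌈(3 * L : ℝ) / (2 * φ)⌉₊ := ⟨_, rfl⟩
  have hqpos : 0 < q := by
    rw [hq, Nat.ceil_pos]
    positivity
  have hqlow : (3 * L : ℝ) ≤ 2 * q * φ := by
    have := Nat.le_ceil ((3 * L : ℝ) / (2 * φ))
    rw [← hq, div_le_iff₀ (by positivity)] at this
    linarith
  have hqhigh : (q : ℝ) * φ ≤ 3 / 2 * L + φ := by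
    have := (Nat.ceil_lt_add_one (a := (3 * L : ℝ) / (2 * φ)) (by positivity)).le
    rw [← hq] at this
    have h1 := mul_le_mul_of_nonneg_right this hφ
    have h2 : ((3 * L : ℝ) / (2 * φ) + 1) * φ = 3 / 2 * L + φ := by field_simp
    linarith
  -- This makes the `2 m` arcs fit below a tree of height `L + L`, and it also gives `2 * m ≤ 4 ^ L`
  -- for the starting mass.
  have hpow : n * (n - 1) < 2 ^ (L + L) := by
    have h1 : n < 2 ^ L := Nat.lt_size_self n
    rw [pow_add]
    exact Nat.mul_lt_mul'' h1 (by omega)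
  obtain ⟨h, hh⟩ : ∃ h, h = 32 * q * (L + L) := ⟨_, rfl⟩
  obtain ⟨T, hT⟩ : ∃ T, T = 32 * q * h := ⟨_, rfl⟩
  refine ⟨10 ^ 8 * (L ^ 3 * q ^ 2), Runs.mono_cost ?_ (cost_le hLpos hqpos hh hT), ?_⟩
  · have hsetup : Runs φ (m + m) (.seq paramProg <| .seq arcProg <| .seq pointerProg <|
        .seq flowProg mainProg) (inputMem e A) _
        (fun M => IsTrimmed G φ A (outputSet n M)) :=
      setup_spec hmpos hφ0 e A hL hLpos (by omega) hq hh hT fun M' A' r' hout H => by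
        rw [hout]
        -- The excess is a natural number, and `8 ^ L` times it is less than `8 ^ L`.
        have hex : ∑ v ∈ A', excess (arcSrc e) (q + L) r' v = 0 := by
          have h1 := H.mass
          rw [he.across_eq] at h1
          have h2 := start_mass_lt hLpos (Nat.cast_nonneg (α := ℝ) m) (by
            have : 2 * m ≤ 4 ^ L := by
              rw [show (4 : ℕ) = 2 * 2 from rfl, mul_pow, ← pow_add]
              omega
            exact_mod_cast this)
          have h3 : (q : ℝ) * cutSize G A Aᶜ < 8 ^ L := by
            refine lt_of_le_of_lt ?_ h2
            calc (q : ℝ) * cutSize G A Aᶜ ≤ q * (φ * m) :=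
                  mul_le_mul_of_nonneg_left hcut (Nat.cast_nonneg _)
              _ = q * φ * m := by ring
              _ ≤ _ := by
                  refine mul_le_mul_of_nonneg_right ?_ (Nat.cast_nonneg _)
                  linarith
          have h4 : q * cutSize G A Aᶜ < 8 ^ L := by exact_mod_cast h3
          by_contra h0
          have h5 := Nat.le_mul_of_pos_right (8 ^ L) (Nat.pos_of_ne_zero h0)
          omega
        refine ⟨H.subset, H.isInducedExpander he hqpos hex hqlow hnear, ?_,
          (H.cutSize_le he hqpos).trans (by omega)⟩
        have h1 : (15 * vol G A : ℝ) ≤ 15 * vol G A' + 16 * q * cutSize G A Aᶜ := by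
          exact_mod_cast H.vol_le he
        have h2 := loss_le_log_sq (n := n) (by omega)
        rw [← hL] at h2
        have h3 : 16 * (q : ℝ) ≤ 15 * (4 * Real.log n ^ 2 / φ) := by
          rw [← mul_div_assoc, le_div_iff₀ hφ0]
          linarith
        have h4 := mul_le_mul_of_nonneg_right h3 (Nat.cast_nonneg (α := ℝ) (cutSize G A Aᶜ))
        linarith
    refine Runs.ite hNpos (fun hc => ?_) (fun _ => Runs.ite hNpos (fun _ => Runs.ite hNpos
      (fun hc => ?_) (fun _ => hsetup) le_rfl) (fun hc => ?_) le_rfl) ?_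
    · exact absurd (by simpa [Expr.eval, inputMem] using hc) hn
    · exact absurd (by simpa [Expr.eval] using hc) hφ8
    · exact absurd hmφ (by simpa [Expr.eval, inputMem] using hc)
    · simp only [Expr.size]
      linarith
  · intro _ hφ1 _
    have h1 : (L : ℝ) ≤ 3 * Real.log n := size_le_three_mul_log (by omega)
    have hL1 : (1 : ℝ) ≤ L := by exact_mod_cast hLpos
    have h2 : (q : ℝ) * φ ≤ 5 / 2 * L := by linarith
    have h3 : ((q : ℝ) * φ) ^ 2 ≤ (5 / 2 * L) ^ 2 := pow_le_pow_left₀ (by positivity) h2 2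
    rw [le_div_iff₀ (by positivity)]
    push_cast
    calc (100000000 : ℝ) * ((L : ℝ) ^ 3 * (q : ℝ) ^ 2) * φ ^ 2
        = 100000000 * (L : ℝ) ^ 3 * (q * φ) ^ 2 := by ring
      _ ≤ 100000000 * (L : ℝ) ^ 3 * (5 / 2 * L) ^ 2 := by gcongr
      _ = 625000000 * (L : ℝ) ^ 5 := by ring
      _ ≤ 625000000 * (3 * Real.log n) ^ 5 := by gcongr
      _ = 151875000000 * Real.log n ^ 5 := by ring
      _ ≤ 4 * 10 ^ 11 * Real.log n ^ 5 := by
          have : 0 ≤ Real.log n ^ 5 := pow_nonneg (Real.log_natCast_nonneg n) 5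
          linarith

end Pram

theorem mainTheorem2 :
    ∃ (Trimming : Pram.Prog) (C : ℝ) (k : ℕ),
      ∀ (n : ℕ) (G : SimpleGraph (Fin n)) [DecidableRel G.Adj] (φ : ℝ) (A : Finset (Fin n))
        (e : Fin G.edgeFinset.card → Fin n × Fin n),
        Pram.IsEdgeList G e →
        0 ≤ φ →
        IsNearlyExpander G φ A →
        (cutSize G A Aᶜ : ℝ) ≤ φ * (G.edgeFinset.card : ℝ) →
        ∃ (M : Pram.Mem) (work span : ℕ) (A' : Finset (Fin n)),
          Pram.Exec φ Trimming (Pram.inputMem e A) M work span ∧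
          A' = Pram.outputSet n M ∧
          A' ⊆ A ∧
          IsInducedExpander G (φ / 6) A' ∧
          (vol G A : ℝ) - 4 * Real.log n ^ 2 / φ * (cutSize G A Aᶜ : ℝ) ≤ (vol G A' : ℝ) ∧
          cutSize G A' A'ᶜ ≤ 2 * cutSize G A Aᶜ ∧
          (0 < φ → φ ≤ 1 → 1 ≤ G.edgeFinset.card →
            (work : ℝ) ≤ C * Real.log n ^ k * ((G.edgeFinset.card : ℝ) / φ ^ 2) ∧
            (span : ℝ) ≤ C * Real.log n ^ k * (1 / φ ^ 3)) := by
  refine ⟨Pram.trimProg, 10 ^ 12, 5, ?_⟩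
  intro n G _ φ A e he hφ hnear hcut
  obtain ⟨S, ⟨M, w, s, hexec, hs, hw, h1, h2, h3, h4⟩, hS⟩ :=
    Pram.trimProg_spec rfl he hφ hnear hcut
  refine ⟨M, w, s, Pram.outputSet n M, hexec, rfl, h1, h2, h3, h4, fun hφ0 hφ1 hm1 => ?_⟩
  specialize hS hφ0 hφ1 hm1
  set m := G.edgeFinset.card
  have hlog : 0 ≤ Real.log n := Real.log_natCast_nonneg n
  rw [max_eq_right (by omega)] at hw
  constructor
  · have h5 : (w : ℝ) ≤ (m + m : ℝ) * S := by exact_mod_cast hw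
    calc (w : ℝ) ≤ (m + m : ℝ) * (4 * 10 ^ 11 * Real.log n ^ 5 / φ ^ 2) :=
          h5.trans (mul_le_mul_of_nonneg_left hS (by positivity))
      _ = 8 * 10 ^ 11 * Real.log n ^ 5 * (m / φ ^ 2) := by ring
      _ ≤ _ := by gcongr; norm_num
  · have h5 : (s : ℝ) ≤ S := by exact_mod_cast hs
    -- The span is in fact of order `1 / φ ^ 2` up to logarithms; `φ ≤ 1` weakens this to the cubic
    -- bound.
    have h6 : 1 / φ ^ 2 ≤ 1 / φ ^ 3 :=
      one_div_le_one_div_of_le (by positivity) (pow_le_pow_of_le_one hφ0.le hφ1 (by norm_num))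
    calc (s : ℝ) ≤ 4 * 10 ^ 11 * Real.log n ^ 5 * (1 / φ ^ 2) := by
          rw [mul_one_div]; exact h5.trans hS
      _ ≤ 4 * 10 ^ 11 * Real.log n ^ 5 * (1 / φ ^ 3) := by gcongr
      _ ≤ _ := by gcongr; norm_num
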